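/- Let $n\ge 2$ be an integer, let $q_{11},\dots,q_{nn}>0$, $q=\mathrm{diag}(q_{11},\dots,q_{nn})$, $Q=\prod_{j=1}^n\,]0,q_{jj}[$, let $|Q|$ be the Lebesgue measure of $Q$, and $q\mathbb Z^n=\{qz: z\in\mathbb Z^n\}$. Let $\omega\in\,]1-(2/n),+\infty[$ and $L[\omega]=\Delta+\omega\nabla\mathrm{div}$, acting on the columns of $n\times n$ matrices. Let $s_n$ be the $(n-1)$-dimensional measure of the unit sphere of $\mathbb R^n$, let $S_2(x)=\frac1{s_2}\log|x|$ and $S_n(x)=\frac{1}{(2-n)s_n}|x|^{2-n}$ for $n>2$, and, for $x\in\mathbb R^n\setminus\{0\}$, let $\Gamma_{n,\omega}(x)$ be the matrix with entries $$\Gamma_{n,\omega,i}^j(x)=\frac{\omega+2}{2(\omega+1)}\delta_{i,j}S_n(x)-\frac{\omega}{2(\omega+1)}\frac1{s_n}\frac{x_ix_j}{|x|^n}.$$ For $z\in\mathbb Z^n$ let $E_{2\pi i q^{-1}z}(x)=e^{2\pi i (q^{-1}z)\cdot x}$. Then for all $j,k\in\{1,\dots,n\}$ the series $$\Gamma^{q,k}_{n,\omega,j}=\sum_{z\in\mathbb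 Z^n\setminus\{0\}}\frac{1}{4\pi^2|Q||q^{-1}z|^2}\Bigl[-\delta_{j,k}+\frac{\omega}{\omega+1}\frac{(q^{-1}z)_j(q^{-1}z)_k}{|q^{-1}z|^2}\Bigr]E_{2\pi i q^{-1}z}$$ converges unconditionally in the space $\mathcal S'(\mathbb R^n,\mathbb C)$ of tempered distributions (with respect to pointwise convergence on Schwartz functions), and the matrix $\Gamma^q_{n,\omega}=(\Gamma^{q,k}_{n,\omega,j})_{j,k}$ of tempered distributions has the following properties. (i) $\Gamma^{q,k}_{n,\omega,j}$ is invariant under translation by $q_{ll}e_l$ for all $l,j,k\in\{1,\dots,n\}$. (ii) $\overline{\langle\Gamma^{q,k}_{n,\omega,j},\overline f\rangle}=\langle\Gamma^{q,k}_{n,\omega,j},f\rangle$ for every Schwartz function $f$ and all $j,k$. (iii) $L[\omega]\Gamma^q_{n,\omega}=\sum_{z\in\mathbb Z^n}\delta_{qz}I_n-\frac1{|Q|}I_n$ in $M_n(\mathcal S'(\mathbb R^n,\mathbb C))$, where $\delta_{qz}$ is the Dirac measure at $qz$, and the series $\sum_{z\in\mathbb Z^n}\delta_{qz}$ converges unconditionally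 in $\mathcal S'(\mathbb R^n,\mathbb C)$. Moreover, there is a function from $\mathbb R^n$ to $M_n(\mathbb R)$, again denoted by $\Gamma^q_{n,\omega}$, such that the following hold. (iv) It is real analytic on $\mathbb R^n\setminus q\mathbb Z^n$. (v) There is a function $R^q_{n,\omega}$ from $\mathbb R^n$ to $M_n(\mathbb R)$ with locally integrable entries that is real analytic on $(\mathbb R^n\setminus q\mathbb Z^n)\cup\{0\}$, coincides with $\Gamma^q_{n,\omega}-\Gamma_{n,\omega}$ on $\mathbb R^n\setminus q\mathbb Z^n$, and satisfies $L[\omega]R^q_{n,\omega}=\sum_{z\in\mathbb Z^n\setminus\{0\}}\delta_{qz}I_n-\frac1{|Q|}I_n$ in the sense of distributions on $\mathbb R^n$. (vi) Its entries are locally integrable on $\mathbb R^n$ and represent the distributions $\Gamma^{q,k}_{n,\omega,j}$: for every Schwartz function $f$, the product of the $(j,k)$ entry and $f$ is integrable and its integral is $\langle\Gamma^{q,k}_{n,\omega,j},f\rangle$. (vii) $\Gamma^q_{n,\omega}(x)=\Gamma^q_{n,\omega}(-x)$ for all $x\in\mathbb R^n\setminus q\mathbb Z^n$. -/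

import Mathlib

open MeasureTheory SchwartzMap LineDeriv
open scoped Distributions

namespace PeriodicElastic

noncomputable section

variable {n : ℕ}

/-! ### The lattice and the periodicity cell

The diagonal matrix `q` is given by its diagonal entries `q : Fin n → ℝ`. -/

/-- The open periodicity cell `Q = ∏ ]0, q_jj[`. -/
def cell (q : Fin n → ℝ) : Set (EuclideanSpace ℝ (Fin n)) :=
  {x | ∀ j, x j ∈ Set.Ioo 0 (q j)}

/-- The measure `|Q|` of the periodicity cell. -/
def cellVol (q : Fin n → ℝ) : ℝ := volume.real (cell q)

/-- The lattice point `q z`. -/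
def latticePt (q : Fin n → ℝ) (z : Fin n → ℤ) : EuclideanSpace ℝ (Fin n) :=
  WithLp.toLp 2 fun j => q j * (z j : ℝ)

/-- The dual lattice point `q⁻¹ z`. -/
def dualPt (q : Fin n → ℝ) (z : Fin n → ℤ) : EuclideanSpace ℝ (Fin n) :=
  WithLp.toLp 2 fun j => (q j)⁻¹ * (z j : ℝ)

/-- The lattice `q ℤⁿ`. -/
def lattice (q : Fin n → ℝ) : Set (EuclideanSpace ℝ (Fin n)) := Set.range (latticePt q)

/-! ### The fundamental solution of `L[ω]` in `ℝⁿ` -/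

/-- The `(n-1)`-dimensional measure `s_n` of the unit sphere of `ℝⁿ`. -/
def sphereArea (n : ℕ) : ℝ :=
  (volume : Measure (EuclideanSpace ℝ (Fin n))).toSphere.real Set.univ

/-- The fundamental solution `S_n` of the Laplace operator in `ℝⁿ`, `n ≥ 2`. -/
def laplaceFund (x : EuclideanSpace ℝ (Fin n)) : ℝ :=
  if n = 2 then 1 / sphereArea n * Real.log ‖x‖
  else 1 / ((2 - (n : ℝ)) * sphereArea n) * ‖x‖ ^ (2 - (n : ℤ))

/-- The matrix valued fundamental solution `Γ_{n,ω}` of `L[ω]` in `ℝⁿ`. -/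
def elasticFund (ω : ℝ) (x : EuclideanSpace ℝ (Fin n)) : Matrix (Fin n) (Fin n) ℝ :=
  Matrix.of fun i j =>
    (ω + 2) / (2 * (ω + 1)) * (if i = j then 1 else 0) * laplaceFund x
      - ω / (2 * (ω + 1)) * (1 / sphereArea n) * (x i * x j / ‖x‖ ^ n)

/-! ### The operator `L[ω] = Δ + ω ∇ div` -/

/-- The operator `L[ω] = Δ + ω ∇ div` acting on (the columns of) a matrix of distributions;
`D` is one of the spaces `𝓢'(ℝⁿ, ℂ)` or `𝓓'(ℝⁿ, ℝ)`. -/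
def lameOp {D : Type*} [AddCommGroup D] [Module ℝ D] [LineDeriv (EuclideanSpace ℝ (Fin n)) D D]
    (ω : ℝ) (U : Matrix (Fin n) (Fin n) D) : Matrix (Fin n) (Fin n) D :=
  Matrix.of fun j k =>
    (∑ l : Fin n, ∂_{EuclideanSpace.single l (1 : ℝ)} (∂_{EuclideanSpace.single l (1 : ℝ)} (U j k)))
      + ω • ∂_{EuclideanSpace.single j (1 : ℝ)}
          (∑ l : Fin n, ∂_{EuclideanSpace.single l (1 : ℝ)} (U l k))

/-! ### Tempered distributions -/

/-- The function `E_{2πiξ}(x) = exp (2πi ξ·x)`. -/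
def expFun (ξ x : EuclideanSpace ℝ (Fin n)) : ℂ :=
  Complex.exp (2 * Real.pi * Complex.I * (inner ℝ ξ x : ℝ))

theorem expI_hasTemperateGrowth :
    Function.HasTemperateGrowth (fun t : ℝ => Complex.exp (2 * Real.pi * Complex.I * (t : ℂ))) := by
  set c : ℂ := 2 * Real.pi * Complex.I with hc
  have hd : ∀ (k : ℕ) (b : ℂ) , iteratedDeriv k (fun t : ℝ => b * Complex.exp (c * (t : ℂ)))
      = fun t : ℝ => (b * c ^ k) * Complex.exp (c * (t : ℂ)) := by
    intro k
    induction k with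
    | zero => intro b; simp
    | succ k ih =>
      intro b
      rw [iteratedDeriv_succ']
      have h1 : deriv (fun t : ℝ => b * Complex.exp (c * (t : ℂ)))
          = fun t : ℝ => (b * c) * Complex.exp (c * (t : ℂ)) := by
        funext t
        have h2 : HasDerivAt (fun t : ℝ => c * (t : ℂ)) (c * 1) t :=
          (Complex.ofRealCLM.hasDerivAt (x := t)).const_mul c
        have h3 := (h2.cexp).const_mul b
        rw [h3.deriv]; ring
      rw [h1, ih]
      funext t; ring
  refine ⟨?_, ?_⟩
  · exact (contDiff_const.mul Complex.ofRealCLM.contDiff).cexp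
  · intro k
    refine ⟨0, ‖c ^ k‖, fun t => ?_⟩
    rw [norm_iteratedFDeriv_eq_norm_iteratedDeriv]
    have h := congrFun (hd k 1) t
    simp only [one_mul] at h
    rw [h, norm_mul]
    have h4 : ‖Complex.exp (c * (t : ℂ))‖ = 1 := by
      rw [Complex.norm_exp, hc]
      simp
    rw [h4]; simp

theorem expFun_hasTemperateGrowth (ξ : EuclideanSpace ℝ (Fin n)) :
    Function.HasTemperateGrowth (expFun ξ) :=
  expI_hasTemperateGrowth.comp (Function.hasTemperateGrowth_inner_right ξ)

/-- `E_{2πiξ}` as a tempered distribution, `f ↦ ∫ f(x) exp (2πi ξ·x) dx`. -/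
def expDist (ξ : EuclideanSpace ℝ (Fin n)) : 𝓢'(EuclideanSpace ℝ (Fin n), ℂ) :=
  Function.HasTemperateGrowth.toTemperedDistribution volume (expFun_hasTemperateGrowth ξ)

/-- The translate `τ_y u` of a tempered distribution, `⟨τ_y u, f⟩ = ⟨u, f(· + y)⟩`. -/
def translateDistr (y : EuclideanSpace ℝ (Fin n)) (u : 𝓢'(EuclideanSpace ℝ (Fin n), ℂ)) :
    𝓢'(EuclideanSpace ℝ (Fin n), ℂ) :=
  PointwiseConvergenceCLM.precomp ℂ (SchwartzMap.compSubConstCLM ℂ (-y)) u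

/-- The complex conjugate of a Schwartz function. -/
def conjS (f : 𝓢(EuclideanSpace ℝ (Fin n), ℂ)) : 𝓢(EuclideanSpace ℝ (Fin n), ℂ) :=
  SchwartzMap.postcompCLM (𝕜 := ℝ) (Complex.conjCLE : ℂ →L[ℝ] ℂ) f

/-! ### The periodic fundamental solution -/

/-- The Fourier coefficient of index `z` of the `(j,k)` entry of `Γ^q_{n,ω}`. -/
def perCoeff (q : Fin n → ℝ) (ω : ℝ) (j k : Fin n) (z : Fin n → ℤ) : ℝ :=
  1 / (4 * Real.pi ^ 2 * cellVol q * ‖dualPt q z‖ ^ 2) *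
    (-(if j = k then 1 else 0)
      + ω / (ω + 1) * (dualPt q z j * dualPt q z k / ‖dualPt q z‖ ^ 2))

/-- The terms of the Fourier series of the `(j,k)` entry of `Γ^q_{n,ω}`. -/
def perTerm (q : Fin n → ℝ) (ω : ℝ) (j k : Fin n) (z : {z : Fin n → ℤ // z ≠ 0}) :
    𝓢'(EuclideanSpace ℝ (Fin n), ℂ) :=
  ((perCoeff q ω j k z : ℝ) : ℂ) • expDist (dualPt q z)

/-- The matrix `Γ^q_{n,ω}` of tempered distributions: the sum of the Fourier series in `𝓢'`. -/
def perFund (q : Fin n → ℝ) (ω : ℝ) :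
    Matrix (Fin n) (Fin n) (𝓢'(EuclideanSpace ℝ (Fin n), ℂ)) :=
  Matrix.of fun j k => ∑' z : {z : Fin n → ℤ // z ≠ 0}, perTerm q ω j k z

/-! ### Distributions given by locally integrable functions -/

/-- The real distribution on `ℝⁿ` given by a locally integrable function,
`φ ↦ ∫ φ(x) g(x) dx`. -/
def toDistr (g : EuclideanSpace ℝ (Fin n) → ℝ) :
    𝓓'((⊤ : TopologicalSpace.Opens (EuclideanSpace ℝ (Fin n))), ℝ) :=
  TestFunction.integralAgainstBilinCLM (ContinuousLinearMap.mul ℝ ℝ) volume g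

end

end PeriodicElastic

/-!
The periodic fundamental solution of `L[ω]` is obtained by Ewald's splitting. In the variable
`s = 1/(4t)`, where `t` is the time of the heat equation, the fundamental solution `Γ_{n,ω}` is, up
to an additive constant matrix, a superposition over `s ∈ ]0, ∞[` of the Gaussian kernels `heatKer`;
for `n = 2` their values at the origin have to be subtracted for `s ≤ 1`, to make the integral
converge. The parameters `s > 1` give `shortPart`, singular at the origin and with Gaussian decay,
and the parameters `s ≤ 1` give `regPart`, analytic at the origin (`exists_elasticFund_eq`,
`analyticAt_regPart`). At a nonzero frequency the Fourier transform of `shortPart` is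
`invSymbol - longSymbol`, where `invSymbol` is the inverse symbol of `L[ω]` and `longSymbol` has
Gaussian decay (`integral_expFun_mul_shortPart`).

The function `perFun` is the sum of the translates of `shortPart` over `q ℤⁿ` plus `1/|Q|` times
the Fourier series with coefficients `longSymbol` and a constant. The Poisson summation formula
(`poisson_schwartz`, applied under the integral sign) turns the first sum into the Fourier series
with coefficients `invSymbol - longSymbol`. The two occurrences of `longSymbol` cancel, the constant
cancels the term of frequency zero, and `perFun` is seen to represent the Fourier series that
defines `perFund` (`perFund_apply_eq_integral`). Local integrability comes with this representation.

Both sums are superpositions of exponentials with an integrable majorant on a ball, hence are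
analytic (`analyticAt_integral_exp`). For the lattice sum this is used at the points at positive
distance from the lattice points that occur in it: off the lattice for the whole sum, and near `0`
when the term of the lattice point `0` is left out. That missing term, `shortPart`, differs from
`Γ_{n,ω}` by `regPart` and a constant, so that `perFun - Γ_{n,ω}` extends analytically to `0`
(`analyticOnNhd_perReg`).

The equation for `perFund` is the Poisson summation formula again, since `L[ω]` multiplies the
Fourier coefficients by the inverse of `invSymbol` (`lameOp_perFund`). The equation for the regular
part is the difference of this one and of `L[ω] Γ_{n,ω} = δ I` (`lamePairing_elasticFund`). The
latter follows from Parseval's identity: the short range parts with cut-off `s > a` satisfy the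
equation up to an error whose Fourier transform is Gaussian and tends to `0` with `a`, and they
converge to `Γ_{n,ω}` up to constants, which second derivatives do not see.
-/

namespace PeriodicElastic

/-! ### Analyticity of superpositions of exponentials -/

section PlaneWaves

variable {E : Type*} [NormedAddCommGroup E] [NormedSpace ℝ E]

/-- The `k`-linear map `(v₁, …, v_k) ↦ L v₁ ⋯ L v_k`. -/
noncomputable def linPow (k : ℕ) (L : E →L[ℝ] ℂ) :
    ContinuousMultilinearMap ℝ (fun _ : Fin k => E) ℂ :=
  (ContinuousMultilinearMap.mkPiAlgebraFin ℝ k ℂ).compContinuousLinearMap fun _ => L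

theorem linPow_apply_const (k : ℕ) (L : E →L[ℝ] ℂ) (y : E) :
    linPow k L (fun _ => y) = L y ^ k := by
  simp [linPow]

theorem norm_linPow_le (k : ℕ) (L : E →L[ℝ] ℂ) : ‖linPow k L‖ ≤ ‖L‖ ^ k := by
  refine (ContinuousMultilinearMap.norm_compContinuousLinearMap_le _ _).trans ?_
  simp

theorem continuous_linPow (k : ℕ) : Continuous (linPow k : (E →L[ℝ] ℂ) → _) := by
  have h := (ContinuousMultilinearMap.compContinuousLinearMapContinuousMultilinear ℝ
    (fun _ : Fin k => E) (fun _ : Fin k => ℂ) ℂ).cont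
  have h2 : Continuous fun L : E →L[ℝ] ℂ =>
      (ContinuousMultilinearMap.compContinuousLinearMapContinuousMultilinear ℝ
        (fun _ : Fin k => E) (fun _ : Fin k => ℂ) ℂ) (fun _ => L) :=
    h.comp (continuous_pi fun _ => continuous_id)
  exact h2.clm_apply continuous_const

/-- A superposition of exponentials `h ↦ exp (Λₓ h)` with an integrable majorant on a ball is
analytic at the centre: integrating the exponential series term by term gives a convergent power
series. -/
theorem analyticAt_integral_exp {X : Type*} [MeasurableSpace X] {μ : Measure X} {c : X → ℂ}
    {Λ : X → E →L[ℝ] ℂ} {r : ℝ} (hr : 0 < r) (hc : AEStronglyMeasurable c μ)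
    (hΛ : AEStronglyMeasurable Λ μ)
    (hint : Integrable (fun x => ‖c x‖ * Real.exp (r * ‖Λ x‖)) μ) :
    AnalyticAt ℝ (fun h : E => ∫ x, c x * Complex.exp (Λ x h) ∂μ) 0 := by
  set φ : (k : ℕ) → X → ContinuousMultilinearMap ℝ (fun _ : Fin k => E) ℂ :=
    fun k x => (c x / (k.factorial : ℂ)) • linPow k (Λ x) with hφ
  have hφm : ∀ k, AEStronglyMeasurable (φ k) μ := fun k =>
    (hc.div₀ aestronglyMeasurable_const).smul ((continuous_linPow k).comp_aestronglyMeasurable hΛ)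
  have hφb : ∀ k x, ‖φ k x‖ ≤ ‖c x‖ * (‖Λ x‖ ^ k / k.factorial) := by
    intro k x
    rw [hφ]
    simp only [norm_smul, norm_div, RCLike.norm_natCast]
    calc ‖c x‖ / k.factorial * ‖linPow k (Λ x)‖ ≤ ‖c x‖ / k.factorial * ‖Λ x‖ ^ k := by
          gcongr; exact norm_linPow_le _ _
      _ = _ := by ring
  -- `tᵏ / k! ≤ eᵗ` with `t = r ‖Λₓ‖`: the majorant gives the radius of convergence `r`
  have hterm : ∀ (k : ℕ) (t : ℝ), 0 ≤ t → t ^ k / k.factorial ≤ Real.exp t := fun k t ht =>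
    Real.pow_div_factorial_le_exp t ht k
  have hφb2 : ∀ k x, ‖φ k x‖ ≤ (‖c x‖ * Real.exp (r * ‖Λ x‖)) * (r⁻¹) ^ k := by
    intro k x
    have h1 := hterm k (r * ‖Λ x‖) (by positivity)
    rw [mul_pow] at h1
    calc ‖φ k x‖ ≤ ‖c x‖ * (‖Λ x‖ ^ k / k.factorial) := hφb k x
      _ = ‖c x‖ * (r ^ k * ‖Λ x‖ ^ k / k.factorial) * (r⁻¹) ^ k := by
          rw [inv_pow]; field_simp
      _ ≤ _ := by gcongr
  have hφi : ∀ k, Integrable (φ k) μ := fun k =>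
    (hint.mul_const _).mono' (hφm k) (Filter.Eventually.of_forall (hφb2 k))
  set p : FormalMultilinearSeries ℝ E ℂ := fun k => ∫ x, φ k x ∂μ with hp
  refine ⟨p, ENNReal.ofReal r, ?_, by simpa using hr, ?_⟩
  · have := p.le_radius_of_bound (∫ x, ‖c x‖ * Real.exp (r * ‖Λ x‖) ∂μ) (r := ⟨r, hr.le⟩)
      (fun k => ?_)
    · convert this using 1
      rw [ENNReal.ofReal_eq_coe_nnreal hr.le]
      rfl
    · have h1 : ‖p k‖ ≤ (∫ x, ‖c x‖ * Real.exp (r * ‖Λ x‖) ∂μ) * (r⁻¹) ^ k := by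
        rw [← integral_mul_const]
        exact norm_integral_le_of_norm_le (hint.mul_const _)
          (Filter.Eventually.of_forall (hφb2 k))
      calc ‖p k‖ * r ^ k ≤ (∫ x, ‖c x‖ * Real.exp (r * ‖Λ x‖) ∂μ) * (r⁻¹) ^ k * r ^ k := by
            gcongr
        _ = _ := by rw [mul_assoc, ← mul_pow, inv_mul_cancel₀ hr.ne', one_pow, mul_one]
  · intro y hy
    have hy' : ‖y‖ < r := by
      rw [Metric.eball_ofReal] at hy
      simpa using hy
    have happ : ∀ k, p k (fun _ => y) = ∫ x, c x / (k.factorial : ℂ) * Λ x y ^ k ∂μ := by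
      intro k
      have := (ContinuousMultilinearMap.apply ℝ (fun _ : Fin k => E) ℂ
        (fun _ => y)).integral_comp_comm (hφi k)
      simp only [ContinuousMultilinearMap.apply_apply] at this
      rw [hp, ← this]
      refine integral_congr_ae (Filter.Eventually.of_forall fun x => ?_)
      simp only [hφ, smul_apply, linPow_apply_const, smul_eq_mul]
    have hb : ∀ k x, ‖c x / (k.factorial : ℂ) * Λ x y ^ k‖
        ≤ ‖c x‖ * ((r * ‖Λ x‖) ^ k / k.factorial) := by
      intro k x
      rw [norm_mul, norm_div, RCLike.norm_natCast, norm_pow]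
      have h1 : ‖Λ x y‖ ≤ r * ‖Λ x‖ := by
        rw [mul_comm]
        exact ((Λ x).le_opNorm y).trans (by gcongr)
      calc ‖c x‖ / k.factorial * ‖Λ x y‖ ^ k ≤ ‖c x‖ / k.factorial * (r * ‖Λ x‖) ^ k := by gcongr
        _ = _ := by ring
    have hm : ∀ k : ℕ, AEStronglyMeasurable (fun x => c x / (k.factorial : ℂ) * Λ x y ^ k) μ := by
      intro k
      have hΛy : AEStronglyMeasurable (fun x => Λ x y) μ :=
        (ContinuousLinearMap.apply ℝ ℂ y).continuous.comp_aestronglyMeasurable hΛ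
      exact (hc.div₀ aestronglyMeasurable_const).mul (hΛy.pow k)
    rw [zero_add]
    simp_rw [happ]
    have hexpS : ∀ x, HasSum (fun k : ℕ => ‖c x‖ * ((r * ‖Λ x‖) ^ k / k.factorial))
        (‖c x‖ * Real.exp (r * ‖Λ x‖)) := by
      intro x
      have := NormedSpace.expSeries_div_hasSum_exp (𝔸 := ℝ) (r * ‖Λ x‖)
      rw [← Real.exp_eq_exp_ℝ] at this
      exact this.mul_left _
    refine hasSum_integral_of_dominated_convergence
      (fun k x => ‖c x‖ * ((r * ‖Λ x‖) ^ k / k.factorial)) hm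
      (fun k => Filter.Eventually.of_forall (hb k))
      (Filter.Eventually.of_forall fun x => (hexpS x).summable) ?_
      (Filter.Eventually.of_forall fun x => ?_)
    · refine hint.congr (Filter.Eventually.of_forall fun x => ?_)
      exact (hexpS x).tsum_eq.symm
    · have := NormedSpace.expSeries_div_hasSum_exp (𝔸 := ℂ) (Λ x y)
      rw [← Complex.exp_eq_exp_ℂ] at this
      refine (this.mul_left (c x)).congr_fun fun k => ?_
      ring

/-- The real form of `analyticAt_integral_exp`. -/
theorem analyticAt_integral_rexp {X : Type*} [MeasurableSpace X] {μ : Measure X} {c : X → ℝ}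
    {Λ : X → E →L[ℝ] ℝ} {r : ℝ} (hr : 0 < r) (hc : AEStronglyMeasurable c μ)
    (hΛ : AEStronglyMeasurable Λ μ)
    (hint : Integrable (fun x => |c x| * Real.exp (r * ‖Λ x‖)) μ) :
    AnalyticAt ℝ (fun h : E => ∫ x, c x * Real.exp (Λ x h) ∂μ) 0 := by
  have hcont : Continuous fun L : E →L[ℝ] ℝ => Complex.ofRealCLM.comp L :=
    ((ContinuousLinearMap.compL ℝ E ℝ ℂ) Complex.ofRealCLM).continuous
  have hn : ∀ L : E →L[ℝ] ℝ, ‖Complex.ofRealCLM.comp L‖ ≤ ‖L‖ := by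
    intro L
    refine ContinuousLinearMap.opNorm_le_bound _ (norm_nonneg _) fun x => ?_
    simpa using L.le_opNorm x
  have h := analyticAt_integral_exp (μ := μ) (c := fun x => (c x : ℂ))
    (Λ := fun x => Complex.ofRealCLM.comp (Λ x)) hr
    (Complex.continuous_ofReal.comp_aestronglyMeasurable hc)
    (hcont.comp_aestronglyMeasurable hΛ) ?_
  · have h2 := (Complex.reCLM.analyticAt _).comp h
    refine h2.congr (Filter.Eventually.of_forall fun y => ?_)
    simp only [Function.comp_apply, Complex.reCLM_apply]
    have : ∀ x, (c x : ℂ) * Complex.exp ((Complex.ofRealCLM.comp (Λ x)) y)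
        = ((c x * Real.exp (Λ x y) : ℝ) : ℂ) := by
      intro x; push_cast; simp
    simp_rw [this]
    rw [integral_complex_ofReal, Complex.ofReal_re]
  · refine hint.mono' ?_ (Filter.Eventually.of_forall fun x => ?_)
    · exact ((Complex.continuous_ofReal.comp_aestronglyMeasurable hc).norm).mul
        (Real.continuous_exp.comp_aestronglyMeasurable
          ((hcont.comp_aestronglyMeasurable hΛ).norm.const_mul r))
    · rw [Real.norm_of_nonneg (by positivity), Complex.norm_real, Real.norm_eq_abs]
      gcongr
      exact hn _

end PlaneWaves

/-! ### Lattice sums and the decay of Schwartz functions -/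

section LatticeSums

variable {n : ℕ}

theorem dualPt_eq_latticePt (q : Fin n → ℝ) : dualPt q = latticePt fun j => (q j)⁻¹ := rfl

theorem latticePt_neg (q : Fin n → ℝ) (z : Fin n → ℤ) : latticePt q (-z) = -latticePt q z := by
  ext i; simp [latticePt]

theorem latticePt_zero (q : Fin n → ℝ) : latticePt q 0 = 0 := by
  ext i; simp [latticePt]

theorem latticePt_injective {q : Fin n → ℝ} (hq : ∀ j, 0 < q j) :
    Function.Injective (latticePt q) := by
  intro z w h
  funext i
  have := congrArg (fun x : EuclideanSpace ℝ (Fin n) => x i) h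
  simpa [latticePt, (hq i).ne'] using this

theorem inner_dualPt_latticePt {q : Fin n → ℝ} (hq : ∀ j, 0 < q j) (z w : Fin n → ℤ) :
    inner ℝ (dualPt q z) (latticePt q w) = ((∑ i, z i * w i : ℤ) : ℝ) := by
  simp only [PiLp.inner_apply, dualPt, latticePt, RCLike.inner_apply, conj_trivial]
  push_cast
  refine Finset.sum_congr rfl fun i _ => ?_
  have := (hq i).ne'
  field_simp

/-- The lattice norm dominates the sup norm of the integer coordinates. -/
theorem exists_le_norm_latticePt {q : Fin n → ℝ} (hq : ∀ j, 0 < q j) :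
    ∃ c : ℝ, 0 < c ∧ ∀ z : Fin n → ℤ, c * ‖(fun i => (z i : ℝ) : Fin n → ℝ)‖ ≤ ‖latticePt q z‖ := by
  obtain ⟨c, hc, hcq⟩ : ∃ c : ℝ, 0 < c ∧ ∀ j, c ≤ q j := by
    rcases isEmpty_or_nonempty (Fin n) with h | h
    · exact ⟨1, one_pos, fun j => (IsEmpty.false j).elim⟩
    · obtain ⟨j, hj⟩ := Finite.exists_min q
      exact ⟨q j, hq j, hj⟩
  refine ⟨c, hc, fun z => ?_⟩
  rw [← le_div_iff₀' hc, pi_norm_le_iff_of_nonneg (by positivity)]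
  intro i
  rw [le_div_iff₀' hc]
  have h1 := PiLp.norm_apply_le (latticePt q z) i
  have h2 : ‖latticePt q z i‖ = q i * ‖(z i : ℝ)‖ := by
    simp [latticePt, abs_of_pos (hq i)]
  calc c * ‖(z i : ℝ)‖ ≤ q i * ‖(z i : ℝ)‖ := by gcongr; exact hcq i
    _ ≤ _ := by rw [← h2]; exact h1

/-- The exponent `n + 1` makes the series over a lattice of `ℝⁿ` converge. -/
theorem summable_one_add_norm_latticePt {q : Fin n → ℝ} (hq : ∀ j, 0 < q j) :
    Summable fun z : Fin n → ℤ => ((1 + ‖latticePt q z‖) ^ (n + 1))⁻¹ := by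
  obtain ⟨c, hc, hcz⟩ := exists_le_norm_latticePt hq
  let b := Pi.basisFun ℝ (Fin n)
  let L : Submodule ℤ (Fin n → ℝ) := Submodule.span ℤ (Set.range b)
  have hrank : Module.finrank ℤ L = n := by
    rw [ZLattice.rank ℝ L]; simp
  have h1 := ZLattice.summable_norm_pow_inv L (n + 1) (by omega)
  have hmem : ∀ z : Fin n → ℤ, (fun i => (z i : ℝ)) ∈ L := by
    intro z
    have : (fun i => (z i : ℝ)) = ∑ i, z i • b i := by
      funext j
      simp [b, Pi.basisFun_apply, Finset.sum_apply, Pi.single_apply]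
    rw [this]
    exact Submodule.sum_mem _ fun i _ => Submodule.smul_mem _ _ (Submodule.subset_span ⟨i, rfl⟩)
  let e : (Fin n → ℤ) → L := fun z => ⟨_, hmem z⟩
  have he : Function.Injective e := by
    intro z w h
    funext i
    have h' : (z i : ℝ) = w i := congrFun (congrArg Subtype.val h) i
    exact_mod_cast h'
  have h2 := (h1.comp_injective he).mul_left ((c ^ (n + 1))⁻¹)
  refine Summable.of_norm_bounded_eventually h2 ?_
  refine (Set.finite_singleton (0 : Fin n → ℤ)).subset fun z hz => ?_
  by_contra hz0
  apply hz
  have hpos : 0 < ‖(fun i => (z i : ℝ) : Fin n → ℝ)‖ := by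
    rw [norm_pos_iff]
    intro h
    apply hz0
    funext i
    have h' : (z i : ℝ) = 0 := congrFun h i
    exact_mod_cast h'
  show ‖((1 + ‖latticePt q z‖) ^ (n + 1))⁻¹‖ ≤ _
  rw [Real.norm_of_nonneg (by positivity)]
  have h3 : ‖e z‖ = ‖(fun i => (z i : ℝ) : Fin n → ℝ)‖ := rfl
  simp only [Function.comp_apply, h3]
  rw [inv_pow, ← mul_inv, ← mul_pow]
  gcongr
  linarith [hcz z]

theorem schwartz_decay {E F : Type*} [NormedAddCommGroup E] [NormedSpace ℝ E]
    [NormedAddCommGroup F] [NormedSpace ℝ F] (f : 𝓢(E, F)) (k : ℕ) :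
    ∃ C : ℝ, 0 ≤ C ∧ ∀ x, ‖f x‖ ≤ C * ((1 + ‖x‖) ^ k)⁻¹ := by
  refine ⟨2 ^ k * (Finset.Iic (k, 0)).sup (fun m => SchwartzMap.seminorm ℝ m.1 m.2) f,
    by positivity, fun x => ?_⟩
  have := one_add_le_sup_seminorm_apply (𝕜 := ℝ) (m := (k, 0)) (k := k) (n := 0) le_rfl le_rfl f x
  rw [norm_iteratedFDeriv_zero] at this
  rw [← div_eq_mul_inv, le_div_iff₀ (by positivity), mul_comm]
  exact this

/-- Peetre's inequality. -/
theorem one_add_norm_le_mul {E : Type*} [NormedAddCommGroup E] (x y : E) :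
    1 + ‖x‖ ≤ (1 + ‖y‖) * (1 + ‖y + x‖) := by
  have h := norm_sub_le (y + x) y
  rw [add_sub_cancel_left] at h
  nlinarith [norm_nonneg y, norm_nonneg (y + x)]

/-- A Schwartz function decays along the points `y + x`, as `x → ∞`, with a polynomial loss in the
base point `y`. -/
theorem schwartz_translate_decay {E F : Type*} [NormedAddCommGroup E] [NormedSpace ℝ E]
    [NormedAddCommGroup F] [NormedSpace ℝ F] (f : 𝓢(E, F)) (k : ℕ) :
    ∃ C : ℝ, 0 ≤ C ∧ ∀ y x, ‖f (y + x)‖ ≤ C * (1 + ‖y‖) ^ k * ((1 + ‖x‖) ^ k)⁻¹ := by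
  obtain ⟨C, hC, h⟩ := schwartz_decay f k
  refine ⟨C, hC, fun y x => (h _).trans ?_⟩
  rw [mul_assoc]
  gcongr
  rw [← div_eq_mul_inv, le_div_iff₀ (by positivity), inv_mul_le_iff₀ (by positivity),
    mul_comm, ← mul_pow]
  gcongr
  exact one_add_norm_le_mul x y

theorem summable_norm_schwartz_latticePt {F : Type*} [NormedAddCommGroup F] [NormedSpace ℝ F]
    {q : Fin n → ℝ} (hq : ∀ j, 0 < q j) (f : 𝓢(EuclideanSpace ℝ (Fin n), F)) :
    Summable fun z => ‖f (latticePt q z)‖ := by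
  obtain ⟨C, hC, h⟩ := schwartz_decay f (n + 1)
  exact Summable.of_nonneg_of_le (fun _ => norm_nonneg _) (fun z => h _)
    ((summable_one_add_norm_latticePt hq).mul_left C)

theorem summable_norm_schwartz_dualPt {F : Type*} [NormedAddCommGroup F] [NormedSpace ℝ F]
    {q : Fin n → ℝ} (hq : ∀ j, 0 < q j) (f : 𝓢(EuclideanSpace ℝ (Fin n), F)) :
    Summable fun z => ‖f (dualPt q z)‖ :=
  summable_norm_schwartz_latticePt (fun j => inv_pos.2 (hq j)) f

end LatticeSums

/-! ### Poisson summation for the integer lattice -/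

section Poisson

variable {d : Type*} [Fintype d]

/-- The half-open unit boxes with integer corners tile `ℝᵈ`: the integral over `ℝᵈ` is the sum of
the integrals over the unit box of the integer translates. -/
theorem hasSum_integral_box {F : Type*} [NormedAddCommGroup F] [NormedSpace ℝ F]
    {h : (d → ℝ) → F} (hh : Integrable h) :
    HasSum (fun z : d → ℤ => ∫ x in {x : d → ℝ | ∀ i, x i ∈ Set.Ioc (0 : ℝ) (0 + 1)},
      h (x + fun i => (z i : ℝ))) (∫ x, h x) := by
  classical
  set B : Set (d → ℝ) := {x | ∀ i, x i ∈ Set.Ioc (0 : ℝ) (0 + 1)} with hB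
  have hBm : MeasurableSet B := by
    have : B = Set.univ.pi fun _ => Set.Ioc (0 : ℝ) (0 + 1) := by ext x; simp [hB, Set.mem_pi]
    rw [this]
    exact MeasurableSet.univ_pi fun _ => measurableSet_Ioc
  let τ : (d → ℤ) → (d → ℝ) → (d → ℝ) := fun z x => x + fun i => (z i : ℝ)
  let s : (d → ℤ) → Set (d → ℝ) := fun z => {x | ∀ i, x i - z i ∈ Set.Ioc (0 : ℝ) (0 + 1)}
  have hs : ∀ z, τ z ⁻¹' (s z) = B := by
    intro z; ext x; simp [τ, s, hB]
  have hτ : ∀ z, MeasurePreserving (τ z) volume volume := fun z =>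
    measurePreserving_add_right volume _
  have hsm : ∀ z, MeasurableSet (s z) := by
    intro z
    have : s z = (fun x => x - fun i => (z i : ℝ)) ⁻¹' B := by ext x; simp [s, hB]
    rw [this]
    exact (measurable_id.sub_const _) hBm
  have hdisj : Pairwise (Function.onFun Disjoint s) := by
    intro z w hzw
    refine Set.disjoint_left.2 fun x hx hy => hzw ?_
    funext i
    have h1 := hx i
    have h2 := hy i
    simp only [Set.mem_Ioc] at h1 h2
    have h3 : (z i : ℝ) < w i + 1 := by linarith
    have h4 : (w i : ℝ) < z i + 1 := by linarith
    norm_cast at h3 h4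
    omega
  have hun : (⋃ z, s z) = Set.univ := by
    refine Set.eq_univ_of_forall fun x => Set.mem_iUnion.2 ⟨fun i => ⌈x i⌉ - 1, fun i => ?_⟩
    have h1 := Int.le_ceil (x i)
    have h2 := Int.ceil_lt_add_one (x i)
    push_cast
    constructor <;> linarith
  have key := hasSum_integral_iUnion (μ := volume) hsm hdisj (f := h)
    (by rw [hun]; exact hh.integrableOn)
  rw [hun, setIntegral_univ] at key
  refine key.congr_fun fun z => ?_
  rw [← hs z, (hτ z).setIntegral_preimage_emb (measurableEmbedding_addRight _) h (s z)]

/-- The Poisson summation formula on `ℝᵈ` for the lattice `ℤᵈ`. The bound `hb` makes the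
periodization of `g` converge locally uniformly, and `hsum` makes its Fourier series converge
absolutely. -/
theorem poisson_pi {g : (d → ℝ) → ℂ} (hg : Continuous g) (hgi : Integrable g)
    {u : (d → ℤ) → ℝ} (hu : Summable u) {B : (d → ℝ) → ℝ} (hBc : Continuous B)
    (hu0 : ∀ z, 0 ≤ u z)
    (hb : ∀ y (z : d → ℤ), ‖g (y + fun i => (z i : ℝ))‖ ≤ B y * u z)
    (hsum : Summable fun z : d → ℤ =>
      ∫ y, UnitAddTorus.mFourier (-z) (fun i => (y i : UnitAddCircle)) * g y) :
    ∑' z : d → ℤ, g (fun i => (z i : ℝ)) =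
      ∑' z : d → ℤ, ∫ y, UnitAddTorus.mFourier (-z) (fun i => (y i : UnitAddCircle)) * g y := by
  let π : (d → ℝ) → UnitAddTorus d := fun y i => (y i : UnitAddCircle)
  have hπ : IsOpenQuotientMap π := IsOpenQuotientMap.piMap
    (f := fun (_ : d) (y : ℝ) => (y : UnitAddCircle)) fun _ => QuotientAddGroup.isOpenQuotientMap_mk
  have hπper : ∀ y (z : d → ℤ), π (y + fun i => (z i : ℝ)) = π y := by
    intro y z
    funext i
    simp only [π, Pi.add_apply, AddCircle.coe_add]
    have : ((z i : ℝ) : UnitAddCircle) = 0 := by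
      rw [AddCircle.coe_eq_zero_iff]
      exact ⟨z i, by simp⟩
    rw [this, add_zero]
  -- the periodization of `g`, which converges locally uniformly
  let Fn : (d → ℝ) → ℂ := fun y => ∑' z : d → ℤ, g (y + fun i => (z i : ℝ))
  have hFs : ∀ y, Summable fun z : d → ℤ => g (y + fun i => (z i : ℝ)) := fun y =>
    Summable.of_norm_bounded (hu.mul_left (B y)) (hb y)
  have hFc : Continuous Fn := by
    rw [continuous_iff_continuousAt]
    intro y0
    obtain ⟨M, hM⟩ := (isCompact_closedBall y0 1).bddAbove_image hBc.continuousOn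
    have : ContinuousOn Fn (Metric.closedBall y0 1) := by
      refine continuousOn_tsum (u := fun z => M * u z) (fun z => ?_) (hu.mul_left M) ?_
      · exact (hg.comp (continuous_id.add continuous_const)).continuousOn
      · intro z y hy
        exact (hb y z).trans (by gcongr; exacts [hu0 z, hM ⟨y, hy, rfl⟩])
    exact this.continuousAt (Metric.closedBall_mem_nhds y0 one_pos)
  have hFper : ∀ y (w : d → ℤ), Fn (y + fun i => (w i : ℝ)) = Fn y := by
    intro y w
    have := (Equiv.addRight w).tsum_eq fun z : d → ℤ => g (y + fun i => (z i : ℝ))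
    refine Eq.trans ?_ this
    refine tsum_congr fun z => congrArg g ?_
    funext i
    simp only [Pi.add_apply, Equiv.coe_addRight]
    push_cast
    ring
  -- it descends to the torus
  let F' : UnitAddTorus d → ℂ := fun θ => Fn (Function.surjInv hπ.surjective θ)
  have hF' : ∀ y, F' (π y) = Fn y := by
    intro y
    have h1 : π (Function.surjInv hπ.surjective (π y)) = π y := Function.surjInv_eq _ _
    set y' := Function.surjInv hπ.surjective (π y) with hy'
    have h2 : ∀ i, ∃ m : ℤ, y' i = y i + m := by
      intro i
      have h3 := congrFun h1 i
      simp only [π] at h3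
      rw [← sub_eq_zero, ← AddCircle.coe_sub, AddCircle.coe_eq_zero_iff] at h3
      obtain ⟨m, hm⟩ := h3
      refine ⟨m, ?_⟩
      simp at hm
      linarith
    choose m hm using h2
    have h4 : y' = y + fun i => (m i : ℝ) := by funext i; exact hm i
    show Fn y' = Fn y
    rw [h4, hFper]
  have hF'c : Continuous F' := by
    rw [hπ.isQuotientMap.continuous_iff]
    exact hFc.congr fun y => (hF' y).symm
  let Fc : C(UnitAddTorus d, ℂ) := ⟨F', hF'c⟩
  -- unfolding the box gives its Fourier coefficients as integrals over `ℝᵈ`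
  have hcoef : ∀ z : d → ℤ, UnitAddTorus.mFourierCoeff Fc z =
      ∫ y, UnitAddTorus.mFourier (-z) (π y) * g y := by
    intro z
    have hcm : Continuous fun y => UnitAddTorus.mFourier (-z) (π y) :=
      (UnitAddTorus.mFourier (-z)).continuous.comp hπ.continuous
    have hnorm : ∀ y, ‖UnitAddTorus.mFourier (-z) (π y)‖ ≤ 1 := fun y =>
      (ContinuousMap.norm_coe_le_norm _ _).trans UnitAddTorus.mFourier_norm.le
    have hint : Integrable fun y => UnitAddTorus.mFourier (-z) (π y) * g y :=
      hgi.bdd_mul hcm.aestronglyMeasurable (Filter.Eventually.of_forall hnorm)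
    have hbox := hasSum_integral_box hint
    have hboxn := hasSum_integral_box hint.norm
    rw [UnitAddTorus.mFourierCoeff_eq_integral Fc z 0]
    rw [← hbox.tsum_eq]
    simp only [Pi.zero_apply]
    refine Eq.trans ?_ (integral_tsum_of_summable_integral_norm ?_ ?_).symm
    · refine integral_congr_ae (Filter.Eventually.of_forall fun y => ?_)
      simp only [hπper]
      rw [tsum_mul_left]
      show _ • F' (π y) = _
      rw [hF', smul_eq_mul]
    · intro m
      exact (hint.comp_add_right _).integrableOn
    · exact hboxn.summable
  have key := UnitAddTorus.hasSum_mFourier_series_apply_of_summable (f := Fc)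
    (by rw [show UnitAddTorus.mFourierCoeff Fc = _ from funext hcoef]; exact hsum) (π 0)
  have h0 : Fc (π 0) = ∑' z : d → ℤ, g (fun i => (z i : ℝ)) := by
    show F' (π 0) = _
    rw [hF']
    simp [Fn]
  have h1 : ∀ z : d → ℤ, UnitAddTorus.mFourier z (π 0) = 1 := by
    intro z
    simp [UnitAddTorus.mFourier, π]
  rw [← h0, ← key.tsum_eq]
  refine tsum_congr fun z => ?_
  rw [h1, hcoef, smul_eq_mul, mul_one]

end Poisson

/-! ### Plane waves and the Poisson summation formula for Schwartz functions -/

section FourierInv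

open FourierTransform

variable {n : ℕ}

theorem norm_expFun (ξ x : EuclideanSpace ℝ (Fin n)) : ‖expFun ξ x‖ = 1 := by
  rw [expFun, Complex.norm_exp]
  simp

theorem continuous_expFun (ξ : EuclideanSpace ℝ (Fin n)) : Continuous (expFun ξ) := by
  unfold expFun; fun_prop

theorem expFun_add (ξ x y : EuclideanSpace ℝ (Fin n)) :
    expFun ξ (x + y) = expFun ξ x * expFun ξ y := by
  simp only [expFun, inner_add_right, Complex.ofReal_add, mul_add, Complex.exp_add]

theorem expFun_neg_left (ξ x : EuclideanSpace ℝ (Fin n)) : expFun (-ξ) x = expFun ξ (-x) := by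
  simp only [expFun, inner_neg_left, inner_neg_right]

theorem expFun_zero_left (x : EuclideanSpace ℝ (Fin n)) : expFun 0 x = 1 := by simp [expFun]

theorem conj_expFun (ξ x : EuclideanSpace ℝ (Fin n)) :
    (starRingEnd ℂ) (expFun ξ x) = expFun (-ξ) x := by
  simp only [expFun, ← Complex.exp_conj, inner_neg_left]
  congr 1
  simp only [map_mul, Complex.conj_ofReal, Complex.conj_I, Complex.ofReal_neg, map_ofNat]
  ring

theorem expFun_dualPt_latticePt {q : Fin n → ℝ} (hq : ∀ j, 0 < q j) (z w : Fin n → ℤ) :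
    expFun (dualPt q z) (latticePt q w) = 1 := by
  rw [expFun, inner_dualPt_latticePt hq]
  rw [Complex.exp_eq_one_iff]
  exact ⟨∑ i, z i * w i, by push_cast; ring⟩

theorem fourierInv_eq_integral_expFun (f : 𝓢(EuclideanSpace ℝ (Fin n), ℂ))
    (ξ : EuclideanSpace ℝ (Fin n)) : 𝓕⁻ f ξ = ∫ x, expFun ξ x * f x := by
  rw [SchwartzMap.fourierInv_coe, Real.fourierInv_eq']
  refine integral_congr_ae (Filter.Eventually.of_forall fun x => ?_)
  simp only [expFun, smul_eq_mul, real_inner_comm ξ x]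
  congr 2
  push_cast; ring

/-- Testing a plane wave on `f` evaluates the inverse Fourier transform of `f`. -/
theorem expDist_apply (ξ : EuclideanSpace ℝ (Fin n)) (f : 𝓢(EuclideanSpace ℝ (Fin n), ℂ)) :
    expDist ξ f = 𝓕⁻ f ξ := by
  rw [fourierInv_eq_integral_expFun]
  refine (Function.HasTemperateGrowth.toTemperedDistribution_apply (μ := volume)
    (expFun_hasTemperateGrowth ξ) f).trans ?_
  refine integral_congr_ae (Filter.Eventually.of_forall fun x => ?_)
  simp only [smul_eq_mul, mul_comm]

theorem fourierInv_translate (f : 𝓢(EuclideanSpace ℝ (Fin n), ℂ))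
    (y ξ : EuclideanSpace ℝ (Fin n)) :
    𝓕⁻ (compSubConstCLM ℂ (-y) f) ξ = expFun (-ξ) y * 𝓕⁻ f ξ := by
  rw [fourierInv_eq_integral_expFun, fourierInv_eq_integral_expFun, ← integral_const_mul,
    ← integral_sub_right_eq_self _ y]
  refine integral_congr_ae (Filter.Eventually.of_forall fun x => ?_)
  simp only [compSubConstCLM_apply]
  rw [sub_neg_eq_add, sub_add_cancel, sub_eq_add_neg, expFun_add, expFun_neg_left]
  ring

theorem fourierInv_conjS (f : 𝓢(EuclideanSpace ℝ (Fin n), ℂ)) (ξ : EuclideanSpace ℝ (Fin n)) :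
    𝓕⁻ (conjS f) ξ = (starRingEnd ℂ) (𝓕⁻ f (-ξ)) := by
  rw [fourierInv_eq_integral_expFun, fourierInv_eq_integral_expFun, ← integral_conj]
  refine integral_congr_ae (Filter.Eventually.of_forall fun x => ?_)
  simp only [conjS, postcompCLM_apply, map_mul, conj_expFun, neg_neg]
  rfl

theorem fourierInv_lineDeriv_single (f : 𝓢(EuclideanSpace ℝ (Fin n), ℂ)) (l : Fin n)
    (ξ : EuclideanSpace ℝ (Fin n)) :
    𝓕⁻ (∂_{EuclideanSpace.single l (1 : ℝ)} f) ξ = -(2 * Real.pi * Complex.I) * ξ l * 𝓕⁻ f ξ := by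
  rw [SchwartzMap.fourierInv_lineDerivOp_eq]
  rw [smul_apply, smulLeftCLM_apply_apply (by fun_prop)]
  have h : inner ℝ ξ (EuclideanSpace.single l (1 : ℝ)) = ξ l := by
    rw [EuclideanSpace.inner_single_right]; simp
  rw [h]
  simp only [smul_eq_mul, Complex.real_smul]
  ring

theorem fourierInv_lineDeriv_single_single (f : 𝓢(EuclideanSpace ℝ (Fin n), ℂ)) (l m : Fin n)
    (ξ : EuclideanSpace ℝ (Fin n)) :
    𝓕⁻ (∂_{EuclideanSpace.single l (1 : ℝ)} (∂_{EuclideanSpace.single m (1 : ℝ)} f)) ξ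
      = ((-(4 * Real.pi ^ 2 * (ξ l * ξ m)) : ℝ) : ℂ) * 𝓕⁻ f ξ := by
  rw [fourierInv_lineDeriv_single, fourierInv_lineDeriv_single]
  push_cast
  linear_combination (4 * Real.pi ^ 2 * (ξ l * ξ m) * 𝓕⁻ f ξ : ℂ) * Complex.I_sq

theorem integral_fourierInv (f : 𝓢(EuclideanSpace ℝ (Fin n), ℂ)) : ∫ ξ, 𝓕⁻ f ξ = f 0 := by
  have h : 𝓕 (𝓕⁻ f) 0 = f 0 := by rw [fourier_fourierInv_eq]
  rw [← h, SchwartzMap.fourier_coe, Real.fourier_eq]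
  simp

theorem fourierInv_zero (f : 𝓢(EuclideanSpace ℝ (Fin n), ℂ)) : 𝓕⁻ f 0 = ∫ x, f x := by
  simp [fourierInv_eq_integral_expFun, expFun_zero_left]

/-- A Schwartz function is the superposition of the plane waves with amplitudes its inverse
Fourier transform. -/
theorem eq_integral_expFun_fourierInv (f : 𝓢(EuclideanSpace ℝ (Fin n), ℂ))
    (x : EuclideanSpace ℝ (Fin n)) : f x = ∫ ξ, expFun (-ξ) x * 𝓕⁻ f ξ := by
  have h : 𝓕 (𝓕⁻ f) x = f x := by rw [fourier_fourierInv_eq]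
  rw [← h, SchwartzMap.fourier_coe, Real.fourier_eq']
  refine integral_congr_ae (Filter.Eventually.of_forall fun ξ => ?_)
  simp only [expFun, smul_eq_mul, inner_neg_left]
  congr 2
  push_cast; ring

theorem cellVol_eq_prod {q : Fin n → ℝ} (hq : ∀ j, 0 < q j) : cellVol q = ∏ j, q j := by
  have h1 : cell q = (MeasurableEquiv.toLp 2 (Fin n → ℝ)).symm ⁻¹'
      (Set.univ.pi fun j => Set.Ioo 0 (q j)) := by
    ext x; simp [cell, Set.mem_pi]
  rw [cellVol, Measure.real, h1,
    (EuclideanSpace.volume_preserving_symm_measurableEquiv_toLp (Fin n)).measure_preimage_equiv,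
    Real.volume_pi_Ioo_toReal (fun j => (hq j).le)]
  simp

theorem cellVol_pos {q : Fin n → ℝ} (hq : ∀ j, 0 < q j) : 0 < cellVol q := by
  rw [cellVol_eq_prod hq]
  exact Finset.prod_pos fun j _ => hq j

/-- The diagonal map `y ↦ q y`, from coordinate vectors to `ℝⁿ`. -/
noncomputable def diagMap (q : Fin n → ℝ) (y : Fin n → ℝ) : EuclideanSpace ℝ (Fin n) :=
  WithLp.toLp 2 fun i => q i * y i

theorem continuous_diagMap (q : Fin n → ℝ) : Continuous (diagMap q) := by
  unfold diagMap; fun_prop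

theorem measurableEmbedding_diagMap {q : Fin n → ℝ} (hq : ∀ j, 0 < q j) :
    MeasurableEmbedding (diagMap q) := by
  refine (continuous_diagMap q).measurableEmbedding ?_
  intro x y hxy
  funext i
  have := congrArg (fun v : EuclideanSpace ℝ (Fin n) => v i) hxy
  simpa [diagMap, (hq i).ne'] using this

/-- The diagonal change of variables from `ℝⁿ` to the coordinates of the lattice. -/
theorem map_diagMap_volume {q : Fin n → ℝ} (hq : ∀ j, 0 < q j) :
    Measure.map (diagMap q) volume = ENNReal.ofReal (cellVol q)⁻¹ • volume := by
  classical
  have hdet : (Matrix.diagonal q).det ≠ 0 := by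
    rw [Matrix.det_diagonal]
    exact (Finset.prod_pos fun j _ => hq j).ne'
  have hm := Real.smul_map_diagonal_volume_pi hdet
  have h2 : |(Matrix.diagonal q).det| = cellVol q := by
    rw [Matrix.det_diagonal, cellVol_eq_prod hq,
      abs_of_pos (Finset.prod_pos fun j _ => hq j)]
  rw [h2] at hm
  have hlin : Measurable (Matrix.toLin' (Matrix.diagonal q)) :=
    (LinearMap.continuous_on_pi _).measurable
  have hpres : Measure.map (MeasurableEquiv.toLp 2 (Fin n → ℝ)) volume
      = (volume : Measure (EuclideanSpace ℝ (Fin n))) :=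
    (EuclideanSpace.volume_preserving_symm_measurableEquiv_toLp (Fin n)).symm.map_eq
  have hcomp : diagMap q = MeasurableEquiv.toLp 2 (Fin n → ℝ) ∘
      Matrix.toLin' (Matrix.diagonal q) := by
    funext y; ext i
    simp [diagMap, Matrix.toLin'_apply, Matrix.mulVec_diagonal]
  have h3 : Measure.map (Matrix.toLin' (Matrix.diagonal q)) volume
      = ENNReal.ofReal (cellVol q)⁻¹ • volume := by
    conv_rhs => rw [← hm]
    rw [smul_smul, ← ENNReal.ofReal_mul (inv_pos.2 (cellVol_pos hq)).le,
      inv_mul_cancel₀ (cellVol_pos hq).ne', ENNReal.ofReal_one, one_smul]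
  rw [hcomp, ← Measure.map_map (MeasurableEquiv.measurable _) hlin, h3, Measure.map_smul, hpres]

theorem integral_comp_diagMap {q : Fin n → ℝ} (hq : ∀ j, 0 < q j)
    (H : EuclideanSpace ℝ (Fin n) → ℂ) :
    ∫ y, H (diagMap q y) = ((cellVol q)⁻¹ : ℝ) * ∫ x, H x := by
  rw [← (measurableEmbedding_diagMap hq).integral_map, map_diagMap_volume hq,
    integral_smul_measure, ENNReal.toReal_ofReal (inv_pos.2 (cellVol_pos hq)).le, Complex.real_smul]

theorem integrable_comp_diagMap {q : Fin n → ℝ} (hq : ∀ j, 0 < q j)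
    {H : EuclideanSpace ℝ (Fin n) → ℂ} (hH : Integrable H) :
    Integrable fun y => H (diagMap q y) := by
  have := (measurableEmbedding_diagMap hq).integrable_map_iff (μ := volume) (g := H)
  refine this.1 ?_
  rw [map_diagMap_volume hq]
  exact hH.smul_measure ENNReal.ofReal_ne_top

theorem diagMap_add_intCast (q : Fin n → ℝ) (y : Fin n → ℝ) (z : Fin n → ℤ) :
    diagMap q (y + fun i => (z i : ℝ)) = diagMap q y + latticePt q z := by
  ext i; simp [diagMap, latticePt, mul_add]

theorem mFourier_neg_eq_expFun {q : Fin n → ℝ} (hq : ∀ j, 0 < q j) (z : Fin n → ℤ)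
    (y : Fin n → ℝ) : UnitAddTorus.mFourier (-z) (fun i => (y i : UnitAddCircle))
      = expFun (dualPt q (-z)) (diagMap q y) := by
  simp only [UnitAddTorus.mFourier, ContinuousMap.coe_mk, fourier_coe_apply, expFun]
  rw [← Complex.exp_sum]
  congr 1
  simp only [PiLp.inner_apply, dualPt, diagMap, RCLike.inner_apply, conj_trivial, Pi.neg_apply]
  push_cast
  rw [Finset.mul_sum]
  refine Finset.sum_congr rfl fun i _ => ?_
  have : (q i : ℂ) ≠ 0 := by exact_mod_cast (hq i).ne'
  field_simp

theorem mFourierCoeff_comp_diagMap {q : Fin n → ℝ} (hq : ∀ j, 0 < q j) (z : Fin n → ℤ)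
    (f : 𝓢(EuclideanSpace ℝ (Fin n), ℂ)) :
    ∫ y : Fin n → ℝ, UnitAddTorus.mFourier (-z) (fun i => (y i : UnitAddCircle)) * f (diagMap q y)
      = ((cellVol q)⁻¹ : ℝ) * 𝓕⁻ f (dualPt q (-z)) := by
  simp only [mFourier_neg_eq_expFun hq]
  rw [integral_comp_diagMap hq fun x => expFun (dualPt q (-z)) x * f x,
    fourierInv_eq_integral_expFun]

theorem summable_fourierInv_dualPt {q : Fin n → ℝ} (hq : ∀ j, 0 < q j)
    (f : 𝓢(EuclideanSpace ℝ (Fin n), ℂ)) : Summable fun z : Fin n → ℤ => ‖𝓕⁻ f (dualPt q z)‖ := by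
  generalize 𝓕⁻ f = g
  exact summable_norm_schwartz_dualPt hq g

/-- The Poisson summation formula for Schwartz functions and the lattice `q ℤⁿ`. -/
theorem poisson_schwartz {q : Fin n → ℝ} (hq : ∀ j, 0 < q j)
    (f : 𝓢(EuclideanSpace ℝ (Fin n), ℂ)) :
    ∑' z : Fin n → ℤ, f (latticePt q z)
      = ((cellVol q)⁻¹ : ℝ) * ∑' z : Fin n → ℤ, 𝓕⁻ f (dualPt q z) := by
  obtain ⟨C, hC, hdec⟩ := schwartz_translate_decay f (n + 1)
  have hs : Summable fun z : Fin n → ℤ => ((cellVol q)⁻¹ : ℝ) * 𝓕⁻ f (dualPt q (-z)) :=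
    (((Equiv.neg (Fin n → ℤ)).summable_iff (f := fun z => 𝓕⁻ f (dualPt q z))).2
      (Summable.of_norm (summable_fourierInv_dualPt hq f))).mul_left _
  have hB : Continuous fun y => C * (1 + ‖diagMap q y‖) ^ (n + 1) := by
    have := continuous_diagMap q
    fun_prop
  have hF : Summable fun z : Fin n → ℤ => ∫ y : Fin n → ℝ,
      UnitAddTorus.mFourier (-z) (fun i => (y i : UnitAddCircle)) * f (diagMap q y) :=
    hs.congr fun z => (mFourierCoeff_comp_diagMap hq z f).symm
  have hbd : ∀ y (z : Fin n → ℤ), ‖f (diagMap q (y + fun i => (z i : ℝ)))‖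
      ≤ C * (1 + ‖diagMap q y‖) ^ (n + 1) * ((1 + ‖latticePt q z‖) ^ (n + 1))⁻¹ := by
    intro y z
    rw [diagMap_add_intCast]
    exact hdec _ _
  have key : ∑' z : Fin n → ℤ, f (diagMap q fun i => (z i : ℝ)) =
      ∑' z : Fin n → ℤ, ∫ y : Fin n → ℝ,
        UnitAddTorus.mFourier (-z) (fun i => (y i : UnitAddCircle)) * f (diagMap q y) :=
    poisson_pi (g := fun y => f (diagMap q y)) (f.continuous.comp (continuous_diagMap q))
    (integrable_comp_diagMap hq f.integrable) (summable_one_add_norm_latticePt hq) hB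
    (fun z => by positivity) hbd hF
  have h2 := (Equiv.neg (Fin n → ℤ)).tsum_eq fun z => 𝓕⁻ f (dualPt q z)
  simp only [Equiv.neg_apply] at h2
  rw [← h2, ← tsum_mul_left]
  simp only [mFourierCoeff_comp_diagMap hq] at key
  exact key

end FourierInv

/-! ### The Gaussian kernels and the short range part -/

section GaussianKernel

variable {n : ℕ}

/-- The density `π^{-n/2} s^{n/2-2} / 4` for which `∫₀^∞ e^{-s|x|²} ds` against it is the Newtonian
potential of `ℝⁿ` when `n > 2`; here `s = 1/(4t)`, where `t` is the time of the heat kernel. -/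
noncomputable def heatWeight (n : ℕ) (s : ℝ) : ℝ :=
  Real.pi ^ (-((n : ℝ) / 2)) * s ^ ((n : ℝ) / 2 - 2) / 4

/-- The matrix kernel whose integral over `s ∈ ]0, ∞[` is formally `Γ_{n,ω}`: the convolution kernel
of `e^{tΔ}` composed with the inverse symbol of `L[ω]`, in the variable `s = 1/(4t)`. -/
noncomputable def heatKer (ω : ℝ) (j k : Fin n) (s : ℝ) (x : EuclideanSpace ℝ (Fin n)) : ℝ :=
  -((ω + 2) / (2 * (ω + 1)) * (if j = k then 1 else 0) + ω / (ω + 1) * (s * (x j * x k)))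
    * (Real.exp (-s * ‖x‖ ^ 2) * heatWeight n s)

/-- The short range part of `Γ_{n,ω}`, the contribution of the parameters `s > a`. It has Gaussian
decay at infinity. Where the integral diverges, as may happen at the origin only, its value is `0`
by convention. -/
noncomputable def shortPart (ω : ℝ) (j k : Fin n) (a : ℝ) (x : EuclideanSpace ℝ (Fin n)) : ℝ :=
  ∫ s in Set.Ioi a, heatKer ω j k s x

theorem heatWeight_pos {s : ℝ} (hs : 0 < s) : 0 < heatWeight n s := by
  unfold heatWeight; positivity

theorem measurable_heatWeight : Measurable (heatWeight n) := by
  unfold heatWeight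
  exact ((measurable_id.pow_const _).const_mul _).div_const _

theorem measurable_heatKer (ω : ℝ) (j k : Fin n) :
    Measurable fun p : EuclideanSpace ℝ (Fin n) × ℝ => heatKer ω j k p.2 p.1 := by
  have h := measurable_heatWeight (n := n)
  have h1 : Measurable fun p : EuclideanSpace ℝ (Fin n) × ℝ => heatWeight n p.2 :=
    h.comp measurable_snd
  have h2 : Continuous fun p : EuclideanSpace ℝ (Fin n) × ℝ =>
      -((ω + 2) / (2 * (ω + 1)) * (if j = k then 1 else 0)
        + ω / (ω + 1) * (p.2 * (p.1 j * p.1 k))) := by fun_prop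
  have h3 : Continuous fun p : EuclideanSpace ℝ (Fin n) × ℝ => Real.exp (-p.2 * ‖p.1‖ ^ 2) := by
    fun_prop
  exact h2.measurable.mul (h3.measurable.mul h1)

theorem heatKer_neg (ω : ℝ) (j k : Fin n) (s : ℝ) (x : EuclideanSpace ℝ (Fin n)) :
    heatKer ω j k s (-x) = heatKer ω j k s x := by
  simp [heatKer]

theorem shortPart_neg (ω : ℝ) (j k : Fin n) (a : ℝ) (x : EuclideanSpace ℝ (Fin n)) :
    shortPart ω j k a (-x) = shortPart ω j k a x := by
  simp only [shortPart, heatKer_neg]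

theorem mul_exp_neg_le_exp_neg_half (u : ℝ) (hu : 0 ≤ u) :
    u * Real.exp (-u) ≤ Real.exp (-(u / 2)) := by
  have h1 : u ≤ Real.exp (u / 2) := by
    have := Real.quadratic_le_exp_of_nonneg (x := u / 2) (by positivity)
    nlinarith [sq_nonneg (u - 2)]
  calc u * Real.exp (-u) ≤ Real.exp (u / 2) * Real.exp (-u) := by gcongr
    _ = _ := by rw [← Real.exp_add]; ring_nf

theorem abs_apply_mul_apply_le (x : EuclideanSpace ℝ (Fin n)) (j k : Fin n) :
    |x j * x k| ≤ ‖x‖ ^ 2 := by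
  rw [abs_mul, sq]
  have h := fun i => PiLp.norm_apply_le x i
  simp only [Real.norm_eq_abs] at h
  gcongr <;> exact h _

/-- The constant in the Gaussian bound of `heatKer`. -/
noncomputable def kerConst (ω : ℝ) : ℝ := |(ω + 2) / (2 * (ω + 1))| + |ω / (ω + 1)|

theorem kerConst_nonneg (ω : ℝ) : 0 ≤ kerConst ω := by unfold kerConst; positivity

/-- The factor `s |x|²` of the kernel is absorbed by half of the Gaussian. -/
theorem abs_heatKer_le (ω : ℝ) (j k : Fin n) {s : ℝ} (hs : 0 < s)
    (x : EuclideanSpace ℝ (Fin n)) :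
    |heatKer ω j k s x| ≤ kerConst ω * (Real.exp (-(s * (1 / 2)) * ‖x‖ ^ 2) * heatWeight n s) := by
  have hw := (heatWeight_pos (n := n) hs).le
  rw [heatKer, abs_mul, abs_mul (Real.exp _), abs_of_nonneg hw, Real.abs_exp, abs_neg,
    ← mul_assoc (kerConst ω), ← mul_assoc |_|]
  refine mul_le_mul_of_nonneg_right ?_ hw
  set u := s * ‖x‖ ^ 2 with hu
  have hu0 : 0 ≤ u := by positivity
  have e1 : -s * ‖x‖ ^ 2 = -u := by rw [hu]; ring
  have e2 : -(s * (1 / 2)) * ‖x‖ ^ 2 = -(u / 2) := by rw [hu]; ring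
  rw [e1, e2]
  have h1 : |(ω + 2) / (2 * (ω + 1)) * (if j = k then 1 else 0) + ω / (ω + 1) * (s * (x j * x k))|
      ≤ |(ω + 2) / (2 * (ω + 1))| + |ω / (ω + 1)| * u := by
    refine (abs_add_le _ _).trans ?_
    rw [abs_mul, abs_mul (ω / (ω + 1)), abs_mul s, abs_of_pos hs]
    gcongr
    · split_ifs <;> simp
    · rw [hu]; gcongr; exact abs_apply_mul_apply_le x j k
  have h2 : Real.exp (-u) ≤ Real.exp (-(u / 2)) := Real.exp_le_exp.2 (by linarith)
  calc _ ≤ (|(ω + 2) / (2 * (ω + 1))| + |ω / (ω + 1)| * u) * Real.exp (-u) := by gcongr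
    _ = |(ω + 2) / (2 * (ω + 1))| * Real.exp (-u) + |ω / (ω + 1)| * (u * Real.exp (-u)) := by ring
    _ ≤ |(ω + 2) / (2 * (ω + 1))| * Real.exp (-(u / 2)) +
        |ω / (ω + 1)| * Real.exp (-(u / 2)) := by
          gcongr; exact mul_exp_neg_le_exp_neg_half u hu0
    _ = _ := by rw [kerConst]; ring

/-- Polynomial growth is absorbed by a Gaussian. -/
theorem one_add_pow_le_exp {a : ℝ} (ha : 0 < a) (m : ℕ) {r : ℝ} (hr : 0 ≤ r) :
    (1 + r) ^ m ≤ (m.factorial * Real.exp (1 + 1 / a)) * Real.exp (a * (1 / 4) * r ^ 2) := by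
  have h1 := Real.pow_div_factorial_le_exp (1 + r) (by positivity) m
  rw [div_le_iff₀ (by positivity)] at h1
  have h2 : 1 + r ≤ 1 + 1 / a + a * (1 / 4) * r ^ 2 := by
    -- completing the square
    have h3 : r ≤ 1 / a + a * (1 / 4) * r ^ 2 := by
      rw [← sub_nonneg]
      have : 1 / a + a * (1 / 4) * r ^ 2 - r = (1 - a * r / 2) ^ 2 / a := by field_simp; ring
      rw [this]; positivity
    linarith
  calc (1 + r) ^ m ≤ Real.exp (1 + r) * m.factorial := h1
    _ ≤ Real.exp (1 + 1 / a + a * (1 / 4) * r ^ 2) * m.factorial := by gcongr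
    _ = _ := by rw [Real.exp_add]; ring

theorem integrable_gaussian {b : ℝ} (hb : 0 < b) :
    Integrable fun x : EuclideanSpace ℝ (Fin n) => Real.exp (-b * ‖x‖ ^ 2) := by
  have := Integrable.re (𝕜 := ℂ) (GaussianFourier.integrable_cexp_neg_mul_sq_norm_add
    (b := (b : ℂ)) (by simpa using hb) 0 (0 : EuclideanSpace ℝ (Fin n)))
  refine (show Integrable _ _ from this).congr (Filter.Eventually.of_forall fun x => ?_)
  have h : -(b : ℂ) * ‖x‖ ^ 2 + 0 * (inner ℝ (0 : EuclideanSpace ℝ (Fin n)) x : ℝ)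
      = ((-b * ‖x‖ ^ 2 : ℝ) : ℂ) := by push_cast; ring
  simp only [h, ← Complex.ofReal_exp]
  exact Complex.ofReal_re _

theorem integral_gaussian_mul_heatWeight {b s : ℝ} (hb : 0 < b) (hs : 0 < s) :
    ∫ x : EuclideanSpace ℝ (Fin n), Real.exp (-(s * b) * ‖x‖ ^ 2) * heatWeight n s
      = b ^ (-((n : ℝ) / 2)) / 4 * s ^ (-2 : ℝ) := by
  rw [integral_mul_const, GaussianFourier.integral_rexp_neg_mul_sq_norm (by positivity),
    finrank_euclideanSpace_fin, heatWeight, Real.div_rpow Real.pi_pos.le (by positivity),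
    Real.mul_rpow hs.le hb.le, Real.rpow_neg Real.pi_pos.le, Real.rpow_neg hb.le,
    Real.rpow_sub hs, Real.rpow_neg hs.le]
  have h1 : (0 : ℝ) < Real.pi ^ ((n : ℝ) / 2) := by positivity
  have h2 : (0 : ℝ) < s ^ ((n : ℝ) / 2) := by positivity
  have h3 : (0 : ℝ) < b ^ ((n : ℝ) / 2) := by positivity
  field_simp

theorem integrable_gaussian_mul_heatWeight {a b : ℝ} (ha : 0 < a) (hb : 0 < b) :
    Integrable (fun p : EuclideanSpace ℝ (Fin n) × ℝ =>
      Real.exp (-(p.2 * b) * ‖p.1‖ ^ 2) * heatWeight n p.2)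
      (volume.prod (volume.restrict (Set.Ioi a))) := by
  have hm : Measurable fun p : EuclideanSpace ℝ (Fin n) × ℝ =>
      Real.exp (-(p.2 * b) * ‖p.1‖ ^ 2) * heatWeight n p.2 := by
    have h3 : Continuous fun p : EuclideanSpace ℝ (Fin n) × ℝ =>
      Real.exp (-(p.2 * b) * ‖p.1‖ ^ 2) := by fun_prop
    exact h3.measurable.mul (measurable_heatWeight.comp measurable_snd)
  rw [integrable_prod_iff' hm.aestronglyMeasurable]
  constructor
  · filter_upwards [ae_restrict_mem measurableSet_Ioi] with s hs
    have hs' : 0 < s := ha.trans hs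
    exact (integrable_gaussian (mul_pos hs' hb)).mul_const _
  · have h1 : IntegrableOn (fun s : ℝ => b ^ (-((n : ℝ) / 2)) / 4 * s ^ (-2 : ℝ)) (Set.Ioi a) :=
      (integrableOn_Ioi_rpow_of_lt (by norm_num) ha).const_mul _
    refine h1.congr_fun (fun s hs => ?_) measurableSet_Ioi
    have hs' : 0 < s := ha.trans hs
    show b ^ (-((n : ℝ) / 2)) / 4 * s ^ (-2 : ℝ)
      = ∫ x : EuclideanSpace ℝ (Fin n), ‖Real.exp (-(s * b) * ‖x‖ ^ 2) * heatWeight n s‖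
    rw [← integral_gaussian_mul_heatWeight hb hs']
    refine integral_congr_ae (Filter.Eventually.of_forall fun x => ?_)
    exact (Real.norm_of_nonneg (mul_nonneg (Real.exp_pos _).le (heatWeight_pos hs').le)).symm

/-- All the moments of the kernel are integrable in space and in the parameter away from `0`. -/
theorem integrable_pow_mul_heatKer (ω : ℝ) (j k : Fin n) {a : ℝ} (ha : 0 < a) (m : ℕ) :
    Integrable (fun p : EuclideanSpace ℝ (Fin n) × ℝ => (1 + ‖p.1‖) ^ m * heatKer ω j k p.2 p.1)
      (volume.prod (volume.restrict (Set.Ioi a))) := by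
  have hdom := (integrable_gaussian_mul_heatWeight (n := n) ha
    (show (0 : ℝ) < 1 / 4 by norm_num)).const_mul
      ((m.factorial * Real.exp (1 + 1 / a)) * kerConst ω)
  refine hdom.mono' ?_ ?_
  · have h1 : Continuous fun p : EuclideanSpace ℝ (Fin n) × ℝ => (1 + ‖p.1‖) ^ m := by fun_prop
    exact (h1.measurable.mul (measurable_heatKer ω j k)).aestronglyMeasurable
  · have hae : ∀ᵐ p ∂((volume : Measure (EuclideanSpace ℝ (Fin n))).prod
        (volume.restrict (Set.Ioi a))), p.2 ∈ Set.Ioi a :=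
      Measure.quasiMeasurePreserving_snd.ae (ae_restrict_mem measurableSet_Ioi)
    filter_upwards [hae] with p hp
    obtain ⟨x, s⟩ := p
    have hsa : a < s := hp
    have hs : 0 < s := ha.trans hsa
    have hw := (heatWeight_pos (n := n) hs).le
    have hk0 := kerConst_nonneg ω
    rw [norm_mul, Real.norm_of_nonneg (by positivity), Real.norm_eq_abs]
    have h1 := one_add_pow_le_exp ha m (norm_nonneg x)
    have h2 := abs_heatKer_le ω j k hs x
    have h3 : Real.exp (a * (1 / 4) * ‖x‖ ^ 2) * Real.exp (-(s * (1 / 2)) * ‖x‖ ^ 2)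
        ≤ Real.exp (-(s * (1 / 4)) * ‖x‖ ^ 2) := by
      rw [← Real.exp_add]
      apply Real.exp_le_exp.2
      nlinarith [sq_nonneg ‖x‖]
    calc _ ≤ ((m.factorial * Real.exp (1 + 1 / a)) * Real.exp (a * (1 / 4) * ‖x‖ ^ 2)) *
          (kerConst ω * (Real.exp (-(s * (1 / 2)) * ‖x‖ ^ 2) * heatWeight n s)) := by gcongr
      _ = (m.factorial * Real.exp (1 + 1 / a)) * kerConst ω *
          ((Real.exp (a * (1 / 4) * ‖x‖ ^ 2) * Real.exp (-(s * (1 / 2)) * ‖x‖ ^ 2)) *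
            heatWeight n s) := by ring
      _ ≤ _ := by gcongr

theorem integrable_heatKer_prod (ω : ℝ) (j k : Fin n) {a : ℝ} (ha : 0 < a) :
    Integrable (fun p : EuclideanSpace ℝ (Fin n) × ℝ => heatKer ω j k p.2 p.1)
      (volume.prod (volume.restrict (Set.Ioi a))) := by
  simpa using integrable_pow_mul_heatKer ω j k ha 0

theorem integrable_pow_mul_shortPart (ω : ℝ) (j k : Fin n) {a : ℝ} (ha : 0 < a) (m : ℕ) :
    Integrable fun x : EuclideanSpace ℝ (Fin n) => (1 + ‖x‖) ^ m * shortPart ω j k a x := by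
  refine (integrable_pow_mul_heatKer ω j k ha m).integral_prod_left.congr
    (Filter.Eventually.of_forall fun x => ?_)
  show ∫ s in Set.Ioi a, (1 + ‖x‖) ^ m * heatKer ω j k s x = _
  rw [integral_const_mul]
  rfl

theorem integrable_shortPart (ω : ℝ) (j k : Fin n) {a : ℝ} (ha : 0 < a) :
    Integrable (shortPart (n := n) ω j k a) := by
  simpa using integrable_pow_mul_shortPart ω j k ha 0

/-! ### Moments of the Gaussian against plane waves -/

theorem integrable_pow_mul_gaussian {b : ℝ} (hb : 0 < b) (m : ℕ) :
    Integrable fun x : EuclideanSpace ℝ (Fin n) => (1 + ‖x‖) ^ m * Real.exp (-b * ‖x‖ ^ 2) := by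
  refine ((integrable_gaussian (n := n) (half_pos hb)).const_mul
    (m.factorial * Real.exp (1 + 1 / (2 * b)))).mono' ?_ (Filter.Eventually.of_forall fun x => ?_)
  · have : Continuous fun x : EuclideanSpace ℝ (Fin n) =>
      (1 + ‖x‖) ^ m * Real.exp (-b * ‖x‖ ^ 2) := by fun_prop
    exact this.aestronglyMeasurable
  · rw [Real.norm_of_nonneg (by positivity)]
    have h1 := one_add_pow_le_exp (a := 2 * b) (by positivity) m (norm_nonneg x)
    calc _ ≤ (m.factorial * Real.exp (1 + 1 / (2 * b))) * Real.exp (2 * b * (1 / 4) * ‖x‖ ^ 2)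
          * Real.exp (-b * ‖x‖ ^ 2) := by gcongr
      _ = _ := by rw [mul_assoc, ← Real.exp_add]; ring_nf

theorem _root_.HasLineDerivAt.congr_value {E F : Type*} [AddCommGroup E] [Module ℝ E]
    [NormedAddCommGroup F] [NormedSpace ℝ F] {f : E → F} {a b : F} {x v : E}
    (h : HasLineDerivAt ℝ f a x v) (e : a = b) : HasLineDerivAt ℝ f b x v := e ▸ h

/-- Integration by parts against a Gaussian: multiplication by `x_j` becomes a derivative. -/
theorem integral_apply_mul_gaussian {b : ℝ} (hb : 0 < b) (j : Fin n)
    {h h' : EuclideanSpace ℝ (Fin n) → ℂ} (hh : Continuous h) (hh' : Continuous h')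
    (hd : ∀ x, HasLineDerivAt ℝ h (h' x) x (EuclideanSpace.single j (1 : ℝ)))
    {C : ℝ} (hC : ∀ x, ‖h x‖ ≤ C * (1 + ‖x‖)) (hC' : ∀ x, ‖h' x‖ ≤ C * (1 + ‖x‖)) :
    ∫ x : EuclideanSpace ℝ (Fin n), (x j : ℂ) * h x * (Real.exp (-b * ‖x‖ ^ 2) : ℂ)
      = 1 / (2 * b) * ∫ x, h' x * (Real.exp (-b * ‖x‖ ^ 2) : ℂ) := by
  set g : EuclideanSpace ℝ (Fin n) → ℂ := fun x => (Real.exp (-b * ‖x‖ ^ 2) : ℂ) with hg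
  have hgc : Continuous g := by rw [hg]; fun_prop
  have hgn : ∀ x, ‖g x‖ = Real.exp (-b * ‖x‖ ^ 2) := fun x => by
    rw [hg]
    simp only [Complex.norm_real, Real.norm_eq_abs, Real.abs_exp]
  have hgd : ∀ x, HasLineDerivAt ℝ g (-(2 * b) * (x j : ℂ) * g x) x
      (EuclideanSpace.single j (1 : ℝ)) := by
    intro x
    have h1 : HasFDerivAt (fun x : EuclideanSpace ℝ (Fin n) => Real.exp (-b * ‖x‖ ^ 2))
        (Real.exp (-b * ‖x‖ ^ 2) • (-b) • (2 • (innerSL ℝ x))) x :=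
      (((hasStrictFDerivAt_norm_sq x).hasFDerivAt).const_mul (-b)).exp
    have h2 := (Complex.ofRealCLM.hasFDerivAt.comp x h1).hasLineDerivAt
      (EuclideanSpace.single j (1 : ℝ))
    refine h2.congr_value ?_
    simp [hg, EuclideanSpace.inner_single_right]
    ring
  have hdom := integrable_pow_mul_gaussian (n := n) hb 2
  have hC0 : 0 ≤ C := by
    have := (norm_nonneg _).trans (hC 0)
    simpa using this
  have hx1 : ∀ x : EuclideanSpace ℝ (Fin n), ‖(x j : ℂ)‖ ≤ 1 + ‖x‖ := fun x => by
    rw [Complex.norm_real]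
    linarith [PiLp.norm_apply_le x j]
  have hone : ∀ x : EuclideanSpace ℝ (Fin n), 1 ≤ 1 + ‖x‖ := fun x => by
    linarith [norm_nonneg x]
  have i1 : Integrable fun x => g x * h' x := by
    refine (hdom.const_mul C).mono' (hgc.mul hh').aestronglyMeasurable
      (Filter.Eventually.of_forall fun x => ?_)
    rw [norm_mul, hgn]
    calc _ ≤ Real.exp (-b * ‖x‖ ^ 2) * (C * (1 + ‖x‖)) := by gcongr; exact hC' x
      _ ≤ Real.exp (-b * ‖x‖ ^ 2) * (C * (1 + ‖x‖) ^ 2) := by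
          gcongr; exact le_self_pow₀ (hone x) (by norm_num)
      _ = _ := by ring
  have i2 : Integrable fun x => g x * h x := by
    refine (hdom.const_mul C).mono' (hgc.mul hh).aestronglyMeasurable
      (Filter.Eventually.of_forall fun x => ?_)
    rw [norm_mul, hgn]
    calc _ ≤ Real.exp (-b * ‖x‖ ^ 2) * (C * (1 + ‖x‖)) := by gcongr; exact hC x
      _ ≤ Real.exp (-b * ‖x‖ ^ 2) * (C * (1 + ‖x‖) ^ 2) := by
          gcongr; exact le_self_pow₀ (hone x) (by norm_num)
      _ = _ := by ring
  have i3 : Integrable fun x => (-(2 * b) * (x j : ℂ) * g x) * h x := by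
    refine (hdom.const_mul (2 * b * C)).mono' ?_
      (Filter.Eventually.of_forall fun x => ?_)
    · have : Continuous fun x : EuclideanSpace ℝ (Fin n) => (-(2 * b) * (x j : ℂ) * g x) * h x := by
        fun_prop
      exact this.aestronglyMeasurable
    · rw [norm_mul, norm_mul, norm_mul, hgn]
      have : ‖-(2 * (b : ℂ))‖ = 2 * b := by
        rw [norm_neg, norm_mul, Complex.norm_real, Real.norm_of_nonneg hb.le]; simp
      rw [this]
      calc _ ≤ 2 * b * (1 + ‖x‖) * Real.exp (-b * ‖x‖ ^ 2) * (C * (1 + ‖x‖)) := by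
            gcongr; exacts [hx1 x, hC x]
        _ = _ := by ring
  have key := integral_bilinear_hasLineDerivAt_right_eq_neg_left_of_integrable
    (B := ContinuousLinearMap.mul ℝ ℂ) (f := g) (g := h) (μ := volume)
    (f' := fun x => -(2 * b) * (x j : ℂ) * g x)
    (g' := h') (v := EuclideanSpace.single j (1 : ℝ)) i3 i1 i2 (fun x _ => hgd x) (fun x _ => hd x)
  simp only [ContinuousLinearMap.mul_apply'] at key
  have e1 : ∫ x, h' x * g x = ∫ x, g x * h' x := by simp only [mul_comm]
  rw [e1, key, ← integral_neg, ← integral_const_mul]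
  refine integral_congr_ae (Filter.Eventually.of_forall fun x => ?_)
  have hb' : (b : ℂ) ≠ 0 := by exact_mod_cast hb.ne'
  simp only [hg]
  field_simp

theorem hasLineDerivAt_expFun (ξ x : EuclideanSpace ℝ (Fin n)) (j : Fin n) :
    HasLineDerivAt ℝ (expFun ξ) (2 * Real.pi * Complex.I * ξ j * expFun ξ x) x
      (EuclideanSpace.single j (1 : ℝ)) := by
  have h1 : HasFDerivAt (fun x => (2 * Real.pi * Complex.I) * ((inner ℝ ξ x : ℝ) : ℂ))
      ((2 * Real.pi * Complex.I) • (Complex.ofRealCLM.comp (innerSL ℝ ξ))) x :=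
    (Complex.ofRealCLM.hasFDerivAt.comp x (innerSL ℝ ξ).hasFDerivAt).const_mul _
  have h2 := h1.cexp.hasLineDerivAt (EuclideanSpace.single j (1 : ℝ))
  refine h2.congr_value ?_
  simp [EuclideanSpace.inner_single_right, expFun]
  ring

theorem integral_expFun_mul_gaussian {b : ℝ} (hb : 0 < b) (ξ : EuclideanSpace ℝ (Fin n)) :
    ∫ x, expFun ξ x * (Real.exp (-b * ‖x‖ ^ 2) : ℂ)
      = (((Real.pi / b) ^ ((n : ℝ) / 2) * Real.exp (-(Real.pi ^ 2 * ‖ξ‖ ^ 2) / b) : ℝ) : ℂ) := by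
  have h := GaussianFourier.integral_cexp_neg_mul_sq_norm_add (b := (b : ℂ)) (by simpa using hb)
    (2 * Real.pi * Complex.I) ξ
  rw [finrank_euclideanSpace_fin] at h
  have e : ((Real.pi : ℂ) / b) ^ ((n : ℂ) / 2) = (((Real.pi / b) ^ ((n : ℝ) / 2) : ℝ) : ℂ) := by
    rw [Complex.ofReal_cpow (by positivity)]; push_cast; rfl
  rw [e] at h
  push_cast
  rw [Complex.ofReal_cpow (by positivity)] at h ⊢
  convert h using 1
  · refine integral_congr_ae (Filter.Eventually.of_forall fun x => ?_)
    simp only [expFun]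
    rw [← Complex.exp_add]; congr 1; ring
  · congr 2
    have : (2 * Real.pi * Complex.I) ^ 2 = -(4 * (Real.pi : ℂ) ^ 2) := by
      rw [mul_pow, mul_pow, Complex.I_sq]; ring
    rw [this]
    have hb' : (b : ℂ) ≠ 0 := by exact_mod_cast hb.ne'
    field_simp

/-- The second moments of a Gaussian against a plane wave, by two integrations by parts. -/
theorem integral_apply_apply_mul_expFun_mul_gaussian {b : ℝ} (hb : 0 < b) (j k : Fin n)
    (ξ : EuclideanSpace ℝ (Fin n)) :
    ∫ x, (x j : ℂ) * ((x k : ℂ) * expFun ξ x) * (Real.exp (-b * ‖x‖ ^ 2) : ℂ)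
      = 1 / (2 * b) * ((if j = k then 1 else 0) - 2 * Real.pi ^ 2 * (ξ j * ξ k) / b)
        * ∫ x, expFun ξ x * (Real.exp (-b * ‖x‖ ^ 2) : ℂ) := by
  have hb' : (b : ℂ) ≠ 0 := by exact_mod_cast hb.ne'
  have hc := continuous_expFun ξ
  have hxk : ∀ x : EuclideanSpace ℝ (Fin n), ‖(x k : ℂ)‖ ≤ ‖x‖ := fun x => by
    rw [Complex.norm_real]; exact PiLp.norm_apply_le x k
  set c : ℂ := 2 * Real.pi * Complex.I with hcdef
  have hξ : ∀ i, ‖c * ξ i‖ ≤ 2 * Real.pi * ‖ξ‖ := fun i => by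
    rw [norm_mul, Complex.norm_real]
    have : ‖c‖ = 2 * Real.pi := by simp [hcdef, abs_of_pos Real.pi_pos]
    rw [this]
    gcongr
    exact PiLp.norm_apply_le ξ i
  have hpi := Real.pi_pos
  have s1 : ∫ x, (x k : ℂ) * expFun ξ x * (Real.exp (-b * ‖x‖ ^ 2) : ℂ)
      = 1 / (2 * b) * (c * ξ k * ∫ x, expFun ξ x * (Real.exp (-b * ‖x‖ ^ 2) : ℂ)) := by
    rw [integral_apply_mul_gaussian hb k hc (h' := fun x => c * ξ k * expFun ξ x)
      (continuous_const.mul hc)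
      (fun x => hasLineDerivAt_expFun ξ x k) (C := 1 + 2 * Real.pi * ‖ξ‖),
      ← integral_const_mul (c * ξ k)]
    · congr 1
      refine integral_congr_ae (Filter.Eventually.of_forall fun x => ?_)
      simp only; ring
    · intro x
      rw [norm_expFun]
      nlinarith [norm_nonneg x, norm_nonneg ξ, mul_nonneg hpi.le (norm_nonneg ξ),
        mul_nonneg (mul_nonneg hpi.le (norm_nonneg ξ)) (norm_nonneg x)]
    · intro x
      rw [norm_mul, norm_expFun, mul_one]
      refine (hξ k).trans ?_
      nlinarith [norm_nonneg x, norm_nonneg ξ, mul_nonneg hpi.le (norm_nonneg ξ),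
        mul_nonneg (mul_nonneg hpi.le (norm_nonneg ξ)) (norm_nonneg x)]
  have hder : ∀ x, HasLineDerivAt ℝ (fun x : EuclideanSpace ℝ (Fin n) => (x k : ℂ) * expFun ξ x)
      ((if j = k then 1 else 0) * expFun ξ x + (x k : ℂ) * (c * ξ j * expFun ξ x)) x
      (EuclideanSpace.single j (1 : ℝ)) := by
    intro x
    have h1 : HasLineDerivAt ℝ (fun x : EuclideanSpace ℝ (Fin n) => (x k : ℂ))
        (if j = k then 1 else 0) x (EuclideanSpace.single j (1 : ℝ)) := by
      have := ((Complex.ofRealCLM.comp (EuclideanSpace.proj k : EuclideanSpace ℝ (Fin n) →L[ℝ] ℝ)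
        ).hasFDerivAt (x := x)).hasLineDerivAt (EuclideanSpace.single j (1 : ℝ))
      refine HasLineDerivAt.congr_value this ?_
      by_cases hjk : j = k
      · simp [hjk]
      · simp [hjk, Ne.symm hjk]
    have := HasDerivAt.mul h1 (hasLineDerivAt_expFun ξ x j)
    rw [zero_smul, add_zero] at this
    exact this
  rw [integral_apply_mul_gaussian hb j (by fun_prop) (by fun_prop) hder
    (C := 1 + 2 * Real.pi * ‖ξ‖)]
  · have hg1 : Integrable fun x => expFun ξ x * (Real.exp (-b * ‖x‖ ^ 2) : ℂ) := by
      refine (integrable_gaussian hb).mono' (by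
        have : Continuous fun x => expFun ξ x * (Real.exp (-b * ‖x‖ ^ 2) : ℂ) := by fun_prop
        exact this.aestronglyMeasurable) (Filter.Eventually.of_forall fun x => ?_)
      rw [norm_mul, norm_expFun, one_mul, Complex.norm_real, Real.norm_eq_abs, Real.abs_exp]
    have hg2 : Integrable fun x => (x k : ℂ) * expFun ξ x * (Real.exp (-b * ‖x‖ ^ 2) : ℂ) := by
      refine (integrable_pow_mul_gaussian hb 1).mono' (by
        have : Continuous fun x : EuclideanSpace ℝ (Fin n) =>
          (x k : ℂ) * expFun ξ x * (Real.exp (-b * ‖x‖ ^ 2) : ℂ) := by fun_prop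
        exact this.aestronglyMeasurable) (Filter.Eventually.of_forall fun x => ?_)
      rw [norm_mul, norm_mul, norm_expFun, mul_one, Complex.norm_real (Real.exp _),
        Real.norm_eq_abs, Real.abs_exp, pow_one]
      gcongr
      linarith [hxk x]
    have e : ∫ x, ((if j = k then 1 else 0) * expFun ξ x + (x k : ℂ) * (c * ξ j * expFun ξ x)) *
        (Real.exp (-b * ‖x‖ ^ 2) : ℂ)
        = (if j = k then 1 else 0) * (∫ x, expFun ξ x * (Real.exp (-b * ‖x‖ ^ 2) : ℂ))
          + c * ξ j * ∫ x, (x k : ℂ) * expFun ξ x * (Real.exp (-b * ‖x‖ ^ 2) : ℂ) := by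
      rw [← integral_const_mul, ← integral_const_mul, ← integral_add (hg1.const_mul _)
        (hg2.const_mul _)]
      refine integral_congr_ae (Filter.Eventually.of_forall fun x => ?_)
      simp only; ring
    rw [e, s1]
    have hc2 : c ^ 2 = -(4 * (Real.pi : ℂ) ^ 2) := by
      rw [hcdef, mul_pow, mul_pow, Complex.I_sq]; ring
    generalize ∫ x, expFun ξ x * (Real.exp (-b * ‖x‖ ^ 2) : ℂ) = J
    field_simp
    linear_combination (ξ j * ξ k * J : ℂ) * hc2
  · intro x
    rw [norm_mul, norm_expFun, mul_one]
    refine (hxk x).trans ?_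
    nlinarith [norm_nonneg x, norm_nonneg ξ, mul_nonneg hpi.le (norm_nonneg ξ),
        mul_nonneg (mul_nonneg hpi.le (norm_nonneg ξ)) (norm_nonneg x)]
  · intro x
    have h1 : ‖(if j = k then (1 : ℂ) else 0) * expFun ξ x‖ ≤ 1 := by
      rw [norm_mul, norm_expFun, mul_one]; split_ifs <;> simp
    have h2 : ‖(x k : ℂ) * (c * ξ j * expFun ξ x)‖ ≤ ‖x‖ * (2 * Real.pi * ‖ξ‖) := by
      rw [norm_mul, norm_mul (c * _), norm_expFun, mul_one]
      gcongr
      exacts [hxk x, hξ j]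
    refine (norm_add_le _ _).trans ((add_le_add h1 h2).trans ?_)
    nlinarith [norm_nonneg x, norm_nonneg ξ, mul_nonneg hpi.le (norm_nonneg ξ),
        mul_nonneg (mul_nonneg hpi.le (norm_nonneg ξ)) (norm_nonneg x)]

end GaussianKernel

/-! ### The Fourier transform of the short range part -/

section Symbols

variable {n : ℕ}

/-- The inverse of the symbol of `L[ω]`, i.e. the Fourier transform of `Γ_{n,ω}` off the origin. -/
noncomputable def invSymbol (ω : ℝ) (j k : Fin n) (ξ : EuclideanSpace ℝ (Fin n)) : ℝ :=
  1 / (4 * Real.pi ^ 2 * ‖ξ‖ ^ 2) *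
    (-(if j = k then 1 else 0) + ω / (ω + 1) * (ξ j * ξ k / ‖ξ‖ ^ 2))

/-- The part of `invSymbol` coming from the parameters `s < a` of `heatKer`. It has Gaussian
decay. -/
noncomputable def longSymbol (ω : ℝ) (j k : Fin n) (a : ℝ) (ξ : EuclideanSpace ℝ (Fin n)) : ℝ :=
  Real.exp (-(Real.pi ^ 2 * ‖ξ‖ ^ 2) / a) *
    (invSymbol ω j k ξ + ω / (ω + 1) * (ξ j * ξ k) / (4 * ‖ξ‖ ^ 2 * a))

/-- The Fourier transform of `heatKer` in the space variable. -/
noncomputable def heatKerHat (ω : ℝ) (j k : Fin n) (s : ℝ) (ξ : EuclideanSpace ℝ (Fin n)) : ℝ :=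
  -(1 / (4 * s ^ 2)) * ((if j = k then 1 else 0) - ω / (ω + 1) * Real.pi ^ 2 * (ξ j * ξ k) / s)
    * Real.exp (-(Real.pi ^ 2 * ‖ξ‖ ^ 2) / s)

theorem heatWeight_mul_rpow {s : ℝ} (hs : 0 < s) :
    heatWeight n s * (Real.pi / s) ^ ((n : ℝ) / 2) = 1 / (4 * s ^ 2) := by
  rw [heatWeight, Real.div_rpow Real.pi_pos.le hs.le, Real.rpow_neg Real.pi_pos.le,
    Real.rpow_sub hs]
  have h1 : (0 : ℝ) < Real.pi ^ ((n : ℝ) / 2) := by positivity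
  have h2 : (0 : ℝ) < s ^ ((n : ℝ) / 2) := by positivity
  have h3 : s ^ (2 : ℝ) = s ^ 2 := by norm_cast
  rw [h3]
  field_simp

theorem integral_expFun_mul_heatKer {ω : ℝ} (hω : ω + 1 ≠ 0) (j k : Fin n) {s : ℝ} (hs : 0 < s)
    (ξ : EuclideanSpace ℝ (Fin n)) :
    ∫ x, expFun ξ x * (heatKer ω j k s x : ℂ) = (heatKerHat ω j k s ξ : ℂ) := by
  have hg1 : Integrable fun x => expFun ξ x * (Real.exp (-s * ‖x‖ ^ 2) : ℂ) := by
    refine (integrable_gaussian hs).mono' ((continuous_expFun ξ).mul (by fun_prop)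
      |>.aestronglyMeasurable) (Filter.Eventually.of_forall fun x => ?_)
    rw [norm_mul, norm_expFun, one_mul, Complex.norm_real, Real.norm_eq_abs, Real.abs_exp]
  have hg2 : Integrable fun x =>
      (x j : ℂ) * ((x k : ℂ) * expFun ξ x) * (Real.exp (-s * ‖x‖ ^ 2) : ℂ) := by
    have hc := continuous_expFun ξ
    refine (integrable_pow_mul_gaussian hs 2).mono' (by
        have : Continuous fun x : EuclideanSpace ℝ (Fin n) =>
          (x j : ℂ) * ((x k : ℂ) * expFun ξ x) * (Real.exp (-s * ‖x‖ ^ 2) : ℂ) := by fun_prop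
        exact this.aestronglyMeasurable) (Filter.Eventually.of_forall fun x => ?_)
    rw [← mul_assoc, norm_mul, norm_mul, norm_expFun, mul_one, Complex.norm_real (Real.exp _),
      Real.norm_eq_abs, Real.abs_exp, ← Complex.ofReal_mul, Complex.norm_real, Real.norm_eq_abs]
    gcongr
    exact (abs_apply_mul_apply_le x j k).trans (by gcongr; linarith)
  set c1 : ℝ := (ω + 2) / (2 * (ω + 1)) * (if j = k then 1 else 0) with hc1
  set α : ℝ := ω / (ω + 1) with hα
  have e : ∀ x, expFun ξ x * (heatKer ω j k s x : ℂ)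
      = -(c1 * heatWeight n s : ℂ) * (expFun ξ x * (Real.exp (-s * ‖x‖ ^ 2) : ℂ))
        + -(α * s * heatWeight n s : ℂ) *
          ((x j : ℂ) * ((x k : ℂ) * expFun ξ x) * (Real.exp (-s * ‖x‖ ^ 2) : ℂ)) := by
    intro x
    rw [heatKer, ← hc1, ← hα]
    push_cast
    ring
  simp only [e]
  rw [integral_add (hg1.const_mul _) (hg2.const_mul _), integral_const_mul, integral_const_mul,
    integral_apply_apply_mul_expFun_mul_gaussian hs, integral_expFun_mul_gaussian hs]
  have hδ : (if j = k then (1 : ℂ) else 0) = ((if j = k then (1 : ℝ) else 0 : ℝ) : ℂ) := by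
    split_ifs <;> simp
  rw [hδ, heatKerHat, ← hα]
  have hw := heatWeight_mul_rpow (n := n) hs
  have hs' := hs.ne'
  have hαc : (ω + 2) / (2 * (ω + 1)) = 1 - α / 2 := by
    rw [hα]; field_simp; ring
  rw [hαc] at hc1
  generalize (if j = k then (1 : ℝ) else 0) = D at *
  generalize Real.exp (-(Real.pi ^ 2 * ‖ξ‖ ^ 2) / s) = X
  generalize (Real.pi / s) ^ ((n : ℝ) / 2) = G at *
  norm_cast
  rw [hc1, ← hw]
  field_simp
  ring

/-- The symbol `longSymbol` is a primitive of `heatKerHat` in the parameter, with limit `invSymbol`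
at infinity. -/
theorem integral_heatKerHat {ω : ℝ} (j k : Fin n) {a : ℝ} (ha : 0 < a)
    {ξ : EuclideanSpace ℝ (Fin n)} (hξ : ξ ≠ 0)
    (hint : IntegrableOn (fun s => heatKerHat ω j k s ξ) (Set.Ioi a)) :
    ∫ s in Set.Ioi a, heatKerHat ω j k s ξ = invSymbol ω j k ξ - longSymbol ω j k a ξ := by
  have hn : 0 < ‖ξ‖ := norm_pos_iff.2 hξ
  refine integral_Ioi_of_hasDerivAt_of_tendsto' (f := fun s => longSymbol ω j k s ξ) ?_ hint ?_
  · intro s hs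
    have hs0 : 0 < s := ha.trans_le hs
    have hs' := hs0.ne'
    have h1 : HasDerivAt (fun s : ℝ => Real.exp (-(Real.pi ^ 2 * ‖ξ‖ ^ 2) / s))
        (Real.exp (-(Real.pi ^ 2 * ‖ξ‖ ^ 2) / s) * ((Real.pi ^ 2 * ‖ξ‖ ^ 2) / s ^ 2)) s := by
      have := ((hasDerivAt_inv hs').const_mul (-(Real.pi ^ 2 * ‖ξ‖ ^ 2))).exp
      simp only [← div_eq_mul_inv] at this
      convert this using 1
      field_simp
    have h2 : HasDerivAt (fun s : ℝ => invSymbol ω j k ξ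
        + ω / (ω + 1) * (ξ j * ξ k) / (4 * ‖ξ‖ ^ 2 * s))
        (-(ω / (ω + 1) * (ξ j * ξ k) / (4 * ‖ξ‖ ^ 2 * s ^ 2))) s := by
      have := ((hasDerivAt_inv hs').const_mul (ω / (ω + 1) * (ξ j * ξ k) / (4 * ‖ξ‖ ^ 2))).const_add
        (invSymbol ω j k ξ)
      have hf : (fun s : ℝ => invSymbol ω j k ξ + ω / (ω + 1) * (ξ j * ξ k) / (4 * ‖ξ‖ ^ 2 * s))
          = fun s => invSymbol ω j k ξ + ω / (ω + 1) * (ξ j * ξ k) / (4 * ‖ξ‖ ^ 2) * s⁻¹ := by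
        funext s; rw [div_mul_eq_div_div, div_eq_mul_inv _ s]
      rw [hf]
      refine this.congr_deriv ?_
      rw [div_mul_eq_div_div _ (4 * ‖ξ‖ ^ 2) (s ^ 2), div_eq_mul_inv _ (s ^ 2)]
      ring
    refine (h1.mul h2).congr_deriv ?_
    rw [heatKerHat, invSymbol]
    generalize ω / (ω + 1) = α
    generalize (if j = k then (1 : ℝ) else 0) = D
    have hpi := Real.pi_pos.ne'
    field_simp
    ring
  · have h1 : Filter.Tendsto (fun s : ℝ => s⁻¹) Filter.atTop (nhds 0) := tendsto_inv_atTop_zero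
    have h2 := ((h1.const_mul (-(Real.pi ^ 2 * ‖ξ‖ ^ 2))).rexp).mul
      ((h1.const_mul (ω / (ω + 1) * (ξ j * ξ k) / (4 * ‖ξ‖ ^ 2))).const_add (invSymbol ω j k ξ))
    simp only [mul_zero, add_zero, Real.exp_zero, one_mul] at h2
    refine h2.congr fun s => ?_
    rw [longSymbol]
    simp only [div_eq_mul_inv, mul_inv]
    ring_nf

theorem integrable_expFun_mul_heatKer (ω : ℝ) (j k : Fin n) {a : ℝ} (ha : 0 < a)
    (ξ : EuclideanSpace ℝ (Fin n)) :
    Integrable (fun p : EuclideanSpace ℝ (Fin n) × ℝ => expFun ξ p.1 * (heatKer ω j k p.2 p.1 : ℂ))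
      (volume.prod (volume.restrict (Set.Ioi a))) :=
  ((integrable_heatKer_prod ω j k ha).ofReal (𝕜 := ℂ)).bdd_mul (c := 1)
    ((continuous_expFun ξ).comp continuous_fst).aestronglyMeasurable
    (Filter.Eventually.of_forall fun p => (norm_expFun ξ p.1).le)

theorem integrableOn_heatKerHat {ω : ℝ} (hω : ω + 1 ≠ 0) (j k : Fin n) {a : ℝ} (ha : 0 < a)
    (ξ : EuclideanSpace ℝ (Fin n)) :
    IntegrableOn (fun s => heatKerHat ω j k s ξ) (Set.Ioi a) := by
  have h1 := (integrable_expFun_mul_heatKer ω j k ha ξ).integral_prod_right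
  have h2 : Integrable (fun s => (heatKerHat ω j k s ξ : ℂ)) (volume.restrict (Set.Ioi a)) := by
    refine h1.congr ?_
    filter_upwards [ae_restrict_mem measurableSet_Ioi] with s hs
    exact integral_expFun_mul_heatKer hω j k (ha.trans hs) ξ
  exact Integrable.re (𝕜 := ℂ) h2

theorem integral_expFun_mul_shortPart_eq {ω : ℝ} (hω : ω + 1 ≠ 0) (j k : Fin n) {a : ℝ}
    (ha : 0 < a) (ξ : EuclideanSpace ℝ (Fin n)) :
    ∫ x, expFun ξ x * (shortPart ω j k a x : ℂ)
      = ((∫ s in Set.Ioi a, heatKerHat ω j k s ξ : ℝ) : ℂ) := by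
  have h1 : ∀ x, expFun ξ x * (shortPart ω j k a x : ℂ)
      = ∫ s in Set.Ioi a, expFun ξ x * (heatKer ω j k s x : ℂ) := by
    intro x
    rw [integral_const_mul, shortPart, integral_complex_ofReal]
  simp only [h1]
  rw [integral_integral_swap (integrable_expFun_mul_heatKer ω j k ha ξ), ← integral_complex_ofReal]
  refine setIntegral_congr_fun measurableSet_Ioi fun s hs => ?_
  exact integral_expFun_mul_heatKer hω j k (ha.trans hs) ξ

/-- The Fourier transform of the short range part: it is the inverse symbol up to a Gaussian
remainder. -/
theorem integral_expFun_mul_shortPart {ω : ℝ} (hω : ω + 1 ≠ 0) (j k : Fin n) {a : ℝ}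
    (ha : 0 < a) {ξ : EuclideanSpace ℝ (Fin n)} (hξ : ξ ≠ 0) :
    ∫ x, expFun ξ x * (shortPart ω j k a x : ℂ)
      = ((invSymbol ω j k ξ - longSymbol ω j k a ξ : ℝ) : ℂ) := by
  rw [integral_expFun_mul_shortPart_eq hω j k ha,
    integral_heatKerHat j k ha hξ (integrableOn_heatKerHat hω j k ha ξ)]

/-- The mean of the short range part, which is the value of its Fourier transform at the frequency
`0`, where `invSymbol - longSymbol` is not defined. -/
theorem integral_shortPart {ω : ℝ} (hω : ω + 1 ≠ 0) (j k : Fin n) {a : ℝ} (ha : 0 < a) :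
    ∫ x, (shortPart (n := n) ω j k a x : ℂ) = ((-(if j = k then 1 else 0) / (4 * a) : ℝ) : ℂ) := by
  have h := integral_expFun_mul_shortPart_eq hω j k ha (0 : EuclideanSpace ℝ (Fin n))
  simp only [expFun_zero_left, one_mul] at h
  rw [h]
  congr 1
  have h2 : ∀ s ∈ Set.Ioi a, heatKerHat ω j k s (0 : EuclideanSpace ℝ (Fin n))
      = -(if j = k then 1 else 0) / 4 * s ^ (-2 : ℝ) := by
    intro s hs
    have hs0 : 0 < s := ha.trans hs
    have h3 : s ^ (-2 : ℝ) = (s ^ 2)⁻¹ := by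
      rw [Real.rpow_neg hs0.le]; norm_cast
    rw [h3, heatKerHat]
    generalize (if j = k then (1 : ℝ) else 0) = D
    simp
    ring
  rw [setIntegral_congr_fun measurableSet_Ioi h2, integral_const_mul,
    integral_Ioi_rpow_of_lt (by norm_num) ha]
  have h4 : a ^ ((-2 : ℝ) + 1) = a⁻¹ := by
    rw [show (-2 : ℝ) + 1 = -1 by norm_num, Real.rpow_neg_one]
  rw [h4]
  field_simp
  norm_num

end Symbols

/-! ### The Gaussian representation of the fundamental solution -/

section FundamentalSolution

variable {n : ℕ}

theorem sphereArea_eq (hn : 0 < n) :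
    sphereArea n = 2 * Real.pi ^ ((n : ℝ) / 2) / Real.Gamma ((n : ℝ) / 2) := by
  have : Nonempty (Fin n) := ⟨⟨0, hn⟩⟩
  have hn' : (0 : ℝ) < (n : ℝ) / 2 := by positivity
  have hG := Real.Gamma_pos_of_pos hn'
  rw [sphereArea, Measure.toSphere_real_apply_univ, finrank_euclideanSpace_fin, measureReal_def,
    EuclideanSpace.volume_ball, Fintype.card_fin, Real.Gamma_add_one hn'.ne', ENNReal.ofReal_one,
    one_pow, one_mul, ENNReal.toReal_ofReal (by positivity)]
  have h : √Real.pi ^ n = Real.pi ^ ((n : ℝ) / 2) := by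
    rw [Real.sqrt_eq_rpow, ← Real.rpow_natCast, ← Real.rpow_mul Real.pi_pos.le]
    ring_nf
  rw [h]
  have hn2 : (n : ℝ) ≠ 0 := by positivity
  field_simp

theorem sphereArea_pos (hn : 0 < n) : 0 < sphereArea n := by
  rw [sphereArea_eq hn]
  have hn' : (0 : ℝ) < (n : ℝ) / 2 := by positivity
  have hG := Real.Gamma_pos_of_pos hn'
  positivity

theorem mul_heatWeight {s : ℝ} (hs : 0 < s) :
    s * heatWeight n s = Real.pi ^ (-((n : ℝ) / 2)) / 4 * s ^ ((n : ℝ) / 2 - 1) := by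
  have h : s ^ ((n : ℝ) / 2 - 1) = s ^ ((n : ℝ) / 2 - 2) * s := by
    rw [← Real.rpow_add_one hs.ne']; ring_nf
  rw [heatWeight, h]; ring

/-- The Gamma integral, with the Gamma factor absorbed in the area of the sphere. -/
theorem integral_mul_heatWeight_mul_exp (hn : 0 < n) {ρ : ℝ} (hρ : 0 < ρ) :
    ∫ s in Set.Ioi 0, s * heatWeight n s * Real.exp (-(ρ * s))
      = ρ ^ (-((n : ℝ) / 2)) / (2 * sphereArea n) := by
  have hn' : (0 : ℝ) < (n : ℝ) / 2 := by positivity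
  have hG := Real.Gamma_pos_of_pos hn'
  have h1 : ∀ s ∈ Set.Ioi (0 : ℝ), s * heatWeight n s * Real.exp (-(ρ * s))
      = Real.pi ^ (-((n : ℝ) / 2)) / 4 * (s ^ ((n : ℝ) / 2 - 1) * Real.exp (-(ρ * s))) := by
    intro s hs
    rw [mul_heatWeight hs, mul_assoc]
  rw [setIntegral_congr_fun measurableSet_Ioi h1, integral_const_mul,
    Real.integral_rpow_mul_exp_neg_mul_Ioi hn' hρ, sphereArea_eq hn, one_div,
    Real.inv_rpow hρ.le, Real.rpow_neg Real.pi_pos.le, Real.rpow_neg hρ.le]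
  field_simp
  norm_num

/-- Integrability follows from the value of the integral: it is not `0`, the value that a divergent
integral has by convention. -/
theorem integrableOn_mul_heatWeight_mul_exp (hn : 0 < n) {ρ : ℝ} (hρ : 0 < ρ) :
    IntegrableOn (fun s => s * heatWeight n s * Real.exp (-(ρ * s))) (Set.Ioi 0) := by
  by_contra h
  have h1 := integral_mul_heatWeight_mul_exp hn hρ
  rw [integral_undef h] at h1
  have := sphereArea_pos hn
  have h2 : 0 < ρ ^ (-((n : ℝ) / 2)) / (2 * sphereArea n) := by positivity
  exact h2.ne h1

/-- The integrand of the Laplace representation of `-S_n`, as a function of `ρ = |x|²`. The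
subtraction for `s ≤ 1` makes the integral converge when `n = 2`. -/
noncomputable def newtonKer (n : ℕ) (ρ s : ℝ) : ℝ :=
  heatWeight n s * (Real.exp (-(ρ * s)) - if s ≤ 1 then 1 else 0)

theorem measurable_newtonKer (ρ : ℝ) : Measurable (newtonKer n ρ) := by
  refine measurable_heatWeight.mul (Measurable.sub (by fun_prop) ?_)
  exact Measurable.ite measurableSet_Iic measurable_const measurable_const

theorem abs_newtonKer_le {ρ s : ℝ} (hρ : 0 < ρ) (hs : 0 < s) :
    |newtonKer n ρ s| ≤ (ρ * Real.exp ρ + 1) * (s * heatWeight n s * Real.exp (-(ρ * s))) := by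
  have hw := (heatWeight_pos (n := n) hs).le
  rw [newtonKer, abs_mul, abs_of_nonneg hw]
  have hE := Real.exp_pos (-(ρ * s))
  have key : |Real.exp (-(ρ * s)) - if s ≤ 1 then 1 else 0|
      ≤ (ρ * Real.exp ρ + 1) * (s * Real.exp (-(ρ * s))) := by
    have h0 : 0 ≤ s * Real.exp (-(ρ * s)) := by positivity
    split_ifs with h
    · have h1 : Real.exp (-(ρ * s)) ≤ 1 := Real.exp_le_one_iff.2 (by nlinarith [mul_pos hρ hs])
      have h2 := Real.one_sub_le_exp_neg (ρ * s)
      have h3 : 1 ≤ Real.exp ρ * Real.exp (-(ρ * s)) := by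
        rw [← Real.exp_add]
        exact Real.one_le_exp (by nlinarith)
      rw [abs_of_nonpos (by linarith)]
      calc -(Real.exp (-(ρ * s)) - 1) ≤ ρ * s * 1 := by linarith
        _ ≤ ρ * s * (Real.exp ρ * Real.exp (-(ρ * s))) := by gcongr
        _ ≤ _ := by nlinarith
    · push Not at h
      rw [sub_zero, Real.abs_exp]
      have h4 : 0 ≤ ρ * Real.exp ρ := by positivity
      nlinarith [mul_nonneg h4 h0]
  calc _ ≤ heatWeight n s * ((ρ * Real.exp ρ + 1) * (s * Real.exp (-(ρ * s)))) := by gcongr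
    _ = _ := by ring

theorem integrableOn_newtonKer (hn : 0 < n) {ρ : ℝ} (hρ : 0 < ρ) :
    IntegrableOn (newtonKer n ρ) (Set.Ioi 0) := by
  refine ((integrableOn_mul_heatWeight_mul_exp hn hρ).const_mul (ρ * Real.exp ρ + 1)).mono'
    (measurable_newtonKer ρ).aestronglyMeasurable ?_
  filter_upwards [ae_restrict_mem measurableSet_Ioi] with s hs
  exact abs_newtonKer_le hρ hs

theorem hasDerivAt_integral_newtonKer (hn : 0 < n) {ρ : ℝ} (hρ : 0 < ρ) :
    HasDerivAt (fun ρ => ∫ s in Set.Ioi 0, newtonKer n ρ s)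
      (-(ρ ^ (-((n : ℝ) / 2)) / (2 * sphereArea n))) ρ := by
  have hm : Measurable fun s => s * heatWeight n s := measurable_id.mul measurable_heatWeight
  have h := (hasDerivAt_integral_of_dominated_loc_of_deriv_le
    (μ := volume.restrict (Set.Ioi (0 : ℝ))) (F := fun ρ s => newtonKer n ρ s) (x₀ := ρ)
    (s := Set.Ioi (ρ / 2)) (F' := fun ρ s => -(s * heatWeight n s * Real.exp (-(ρ * s))))
    (bound := fun s => s * heatWeight n s * Real.exp (-(ρ / 2 * s)))
    (Ioi_mem_nhds (by linarith))
    (Filter.Eventually.of_forall fun ρ => (measurable_newtonKer ρ).aestronglyMeasurable)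
    (integrableOn_newtonKer hn hρ)
    ((hm.mul (by fun_prop)).neg.aestronglyMeasurable) ?_
    (integrableOn_mul_heatWeight_mul_exp hn (by positivity)) ?_).2
  · rwa [integral_neg, integral_mul_heatWeight_mul_exp hn hρ] at h
  · filter_upwards [ae_restrict_mem measurableSet_Ioi] with s hs r hr
    have hs0 : 0 < s := hs
    have hw := (heatWeight_pos (n := n) hs).le
    rw [norm_neg, Real.norm_of_nonneg (by positivity)]
    have : ρ / 2 * s ≤ r * s := mul_le_mul_of_nonneg_right (le_of_lt hr) hs0.le
    gcongr
  · filter_upwards with s r hr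
    have h1 : HasDerivAt (fun r : ℝ => Real.exp (-(r * s))) (Real.exp (-(r * s)) * (-s)) r := by
      have := ((hasDerivAt_id r).mul_const s).neg.exp
      simpa using this
    exact ((h1.sub_const _).const_mul (heatWeight n s)).congr_deriv (by ring)

/-- `S_n` as a function of `ρ = |x|²`. -/
noncomputable def laplaceFundSq (n : ℕ) (ρ : ℝ) : ℝ :=
  if n = 2 then Real.log ρ / (2 * sphereArea n)
  else ρ ^ (1 - (n : ℝ) / 2) / ((2 - n) * sphereArea n)

theorem laplaceFund_eq (x : EuclideanSpace ℝ (Fin n)) (hx : x ≠ 0) :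
    laplaceFund x = laplaceFundSq n (‖x‖ ^ 2) := by
  have hx' : 0 < ‖x‖ := norm_pos_iff.2 hx
  unfold laplaceFund laplaceFundSq
  split_ifs with h
  · rw [Real.log_pow, mul_comm (2 : ℝ) (sphereArea n), Nat.cast_ofNat,
      mul_comm (2 : ℝ) (Real.log _), mul_div_mul_right _ _ two_ne_zero]
    ring
  · have : (‖x‖ ^ 2) ^ (1 - (n : ℝ) / 2) = ‖x‖ ^ (2 - (n : ℤ)) := by
      rw [← Real.rpow_natCast, ← Real.rpow_mul hx'.le, ← Real.rpow_intCast]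
      congr 1
      push_cast
      ring
    rw [this]
    ring

theorem hasDerivAt_laplaceFundSq (hn : 0 < n) {ρ : ℝ} (hρ : 0 < ρ) :
    HasDerivAt (laplaceFundSq n) (ρ ^ (-((n : ℝ) / 2)) / (2 * sphereArea n)) ρ := by
  have hs := (sphereArea_pos hn).ne'
  by_cases h : n = 2
  · have e : laplaceFundSq n = fun ρ => Real.log ρ / (2 * sphereArea n) := by
      funext ρ; rw [laplaceFundSq, if_pos h]
    rw [e]
    refine ((Real.hasDerivAt_log hρ.ne').div_const _).congr_deriv ?_
    rw [h]
    norm_num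
    rw [Real.rpow_neg_one]
  · have e : laplaceFundSq n = fun ρ => ρ ^ (1 - (n : ℝ) / 2) / ((2 - n) * sphereArea n) := by
      funext ρ; rw [laplaceFundSq, if_neg h]
    rw [e]
    refine ((Real.hasDerivAt_rpow_const (p := 1 - (n : ℝ) / 2) (Or.inl hρ.ne')).div_const
      _).congr_deriv ?_
    have h2 : (2 - (n : ℝ)) ≠ 0 := by
      intro h3
      exact h (by exact_mod_cast (sub_eq_zero.1 h3).symm)
    rw [show 1 - (n : ℝ) / 2 - 1 = -((n : ℝ) / 2) by ring]
    field_simp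

/-- The two sides have the same derivative in `ρ = |x|²`. -/
theorem exists_integral_newtonKer_eq (hn : 0 < n) : ∃ C : ℝ, ∀ ρ, 0 < ρ →
    laplaceFundSq n ρ = -(∫ s in Set.Ioi 0, newtonKer n ρ s) + C := by
  have hd : ∀ ρ ∈ Set.Ioi (0 : ℝ), HasDerivAt
      (fun ρ => laplaceFundSq n ρ + ∫ s in Set.Ioi 0, newtonKer n ρ s) 0 ρ := fun ρ hρ =>
    ((hasDerivAt_laplaceFundSq hn hρ).add (hasDerivAt_integral_newtonKer hn hρ)).congr_deriv
      (by ring)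
  obtain ⟨C, hC⟩ := isOpen_Ioi.exists_is_const_of_deriv_eq_zero isPreconnected_Ioi
    (fun ρ hρ => (hd ρ hρ).differentiableAt.differentiableWithinAt)
    (fun ρ hρ => (hd ρ hρ).deriv)
  exact ⟨C, fun ρ hρ => by rw [← hC ρ hρ]; ring⟩

/-- The long range part of `Γ_{n,ω}`, renormalized at the origin. It is smooth. -/
noncomputable def regPart (ω : ℝ) (j k : Fin n) (x : EuclideanSpace ℝ (Fin n)) : ℝ :=
  ∫ s in Set.Ioc (0 : ℝ) 1, (heatKer ω j k s x - heatKer ω j k s 0)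

theorem heatKer_zero_right (ω : ℝ) (j k : Fin n) (s : ℝ) :
    heatKer ω j k s 0 = -((ω + 2) / (2 * (ω + 1)) * (if j = k then 1 else 0)) * heatWeight n s := by
  simp [heatKer]

/-- The splitting of `Γ_{n,ω}` into a short range part and a smooth part. -/
theorem exists_elasticFund_eq (hn : 0 < n) (ω : ℝ) (hω : ω + 1 ≠ 0) : ∃ C : ℝ, ∀ (j k : Fin n)
    (x : EuclideanSpace ℝ (Fin n)), x ≠ 0 →
    elasticFund ω x j k
      = shortPart ω j k 1 x + regPart ω j k x + (if j = k then C else 0) := by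
  obtain ⟨C, hC⟩ := exists_integral_newtonKer_eq hn
  refine ⟨(ω + 2) / (2 * (ω + 1)) * C, fun j k x hx => ?_⟩
  have hx' : 0 < ‖x‖ := norm_pos_iff.2 hx
  have hρ : 0 < ‖x‖ ^ 2 := by positivity
  set c : ℝ := (ω + 2) / (2 * (ω + 1)) * (if j = k then 1 else 0) with hc
  set d : ℝ := ω / (ω + 1) * (x j * x k) with hd
  set f : ℝ → ℝ := fun s => -c * newtonKer n (‖x‖ ^ 2) s
    + -d * (s * heatWeight n s * Real.exp (-(‖x‖ ^ 2 * s))) with hf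
  have hi1 := (integrableOn_newtonKer hn hρ).const_mul (-c)
  have hi2 := (integrableOn_mul_heatWeight_mul_exp hn hρ).const_mul (-d)
  have hfi : IntegrableOn f (Set.Ioi 0) := hi1.add hi2
  have hsplit : ∫ s in Set.Ioi 0, f s
      = (∫ s in Set.Ioc 0 1, f s) + ∫ s in Set.Ioi 1, f s := by
    rw [← Set.Ioc_union_Ioi_eq_Ioi zero_le_one]
    exact setIntegral_union (Set.Ioc_disjoint_Ioi le_rfl) measurableSet_Ioi
      (hfi.mono_set Set.Ioc_subset_Ioi_self) (hfi.mono_set (Set.Ioi_subset_Ioi zero_le_one))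
  have e1 : ∫ s in Set.Ioc 0 1, f s = regPart ω j k x := by
    refine setIntegral_congr_fun measurableSet_Ioc fun s hs => ?_
    simp only [hf, newtonKer, if_pos hs.2]
    rw [heatKer_zero_right, heatKer, ← hc, show -s * ‖x‖ ^ 2 = -(‖x‖ ^ 2 * s) by ring]
    ring
  have e2 : ∫ s in Set.Ioi 1, f s = shortPart ω j k 1 x := by
    refine setIntegral_congr_fun measurableSet_Ioi fun s hs => ?_
    simp only [hf, newtonKer, if_neg (not_le.2 (show 1 < s from hs))]
    rw [heatKer, ← hc, show -s * ‖x‖ ^ 2 = -(‖x‖ ^ 2 * s) by ring]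
    ring
  have e3 : ∫ s in Set.Ioi 0, f s = -c * (∫ s in Set.Ioi 0, newtonKer n (‖x‖ ^ 2) s)
      + -d * ((‖x‖ ^ 2) ^ (-((n : ℝ) / 2)) / (2 * sphereArea n)) := by
    rw [hf, integral_add hi1 hi2, integral_const_mul, integral_const_mul,
      integral_mul_heatWeight_mul_exp hn hρ]
  have e4 : (‖x‖ ^ 2) ^ (-((n : ℝ) / 2)) = (‖x‖ ^ n)⁻¹ := by
    rw [← Real.rpow_natCast, ← Real.rpow_mul hx'.le, ← Real.rpow_natCast ‖x‖ n,
      ← Real.rpow_neg hx'.le]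
    congr 1
    push_cast
    ring
  have e5 : (if j = k then (ω + 2) / (2 * (ω + 1)) * C else 0) = c * C := by
    rw [hc]; split_ifs <;> ring
  rw [e5, add_comm (shortPart _ _ _ _ _), ← e1, ← e2, ← hsplit, e3, e4]
  simp only [elasticFund, Matrix.of_apply]
  rw [laplaceFund_eq x hx, hC _ hρ, ← hc, hd]
  have hs := (sphereArea_pos hn).ne'
  field_simp
  ring

/-- Subtracting the value at the origin gains a factor `s`, which makes the kernel integrable near
`s = 0` also when `n = 2`. -/
theorem abs_heatKer_sub_le (ω : ℝ) (j k : Fin n) {s : ℝ} (hs : 0 < s)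
    (x : EuclideanSpace ℝ (Fin n)) :
    |heatKer ω j k s x - heatKer ω j k s 0| ≤ kerConst ω * ‖x‖ ^ 2 * (s * heatWeight n s) := by
  have hw := (heatWeight_pos (n := n) hs).le
  set E := Real.exp (-s * ‖x‖ ^ 2) with hE
  have hE0 : 0 < E := Real.exp_pos _
  have hE1 : E ≤ 1 := Real.exp_le_one_iff.2 (by nlinarith [mul_nonneg hs.le (sq_nonneg ‖x‖)])
  have hE2 : 1 - s * ‖x‖ ^ 2 ≤ E := by
    have := Real.one_sub_le_exp_neg (s * ‖x‖ ^ 2)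
    rwa [← neg_mul] at this
  rw [heatKer_zero_right, heatKer, ← hE]
  have e : ∀ c d : ℝ, -(c + d) * (E * heatWeight n s) - -c * heatWeight n s
      = (c * (1 - E) - d * E) * heatWeight n s := by intros; ring
  rw [e, abs_mul, abs_of_nonneg hw]
  have h1 : |(ω + 2) / (2 * (ω + 1)) * (if j = k then 1 else 0) * (1 - E)|
      ≤ |(ω + 2) / (2 * (ω + 1))| * (s * ‖x‖ ^ 2) := by
    rw [abs_mul, abs_mul, abs_of_nonneg (by linarith : 0 ≤ 1 - E)]
    have : |if j = k then (1 : ℝ) else 0| ≤ 1 := by split_ifs <;> simp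
    calc _ ≤ |(ω + 2) / (2 * (ω + 1))| * 1 * (s * ‖x‖ ^ 2) := by gcongr; linarith
      _ = _ := by ring
  have h2 : |ω / (ω + 1) * (s * (x j * x k)) * E| ≤ |ω / (ω + 1)| * (s * ‖x‖ ^ 2) := by
    rw [abs_mul, abs_mul, abs_mul s, abs_of_pos hs, abs_of_pos hE0]
    calc _ ≤ |ω / (ω + 1)| * (s * ‖x‖ ^ 2) * 1 := by gcongr; exact abs_apply_mul_apply_le x j k
      _ = _ := by ring
  calc _ ≤ (|(ω + 2) / (2 * (ω + 1))| * (s * ‖x‖ ^ 2) + |ω / (ω + 1)| * (s * ‖x‖ ^ 2))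
        * heatWeight n s := by
        gcongr
        exact (abs_sub _ _).trans (add_le_add h1 h2)
    _ = _ := by rw [kerConst]; ring

theorem integrableOn_mul_heatWeight (hn : 0 < n) :
    IntegrableOn (fun s => s * heatWeight n s) (Set.Ioc 0 1) := by
  have h := ((integrableOn_mul_heatWeight_mul_exp hn zero_lt_one).mono_set
    (Set.Ioc_subset_Ioi_self (a := (1 : ℝ)) (b := (0 : ℝ)))).const_mul (Real.exp 1)
  refine h.mono' (measurable_id.mul measurable_heatWeight).aestronglyMeasurable ?_
  filter_upwards [ae_restrict_mem measurableSet_Ioc] with s hs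
  have hs0 : 0 < s := hs.1
  have hw := (heatWeight_pos (n := n) hs0).le
  rw [Real.norm_of_nonneg (by positivity)]
  have : 1 ≤ Real.exp 1 * Real.exp (-(1 * s)) := by
    rw [← Real.exp_add]; exact Real.one_le_exp (by linarith [hs.2])
  nlinarith [mul_nonneg hs0.le hw]

end FundamentalSolution

/-! ### The equation satisfied by the short range parts -/

section EquationFund

open scoped FourierTransform Topology

variable {n : ℕ}

theorem invSymbol_neg (ω : ℝ) (j k : Fin n) (ξ : EuclideanSpace ℝ (Fin n)) :
    invSymbol ω j k (-ξ) = invSymbol ω j k ξ := by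
  simp [invSymbol]

theorem longSymbol_neg (ω : ℝ) (j k : Fin n) (a : ℝ) (ξ : EuclideanSpace ℝ (Fin n)) :
    longSymbol ω j k a (-ξ) = longSymbol ω j k a ξ := by
  simp [longSymbol, invSymbol_neg]

/-- The second derivative `∂_l ∂_m f` of a Schwartz function. -/
noncomputable def secondDeriv (l m : Fin n) (f : 𝓢(EuclideanSpace ℝ (Fin n), ℂ)) :
    𝓢(EuclideanSpace ℝ (Fin n), ℂ) :=
  ∂_{EuclideanSpace.single l (1 : ℝ)} (∂_{EuclideanSpace.single m (1 : ℝ)} f)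

theorem fourierInv_secondDeriv (f : 𝓢(EuclideanSpace ℝ (Fin n), ℂ)) (l m : Fin n)
    (ξ : EuclideanSpace ℝ (Fin n)) :
    𝓕⁻ (secondDeriv l m f) ξ = ((-(4 * Real.pi ^ 2 * (ξ l * ξ m)) : ℝ) : ℂ) * 𝓕⁻ f ξ :=
  fourierInv_lineDeriv_single_single f l m ξ

theorem integral_secondDeriv (f : 𝓢(EuclideanSpace ℝ (Fin n), ℂ)) (l m : Fin n) :
    ∫ x, secondDeriv l m f x = 0 := by
  rw [← fourierInv_zero, fourierInv_secondDeriv]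
  simp

theorem integrable_expFun_mul_mul_schwartz {A : EuclideanSpace ℝ (Fin n) → ℂ} (hA : Integrable A)
    (g : 𝓢(EuclideanSpace ℝ (Fin n), ℂ)) :
    Integrable (fun p : EuclideanSpace ℝ (Fin n) × EuclideanSpace ℝ (Fin n) =>
      expFun (-p.2) p.1 * (A p.1 * g p.2)) (volume.prod volume) := by
  refine (hA.mul_prod g.integrable).bdd_mul (c := 1) ?_
    (Filter.Eventually.of_forall fun p => (norm_expFun _ _).le)
  have : Continuous fun p : EuclideanSpace ℝ (Fin n) × EuclideanSpace ℝ (Fin n) =>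
      expFun (-p.2) p.1 := by unfold expFun; fun_prop
  exact this.aestronglyMeasurable

theorem integrable_fourier_mul_schwartz {A : EuclideanSpace ℝ (Fin n) → ℂ} (hA : Integrable A)
    (g : 𝓢(EuclideanSpace ℝ (Fin n), ℂ)) :
    Integrable fun ξ => (∫ x, expFun (-ξ) x * A x) * g ξ := by
  refine (integrable_expFun_mul_mul_schwartz hA g).integral_prod_right.congr
    (Filter.Eventually.of_forall fun ξ => ?_)
  simp only [← mul_assoc]
  exact integral_mul_const _ _

/-- Parseval's identity for an integrable function and a Schwartz function. -/
theorem integral_mul_schwartz_eq {A : EuclideanSpace ℝ (Fin n) → ℂ} (hA : Integrable A)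
    (f : 𝓢(EuclideanSpace ℝ (Fin n), ℂ)) :
    ∫ x, A x * f x = ∫ ξ, (∫ x, expFun (-ξ) x * A x) * 𝓕⁻ f ξ := by
  have h1 : ∀ x, A x * f x = ∫ ξ, expFun (-ξ) x * (A x * 𝓕⁻ f ξ) := by
    intro x
    conv_lhs => rw [eq_integral_expFun_fourierInv f x, ← integral_const_mul]
    refine integral_congr_ae (Filter.Eventually.of_forall fun ξ => ?_)
    ring
  simp only [h1]
  generalize 𝓕⁻ f = g
  rw [integral_integral_swap (integrable_expFun_mul_mul_schwartz hA g)]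
  refine integral_congr_ae (Filter.Eventually.of_forall fun ξ => ?_)
  simp only [← mul_assoc]
  exact integral_mul_const _ _

/-- The action of the distribution `L[ω] u` on a Schwartz function, for a matrix `u` of functions:
all the derivatives are on the Schwartz function. -/
noncomputable def lamePairing (ω : ℝ) (u : Fin n → Fin n → EuclideanSpace ℝ (Fin n) → ℝ)
    (j k : Fin n) (f : 𝓢(EuclideanSpace ℝ (Fin n), ℂ)) : ℂ :=
  (∑ l, ∫ x, (u j k x : ℂ) * secondDeriv l l f x)
    + ω * ∑ l, ∫ x, (u l k x : ℂ) * secondDeriv l j f x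

/-- The symbol of `L[ω]` at the frequency `ξ`, applied to the columns of the matrix `c`. -/
noncomputable def lameSymbol (ω : ℝ) (c : Fin n → Fin n → ℝ) (j k : Fin n)
    (ξ : EuclideanSpace ℝ (Fin n)) : ℝ :=
  (∑ l, c j k * -(4 * Real.pi ^ 2 * (ξ l * ξ l)))
    + ω * ∑ l, c l k * -(4 * Real.pi ^ 2 * (ξ l * ξ j))

theorem sum_apply_mul_self (ξ : EuclideanSpace ℝ (Fin n)) : ∑ l, ξ l * ξ l = ‖ξ‖ ^ 2 := by
  rw [EuclideanSpace.real_norm_sq_eq]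
  exact Finset.sum_congr rfl fun l _ => (sq _).symm

theorem lameSymbol_invSymbol {ω : ℝ} (hω : ω + 1 ≠ 0) (j k : Fin n)
    {ξ : EuclideanSpace ℝ (Fin n)} (hξ : ξ ≠ 0) :
    lameSymbol ω (fun j k => invSymbol ω j k ξ) j k ξ = if j = k then 1 else 0 := by
  have hn : ‖ξ‖ ≠ 0 := norm_ne_zero_iff.2 hξ
  have hpi := Real.pi_pos.ne'
  have h1 : ∑ l, invSymbol ω j k ξ * -(4 * Real.pi ^ 2 * (ξ l * ξ l))
      = invSymbol ω j k ξ * -(4 * Real.pi ^ 2 * ‖ξ‖ ^ 2) := by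
    rw [← Finset.mul_sum, ← sum_apply_mul_self ξ, Finset.sum_neg_distrib, ← Finset.mul_sum]
  have h2 : ∀ l, invSymbol ω l k ξ * -(4 * Real.pi ^ 2 * (ξ l * ξ j))
      = (if l = k then 1 else 0) * (1 / ‖ξ‖ ^ 2 * (ξ l * ξ j))
        + -(ω / (ω + 1) * (ξ j * ξ k) / ‖ξ‖ ^ 4) * (ξ l * ξ l) := by
    intro l
    rw [invSymbol]
    generalize (if l = k then (1 : ℝ) else 0) = D
    field_simp
    ring
  rw [lameSymbol, h1]
  simp only [h2]
  rw [Finset.sum_add_distrib, ← Finset.mul_sum, sum_apply_mul_self]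
  simp only [ite_mul, one_mul, zero_mul, Finset.sum_ite_eq', Finset.mem_univ, if_true]
  rw [invSymbol]
  generalize (if j = k then (1 : ℝ) else 0) = D
  field_simp
  ring

theorem lameSymbol_longSymbol {ω : ℝ} (hω : ω + 1 ≠ 0) (j k : Fin n) {a : ℝ} (ha : 0 < a)
    {ξ : EuclideanSpace ℝ (Fin n)} (hξ : ξ ≠ 0) :
    lameSymbol ω (fun j k => longSymbol ω j k a ξ) j k ξ
      = Real.exp (-(Real.pi ^ 2 * ‖ξ‖ ^ 2) / a) *
        ((if j = k then 1 else 0) - ω * (Real.pi ^ 2 * (ξ j * ξ k) / a)) := by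
  have hn : ‖ξ‖ ≠ 0 := norm_ne_zero_iff.2 hξ
  have hd : lameSymbol ω (fun j k => ξ j * ξ k) j k ξ
      = -(4 * Real.pi ^ 2 * (1 + ω) * ‖ξ‖ ^ 2 * (ξ j * ξ k)) := by
    rw [lameSymbol, ← Finset.mul_sum, Finset.sum_neg_distrib, ← Finset.mul_sum, sum_apply_mul_self]
    have : ∀ l, ξ l * ξ k * -(4 * Real.pi ^ 2 * (ξ l * ξ j))
        = -(4 * Real.pi ^ 2 * (ξ j * ξ k)) * (ξ l * ξ l) := by intro l; ring
    simp only [this]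
    rw [← Finset.mul_sum, sum_apply_mul_self]
    ring
  have hl : lameSymbol ω (fun j k => longSymbol ω j k a ξ) j k ξ
      = Real.exp (-(Real.pi ^ 2 * ‖ξ‖ ^ 2) / a) *
        (lameSymbol ω (fun j k => invSymbol ω j k ξ) j k ξ
          + ω / (ω + 1) / (4 * ‖ξ‖ ^ 2 * a) * lameSymbol ω (fun j k => ξ j * ξ k) j k ξ) := by
    simp only [lameSymbol, longSymbol, Finset.mul_sum, ← Finset.sum_add_distrib]
    exact Finset.sum_congr rfl fun l _ => by ring
  rw [hl, lameSymbol_invSymbol hω j k hξ, hd]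
  field_simp
  ring

theorem integrable_shortPart_mul (ω : ℝ) (j k : Fin n) {a : ℝ} (ha : 0 < a)
    (f : 𝓢(EuclideanSpace ℝ (Fin n), ℂ)) :
    Integrable fun x => (shortPart ω j k a x : ℂ) * f x := by
  obtain ⟨C, hC, h⟩ := schwartz_decay f 0
  refine ((integrable_shortPart ω j k ha).ofReal (𝕜 := ℂ)).mul_bdd (c := C)
    f.continuous.aestronglyMeasurable (Filter.Eventually.of_forall fun x => ?_)
  simpa using h x

theorem integral_shortPart_mul_secondDeriv (ω : ℝ) (j k l m : Fin n) {a : ℝ} (ha : 0 < a)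
    (f : 𝓢(EuclideanSpace ℝ (Fin n), ℂ)) :
    Integrable (fun ξ => (∫ x, expFun (-ξ) x * (shortPart ω j k a x : ℂ)) *
        (((-(4 * Real.pi ^ 2 * (ξ l * ξ m)) : ℝ) : ℂ) * 𝓕⁻ f ξ)) ∧
    ∫ x, (shortPart ω j k a x : ℂ) * secondDeriv l m f x
      = ∫ ξ, (∫ x, expFun (-ξ) x * (shortPart ω j k a x : ℂ)) *
        (((-(4 * Real.pi ^ 2 * (ξ l * ξ m)) : ℝ) : ℂ) * 𝓕⁻ f ξ) := by
  have hA := (integrable_shortPart (n := n) ω j k ha).ofReal (𝕜 := ℂ)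
  simp only [← fourierInv_secondDeriv]
  exact ⟨integrable_fourier_mul_schwartz hA _, integral_mul_schwartz_eq hA _⟩

/-- The short range parts solve the equation up to an error that is Gaussian on the frequency
side. -/
theorem lamePairing_shortPart {ω : ℝ} (hω : ω + 1 ≠ 0) (hn : 0 < n) (j k : Fin n) {a : ℝ}
    (ha : 0 < a) (f : 𝓢(EuclideanSpace ℝ (Fin n), ℂ)) :
    lamePairing ω (fun j k => shortPart ω j k a) j k f
      = ∫ ξ : EuclideanSpace ℝ (Fin n), (((if j = k then 1 else 0)
          - Real.exp (-(Real.pi ^ 2 * ‖ξ‖ ^ 2) / a) *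
            ((if j = k then 1 else 0) - ω * (Real.pi ^ 2 * (ξ j * ξ k) / a)) : ℝ) : ℂ)
        * 𝓕⁻ f ξ := by
  have : Nonempty (Fin n) := ⟨⟨0, hn⟩⟩
  rw [lamePairing]
  simp only [fun j k l m => (integral_shortPart_mul_secondDeriv ω j k l m ha f).2]
  rw [← integral_finsetSum _ fun l _ => (integral_shortPart_mul_secondDeriv ω j k l l ha f).1,
    ← integral_finsetSum _ fun l _ => (integral_shortPart_mul_secondDeriv ω l k l j ha f).1,
    ← integral_const_mul, ← integral_add
      (integrable_finsetSum _ fun l _ => (integral_shortPart_mul_secondDeriv ω j k l l ha f).1)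
      ((integrable_finsetSum _ fun l _ =>
        (integral_shortPart_mul_secondDeriv ω l k l j ha f).1).const_mul _)]
  refine integral_congr_ae ?_
  filter_upwards [Measure.ae_ne volume (0 : EuclideanSpace ℝ (Fin n))] with ξ hξ
  have hs : ∀ j k, ∫ x, expFun (-ξ) x * (shortPart ω j k a x : ℂ)
      = ((invSymbol ω j k ξ - longSymbol ω j k a ξ : ℝ) : ℂ) := by
    intro j k
    rw [integral_expFun_mul_shortPart hω j k ha (neg_ne_zero.2 hξ), invSymbol_neg, longSymbol_neg]
  simp only [hs]
  have hl : lameSymbol ω (fun j k => invSymbol ω j k ξ - longSymbol ω j k a ξ) j k ξ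
      = lameSymbol ω (fun j k => invSymbol ω j k ξ) j k ξ
        - lameSymbol ω (fun j k => longSymbol ω j k a ξ) j k ξ := by
    simp only [lameSymbol, sub_mul, Finset.sum_sub_distrib, mul_sub]
    ring
  rw [lameSymbol_invSymbol hω j k hξ, lameSymbol_longSymbol hω j k ha hξ] at hl
  rw [← hl, lameSymbol]
  push_cast
  simp only [add_mul, Finset.sum_mul, Finset.mul_sum, mul_assoc]

/-- As the cut-off `a` tends to `0`, the short range parts converge to a fundamental solution. -/
theorem tendsto_lamePairing_shortPart {ω : ℝ} (hω : ω + 1 ≠ 0) (hn : 0 < n) (j k : Fin n)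
    (f : 𝓢(EuclideanSpace ℝ (Fin n), ℂ)) :
    Filter.Tendsto (fun a => lamePairing ω (fun j k => shortPart ω j k a) j k f) (𝓝[>] 0)
      (𝓝 (if j = k then f 0 else 0)) := by
  have : Nonempty (Fin n) := ⟨⟨0, hn⟩⟩
  have hf0 : (if j = k then f 0 else 0)
      = ∫ ξ, (((if j = k then 1 else 0 : ℝ) : ℂ)) * 𝓕⁻ f ξ := by
    rw [integral_const_mul, integral_fourierInv]
    split_ifs <;> simp
  have hfi : Integrable fun ξ => 𝓕⁻ f ξ := (𝓕⁻ f).integrable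
  rw [hf0]
  refine Filter.Tendsto.congr' (f₁ := fun a => ∫ ξ : EuclideanSpace ℝ (Fin n),
        (((if j = k then 1 else 0)
          - Real.exp (-(Real.pi ^ 2 * ‖ξ‖ ^ 2) / a) *
            ((if j = k then 1 else 0) - ω * (Real.pi ^ 2 * (ξ j * ξ k) / a)) : ℝ) : ℂ)
        * 𝓕⁻ f ξ) ?_ ?_
  · filter_upwards [self_mem_nhdsWithin] with a ha
    exact (lamePairing_shortPart hω hn j k ha f).symm
  refine tendsto_integral_filter_of_dominated_convergence
    (fun ξ => (2 + |ω|) * ‖𝓕⁻ f ξ‖) ?_ ?_ (hfi.norm.const_mul _) ?_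
  · filter_upwards with a
    refine AEStronglyMeasurable.mul ?_ hfi.aestronglyMeasurable
    refine (Complex.continuous_ofReal.comp ?_).aestronglyMeasurable
    fun_prop
  · filter_upwards [self_mem_nhdsWithin] with a ha
    have ha0 : (0 : ℝ) < a := ha
    filter_upwards with ξ
    rw [norm_mul, Complex.norm_real, Real.norm_eq_abs]
    refine mul_le_mul_of_nonneg_right ?_ (norm_nonneg _)
    set u := Real.pi ^ 2 * ‖ξ‖ ^ 2 / a with hu
    have hu0 : 0 ≤ u := by positivity
    rw [neg_div, ← hu]
    have hD : |if j = k then (1 : ℝ) else 0| ≤ 1 := by split_ifs <;> simp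
    have hX : |Real.pi ^ 2 * (ξ j * ξ k) / a| ≤ u := by
      rw [abs_div, abs_mul, abs_of_pos ha0, abs_of_nonneg (sq_nonneg Real.pi), hu]
      gcongr
      exact abs_apply_mul_apply_le ξ j k
    have he1 : Real.exp (-u) ≤ 1 := Real.exp_le_one_iff.2 (by linarith)
    have he2 : u * Real.exp (-u) ≤ 1 := (mul_exp_neg_le_exp_neg_half u hu0).trans
      (Real.exp_le_one_iff.2 (by linarith))
    have he0 := Real.exp_pos (-u)
    generalize (if j = k then (1 : ℝ) else 0) = D at *
    calc |D - Real.exp (-u) * (D - ω * (Real.pi ^ 2 * (ξ j * ξ k) / a))|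
        ≤ |D| + Real.exp (-u) * (|D| + |ω| * |Real.pi ^ 2 * (ξ j * ξ k) / a|) := by
          refine (abs_sub _ _).trans ?_
          rw [abs_mul, Real.abs_exp]
          gcongr
          refine (abs_sub _ _).trans ?_
          rw [abs_mul]
      _ ≤ 1 + Real.exp (-u) * (1 + |ω| * u) := by gcongr
      _ = 1 + Real.exp (-u) + |ω| * (u * Real.exp (-u)) := by ring
      _ ≤ 1 + 1 + |ω| * 1 := by gcongr
      _ = _ := by ring
  · filter_upwards [Measure.ae_ne volume (0 : EuclideanSpace ℝ (Fin n))] with ξ hξ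
    have hn : 0 < ‖ξ‖ := norm_pos_iff.2 hξ
    refine Filter.Tendsto.mul_const _ ?_
    refine (Complex.continuous_ofReal.tendsto _).comp ?_
    generalize (if j = k then (1 : ℝ) else 0) = D
    have hM : 0 < Real.pi ^ 2 * ‖ξ‖ ^ 2 := by positivity
    have ht : Filter.Tendsto (fun a : ℝ => Real.pi ^ 2 * ‖ξ‖ ^ 2 * a⁻¹) (𝓝[>] 0) Filter.atTop :=
      tendsto_inv_nhdsGT_zero.const_mul_atTop hM
    have h0 : Filter.Tendsto (fun u : ℝ => Real.exp (-u)) Filter.atTop (𝓝 0) :=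
      Real.tendsto_exp_neg_atTop_nhds_zero
    have h1 : Filter.Tendsto (fun u : ℝ => u * Real.exp (-u)) Filter.atTop (𝓝 0) := by
      simpa using Real.tendsto_pow_mul_exp_neg_atTop_nhds_zero 1
    have h2 := (((h0.comp ht).mul_const D).sub ((h1.comp ht).mul_const
      (ω * (ξ j * ξ k) / ‖ξ‖ ^ 2))).const_sub D
    simp only [zero_mul, sub_zero] at h2
    refine h2.congr fun a => ?_
    simp only [Function.comp_apply, div_eq_mul_inv]
    field_simp

end EquationFund

/-! ### The equation satisfied by the fundamental solution -/

section EquationElasticFund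

open scoped Topology

variable {n : ℕ}

theorem measurable_heatKer_sub (ω : ℝ) (j k : Fin n) :
    Measurable fun p : EuclideanSpace ℝ (Fin n) × ℝ =>
      heatKer ω j k p.2 p.1 - heatKer ω j k p.2 0 :=
  (measurable_heatKer ω j k).sub
    ((measurable_heatKer ω j k).comp (measurable_const.prodMk measurable_snd))

theorem integrableOn_heatKer_sub (hn : 0 < n) (ω : ℝ) (j k : Fin n) (x : EuclideanSpace ℝ (Fin n)) :
    IntegrableOn (fun s => heatKer ω j k s x - heatKer ω j k s 0) (Set.Ioc 0 1) := by
  refine ((integrableOn_mul_heatWeight hn).const_mul (kerConst ω * ‖x‖ ^ 2)).mono'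
    ((measurable_heatKer_sub ω j k).comp measurable_prodMk_left).aestronglyMeasurable ?_
  filter_upwards [ae_restrict_mem measurableSet_Ioc] with s hs
  exact abs_heatKer_sub_le ω j k hs.1 x

theorem aestronglyMeasurable_setIntegral_heatKer_sub (ω : ℝ) (j k : Fin n) (S : Set ℝ) :
    AEStronglyMeasurable (fun x => ∫ s in S, (heatKer ω j k s x - heatKer ω j k s 0)) volume :=
  ((measurable_heatKer_sub ω j k).stronglyMeasurable.integral_prod_right').aestronglyMeasurable

theorem abs_setIntegral_heatKer_sub_le (hn : 0 < n) (ω : ℝ) (j k : Fin n) {a : ℝ} (ha : 0 ≤ a)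
    (x : EuclideanSpace ℝ (Fin n)) :
    |∫ s in Set.Ioc a 1, (heatKer ω j k s x - heatKer ω j k s 0)|
      ≤ kerConst ω * (∫ s in Set.Ioc (0 : ℝ) 1, s * heatWeight n s) * ‖x‖ ^ 2 := by
  have hsub : Set.Ioc a 1 ⊆ Set.Ioc (0 : ℝ) 1 := Set.Ioc_subset_Ioc_left ha
  have hi := (integrableOn_heatKer_sub hn ω j k x).norm
  calc _ ≤ ∫ s in Set.Ioc a 1, ‖heatKer ω j k s x - heatKer ω j k s 0‖ :=
        norm_integral_le_integral_norm _
    _ ≤ ∫ s in Set.Ioc 0 1, ‖heatKer ω j k s x - heatKer ω j k s 0‖ :=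
        setIntegral_mono_set hi (Filter.Eventually.of_forall fun _ => norm_nonneg _)
          hsub.eventuallyLE
    _ ≤ ∫ s in Set.Ioc (0 : ℝ) 1, kerConst ω * ‖x‖ ^ 2 * (s * heatWeight n s) :=
        setIntegral_mono_on hi ((integrableOn_mul_heatWeight hn).const_mul _) measurableSet_Ioc
          fun s hs => abs_heatKer_sub_le ω j k hs.1 x
    _ = _ := by rw [integral_const_mul]; ring

theorem norm_setIntegral_heatKer_sub_mul_le (hn : 0 < n) (ω : ℝ) (j k : Fin n) {a : ℝ}
    (ha : 0 ≤ a) (x : EuclideanSpace ℝ (Fin n)) (w : ℂ) :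
    ‖((∫ s in Set.Ioc a 1, (heatKer ω j k s x - heatKer ω j k s 0) : ℝ) : ℂ) * w‖
      ≤ kerConst ω * (∫ s in Set.Ioc (0 : ℝ) 1, s * heatWeight n s) * (‖x‖ ^ 2 * ‖w‖) := by
  rw [norm_mul, Complex.norm_real, Real.norm_eq_abs, ← mul_assoc]
  exact mul_le_mul_of_nonneg_right (abs_setIntegral_heatKer_sub_le hn ω j k ha x) (norm_nonneg _)

theorem integrable_setIntegral_heatKer_sub_mul (hn : 0 < n) (ω : ℝ) (j k : Fin n) {a : ℝ}
    (ha : 0 ≤ a) (f : 𝓢(EuclideanSpace ℝ (Fin n), ℂ)) :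
    Integrable fun x =>
      ((∫ s in Set.Ioc a 1, (heatKer ω j k s x - heatKer ω j k s 0) : ℝ) : ℂ) * f x :=
  ((f.integrable_pow_mul volume 2).const_mul _).mono'
    ((Complex.continuous_ofReal.comp_aestronglyMeasurable
      (aestronglyMeasurable_setIntegral_heatKer_sub ω j k _)).mul
      f.continuous.aestronglyMeasurable)
    (Filter.Eventually.of_forall fun x => norm_setIntegral_heatKer_sub_mul_le hn ω j k ha x _)

/-- The pairing of `Γ_{n,ω}` with a Schwartz function, through the splitting of `Γ_{n,ω}`. -/
theorem exists_integrable_elasticFund_mul (hn : 0 < n) {ω : ℝ} (hω : ω + 1 ≠ 0) (j k : Fin n) :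
    ∃ C : ℝ, ∀ f : 𝓢(EuclideanSpace ℝ (Fin n), ℂ),
      Integrable (fun x => (elasticFund ω x j k : ℂ) * f x) ∧
      ∫ x, (elasticFund ω x j k : ℂ) * f x
        = (∫ x, ((shortPart ω j k 1 x : ℂ) * f x + (regPart ω j k x : ℂ) * f x))
          + C * ∫ x, f x := by
  have : Nonempty (Fin n) := ⟨⟨0, hn⟩⟩
  obtain ⟨C, hC⟩ := exists_elasticFund_eq hn ω hω
  refine ⟨if j = k then C else 0, fun f => ?_⟩
  have h1 := integrable_shortPart_mul ω j k one_pos f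
  have h2 : Integrable fun x => (regPart ω j k x : ℂ) * f x :=
    integrable_setIntegral_heatKer_sub_mul hn ω j k le_rfl f
  have h3 : Integrable fun x => (((if j = k then C else 0 : ℝ)) : ℂ) * f x :=
    f.integrable.const_mul _
  have e : (fun x => (shortPart ω j k 1 x : ℂ) * f x + (regPart ω j k x : ℂ) * f x
      + ((if j = k then C else 0 : ℝ) : ℂ) * f x)
      =ᵐ[volume] fun x => (elasticFund ω x j k : ℂ) * f x := by
    filter_upwards [Measure.ae_ne volume (0 : EuclideanSpace ℝ (Fin n))] with x hx
    rw [hC j k x hx]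
    simp only [Complex.ofReal_add, add_mul]
  refine ⟨((h1.add h2).add h3).congr e, ?_⟩
  rw [← integral_congr_ae e, ← integral_const_mul]
  exact integral_add (h1.add h2) h3

/-- Lowering the cut-off adds a regularized integral and a constant. -/
theorem shortPart_eq_add (hn : 0 < n) (ω : ℝ) (j k : Fin n) {a : ℝ} (ha : 0 < a) (ha1 : a ≤ 1) :
    ∀ᵐ x : EuclideanSpace ℝ (Fin n), shortPart ω j k a x
      = shortPart ω j k 1 x + (∫ s in Set.Ioc a 1, (heatKer ω j k s x - heatKer ω j k s 0))
        + ∫ s in Set.Ioc a 1, heatKer ω j k s (0 : EuclideanSpace ℝ (Fin n)) := by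
  filter_upwards [(integrable_heatKer_prod (n := n) ω j k ha).prod_right_ae] with x hx
  have h1 : IntegrableOn (fun s => heatKer ω j k s x) (Set.Ioi a) := hx
  have h2 : IntegrableOn (fun s => heatKer ω j k s x) (Set.Ioc a 1) :=
    h1.mono_set Set.Ioc_subset_Ioi_self
  have h3 : IntegrableOn (fun s => heatKer ω j k s x - heatKer ω j k s 0) (Set.Ioc a 1) :=
    (integrableOn_heatKer_sub hn ω j k x).mono_set (Set.Ioc_subset_Ioc_left ha.le)
  have h4 : IntegrableOn (fun s => heatKer ω j k s (0 : EuclideanSpace ℝ (Fin n)))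
      (Set.Ioc a 1) := by
    refine (h2.sub h3).congr (Filter.Eventually.of_forall fun s => ?_)
    simp
  rw [integral_sub h2 h4, add_assoc, sub_add_cancel, shortPart, shortPart,
    ← Set.Ioc_union_Ioi_eq_Ioi ha1, setIntegral_union (Set.Ioc_disjoint_Ioi le_rfl)
      measurableSet_Ioi h2 (h1.mono_set (Set.Ioi_subset_Ioi ha1)), add_comm]

/-- Up to constants, which do not act on functions of mean zero, the short range parts converge to
`Γ_{n,ω}` as the cut-off tends to `0`. -/
theorem tendsto_integral_shortPart_mul (hn : 0 < n) {ω : ℝ} (hω : ω + 1 ≠ 0) (j k : Fin n)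
    (f : 𝓢(EuclideanSpace ℝ (Fin n), ℂ)) (hf : ∫ x, f x = 0) :
    Filter.Tendsto (fun a => ∫ x, (shortPart ω j k a x : ℂ) * f x) (𝓝[>] 0)
      (𝓝 (∫ x, (elasticFund ω x j k : ℂ) * f x)) := by
  obtain ⟨C, hC⟩ := exists_integrable_elasticFund_mul hn hω j k
  rw [(hC f).2, hf, mul_zero, add_zero]
  set M : ℝ → EuclideanSpace ℝ (Fin n) → ℝ := fun a x =>
    ∫ s in Set.Ioc a 1, (heatKer ω j k s x - heatKer ω j k s 0) with hM
  have h1 := integrable_shortPart_mul ω j k one_pos f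
  refine Filter.Tendsto.congr'
    (f₁ := fun a => ∫ x, ((shortPart ω j k 1 x : ℂ) * f x + (M a x : ℂ) * f x)) ?_ ?_
  · filter_upwards [Ioc_mem_nhdsGT (zero_lt_one' ℝ)] with a ha
    have h2 := integrable_setIntegral_heatKer_sub_mul hn ω j k ha.1.le f
    set e : ℝ := ∫ s in Set.Ioc a 1, heatKer ω j k s (0 : EuclideanSpace ℝ (Fin n)) with he
    have h3 : ∫ x, (shortPart ω j k a x : ℂ) * f x
        = ∫ x, (((shortPart ω j k 1 x : ℂ) * f x + (M a x : ℂ) * f x) + (e : ℂ) * f x) := by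
      refine integral_congr_ae ?_
      filter_upwards [shortPart_eq_add hn ω j k ha.1 ha.2] with x hx
      rw [hx, hM]
      push_cast
      ring
    have h4 : ∫ x, (e : ℂ) * f x = 0 := by rw [integral_const_mul, hf, mul_zero]
    rw [h3, ← add_zero (∫ x, _ + _), ← h4]
    exact (integral_add (h1.add h2) (f.integrable.const_mul _)).symm
  · refine tendsto_integral_filter_of_dominated_convergence
      (fun x => ‖(shortPart ω j k 1 x : ℂ) * f x‖ +
        kerConst ω * (∫ s in Set.Ioc (0 : ℝ) 1, s * heatWeight n s) * (‖x‖ ^ 2 * ‖f x‖)) ?_ ?_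
      (h1.norm.add ((f.integrable_pow_mul volume 2).const_mul _)) ?_
    · filter_upwards with a
      exact h1.aestronglyMeasurable.add ((Complex.continuous_ofReal.comp_aestronglyMeasurable
        (aestronglyMeasurable_setIntegral_heatKer_sub ω j k _)).mul
        f.continuous.aestronglyMeasurable)
    · filter_upwards [self_mem_nhdsWithin] with a ha
      filter_upwards with x
      exact (norm_add_le _ _).trans (add_le_add le_rfl
        (norm_setIntegral_heatKer_sub_mul_le hn ω j k (le_of_lt ha) x _))
    · filter_upwards with x
      refine (Filter.Tendsto.mul_const _ ?_).const_add _
      refine (Complex.continuous_ofReal.tendsto _).comp ?_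
      have hg := integrableOn_heatKer_sub hn ω j k x
      set g : ℝ → ℝ := fun s => heatKer ω j k s x - heatKer ω j k s 0 with hgdef
      have e1 : ∀ a : ℝ, 0 ≤ a → M a x = ∫ s in Set.Ioc 0 1, (Set.Ioi a).indicator g s := by
        intro a ha
        rw [setIntegral_indicator measurableSet_Ioi, Set.Ioc_inter_Ioi, max_eq_right ha]
      have e0 : regPart ω j k x = ∫ s in Set.Ioc 0 1, g s := rfl
      rw [e0]
      refine Filter.Tendsto.congr' (f₁ := fun a => ∫ s in Set.Ioc 0 1, (Set.Ioi a).indicator g s)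
        ?_ ?_
      · filter_upwards [self_mem_nhdsWithin] with a ha
        exact (e1 a (le_of_lt ha)).symm
      · refine tendsto_integral_filter_of_dominated_convergence (fun s => ‖g s‖) ?_ ?_ hg.norm ?_
        · filter_upwards with a
          exact hg.aestronglyMeasurable.indicator measurableSet_Ioi
        · filter_upwards with a
          filter_upwards with s
          exact norm_indicator_le_norm_self _ _
        · filter_upwards [ae_restrict_mem measurableSet_Ioc] with s hs
          refine tendsto_const_nhds.congr' ?_
          filter_upwards [Ioo_mem_nhdsGT hs.1] with a ha
          exact (Set.indicator_of_mem (Set.mem_Ioi.2 ha.2) g).symm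

/-- The matrix `Γ_{n,ω}` is a fundamental solution of `L[ω]`. -/
theorem lamePairing_elasticFund (hn : 0 < n) {ω : ℝ} (hω : ω + 1 ≠ 0) (j k : Fin n)
    (f : 𝓢(EuclideanSpace ℝ (Fin n), ℂ)) :
    lamePairing ω (fun j k x => elasticFund ω x j k) j k f = if j = k then f 0 else 0 := by
  refine tendsto_nhds_unique ?_ (tendsto_lamePairing_shortPart hω hn j k f)
  unfold lamePairing
  refine (tendsto_finsetSum _ fun l _ => ?_).add ((tendsto_finsetSum _ fun l _ => ?_).const_mul _)
  · exact tendsto_integral_shortPart_mul hn hω j k _ (integral_secondDeriv f l l)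
  · exact tendsto_integral_shortPart_mul hn hω l k _ (integral_secondDeriv f l j)

end EquationElasticFund

/-! ### Analyticity of the fundamental solution and of its regular part -/

section Analyticity

variable {n : ℕ}

theorem analyticAt_norm_euclidean {x : EuclideanSpace ℝ (Fin n)} (hx : x ≠ 0) :
    AnalyticAt ℝ (fun y : EuclideanSpace ℝ (Fin n) => ‖y‖) x :=
  (contDiffAt_norm ℝ hx).analyticAt

theorem analyticAt_apply (x : EuclideanSpace ℝ (Fin n)) (j : Fin n) :
    AnalyticAt ℝ (fun y : EuclideanSpace ℝ (Fin n) => y j) x :=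
  (EuclideanSpace.proj (𝕜 := ℝ) j).analyticAt x

theorem analyticAt_norm_sq (x : EuclideanSpace ℝ (Fin n)) :
    AnalyticAt ℝ (fun y : EuclideanSpace ℝ (Fin n) => ‖y‖ ^ 2) x :=
  (contDiff_norm_sq ℝ).contDiffAt.analyticAt

theorem analyticAt_elasticFund (ω : ℝ) (j k : Fin n) {x : EuclideanSpace ℝ (Fin n)} (hx : x ≠ 0) :
    AnalyticAt ℝ (fun y => elasticFund ω y j k) x := by
  have hx' : 0 < ‖x‖ := norm_pos_iff.2 hx
  have h1 : AnalyticAt ℝ (laplaceFund (n := n)) x := by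
    unfold laplaceFund
    split_ifs
    · exact analyticAt_const.mul ((analyticAt_log hx').fun_comp (analyticAt_norm_euclidean hx))
    · exact analyticAt_const.mul ((analyticAt_norm_euclidean hx).zpow hx'.ne')
  simp only [elasticFund, Matrix.of_apply]
  exact (analyticAt_const.mul h1).sub (analyticAt_const.mul
    (((analyticAt_apply x j).mul (analyticAt_apply x k)).div
      ((analyticAt_norm_euclidean hx).pow n) (by positivity)))

/-- The smooth part of `Γ_{n,ω}` is analytic at the origin: it is a power series in `|x|²`
with polynomial coefficients. -/
theorem analyticAt_regPart (hn : 0 < n) (ω : ℝ) (j k : Fin n) :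
    AnalyticAt ℝ (regPart (n := n) ω j k) 0 := by
  have hw := integrableOn_mul_heatWeight hn
  have hwm : Measurable fun s : ℝ => s * heatWeight n s := measurable_id.mul measurable_heatWeight
  -- the two moments, as functions of `ρ = |x|²`
  have h1 : AnalyticAt ℝ (fun ρ : ℝ => ∫ s in Set.Ioc (0 : ℝ) 1, s * heatWeight n s *
      Real.exp ((-s • ContinuousLinearMap.id ℝ ℝ) ρ)) 0 := by
    refine analyticAt_integral_rexp one_pos hwm.aestronglyMeasurable
      (Continuous.aestronglyMeasurable (by fun_prop)) ?_
    refine (hw.norm.mul_const (Real.exp 1)).mono' ?_ ?_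
    · refine AEStronglyMeasurable.mul hwm.abs.aestronglyMeasurable
        (Continuous.aestronglyMeasurable (by fun_prop))
    · filter_upwards [ae_restrict_mem measurableSet_Ioc] with s hs
      rw [Real.norm_of_nonneg (by positivity), Real.norm_eq_abs]
      gcongr
      rw [one_mul, norm_smul, ContinuousLinearMap.norm_id, mul_one, norm_neg,
        Real.norm_of_nonneg hs.1.le]
      exact hs.2
  have h2 : AnalyticAt ℝ (fun ρ : ℝ => ∫ p : ℝ × ℝ, p.1 * heatWeight n p.1 *
      Real.exp ((-(p.1 * p.2) • ContinuousLinearMap.id ℝ ℝ) ρ)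
      ∂((volume.restrict (Set.Ioc (0 : ℝ) 1)).prod (volume.restrict (Set.Ioc (0 : ℝ) 1)))) 0 := by
    refine analyticAt_integral_rexp one_pos (hwm.comp measurable_fst).aestronglyMeasurable
      (Continuous.aestronglyMeasurable (by fun_prop)) ?_
    refine ((hw.norm.comp_fst (volume.restrict (Set.Ioc (0 : ℝ) 1))).mul_const (Real.exp 1)).mono'
      ?_ ?_
    · refine AEStronglyMeasurable.mul (hwm.comp measurable_fst).abs.aestronglyMeasurable
        (Continuous.aestronglyMeasurable (by fun_prop))
    · rw [Measure.prod_restrict]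
      filter_upwards [ae_restrict_mem (measurableSet_Ioc.prod measurableSet_Ioc)] with p hp
      rw [Real.norm_of_nonneg (by positivity), Real.norm_eq_abs]
      gcongr
      rw [one_mul, norm_smul, ContinuousLinearMap.norm_id, mul_one, norm_neg, norm_mul,
        Real.norm_of_nonneg hp.1.1.le, Real.norm_of_nonneg hp.2.1.le]
      nlinarith [hp.1.1, hp.1.2, hp.2.1, hp.2.2]
  have hsq : AnalyticAt ℝ (fun x : EuclideanSpace ℝ (Fin n) => ‖x‖ ^ 2) 0 := analyticAt_norm_sq 0
  have h1' := AnalyticAt.fun_comp (x := (0 : EuclideanSpace ℝ (Fin n))) (by simpa using h1) hsq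
  have h2' := AnalyticAt.fun_comp (x := (0 : EuclideanSpace ℝ (Fin n))) (by simpa using h2) hsq
  set c : ℝ := (ω + 2) / (2 * (ω + 1)) * (if j = k then 1 else 0) with hc
  have h3 := ((analyticAt_const (v := c)).mul (hsq.mul h2')).sub
    ((analyticAt_const (v := ω / (ω + 1))).mul
      (((analyticAt_apply 0 j).mul (analyticAt_apply 0 k)).mul h1'))
  refine h3.congr (Filter.Eventually.of_forall fun x => ?_)
  set ρ := ‖x‖ ^ 2 with hρ
  have hρ0 : 0 ≤ ρ := by positivity
  have i1 : IntegrableOn (fun s => s * heatWeight n s * Real.exp (-s * ρ)) (Set.Ioc 0 1) := by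
    refine hw.norm.mono' (hwm.mul (by fun_prop)).aestronglyMeasurable ?_
    filter_upwards [ae_restrict_mem measurableSet_Ioc] with s hs
    rw [norm_mul, Real.norm_of_nonneg (Real.exp_pos _).le]
    refine mul_le_of_le_one_right (norm_nonneg _) (Real.exp_le_one_iff.2 ?_)
    nlinarith [hs.1]
  have i2 : Integrable (fun p : ℝ × ℝ => p.1 * heatWeight n p.1 * Real.exp (-(p.1 * p.2) * ρ))
      ((volume.restrict (Set.Ioc (0 : ℝ) 1)).prod (volume.restrict (Set.Ioc (0 : ℝ) 1))) := by
    refine (hw.norm.comp_fst (volume.restrict (Set.Ioc (0 : ℝ) 1))).mono'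
      ((hwm.comp measurable_fst).mul (by fun_prop)).aestronglyMeasurable ?_
    rw [Measure.prod_restrict]
    filter_upwards [ae_restrict_mem (measurableSet_Ioc.prod measurableSet_Ioc)] with p hp
    rw [norm_mul, Real.norm_of_nonneg (Real.exp_pos _).le]
    refine mul_le_of_le_one_right (norm_nonneg _) (Real.exp_le_one_iff.2 ?_)
    nlinarith [mul_pos hp.1.1 hp.2.1]
  -- `1 - e^{-sρ} = ∫₀¹ sρ e^{-sρθ} dθ`
  have i3 : ∀ s ∈ Set.Ioc (0 : ℝ) 1, heatKer ω j k s x - heatKer ω j k s 0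
      = c * (ρ * ∫ θ in Set.Ioc (0 : ℝ) 1, s * heatWeight n s * Real.exp (-(s * θ) * ρ))
        - ω / (ω + 1) * (x j * x k * (s * heatWeight n s * Real.exp (-s * ρ))) := by
    intro s hs
    have hd : ∀ θ ∈ Set.uIcc (0 : ℝ) 1, HasDerivAt (fun θ : ℝ => -Real.exp (-(s * θ) * ρ))
        (s * ρ * Real.exp (-(s * θ) * ρ)) θ := by
      intro θ _
      have h : HasDerivAt (fun θ : ℝ => -(s * θ) * ρ) (-(s * 1) * ρ) θ :=
        (((hasDerivAt_id θ).const_mul s).neg).mul_const ρ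
      exact h.exp.neg.congr_deriv (by ring)
    have hint := intervalIntegral.integral_eq_sub_of_hasDerivAt hd
      (Continuous.intervalIntegrable (by fun_prop) _ _)
    rw [intervalIntegral.integral_of_le zero_le_one, integral_const_mul] at hint
    have h4 : ρ * ∫ θ in Set.Ioc (0 : ℝ) 1, s * heatWeight n s * Real.exp (-(s * θ) * ρ)
        = heatWeight n s * (1 - Real.exp (-s * ρ)) := by
      rw [integral_const_mul]
      simp only [mul_zero, neg_zero, zero_mul, Real.exp_zero, mul_one] at hint
      linear_combination heatWeight n s * hint
    rw [h4, heatKer_zero_right, heatKer, ← hc, ← hρ]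
    ring
  rw [regPart, setIntegral_congr_fun measurableSet_Ioc i3, integral_sub
    ((i2.integral_prod_left.const_mul ρ).const_mul c) ((i1.const_mul _).const_mul _),
    integral_const_mul, integral_const_mul, integral_const_mul, integral_const_mul,
    ← integral_prod _ i2]
  simp [hρ]

end Analyticity

/-! ### Analyticity of the sums of short range parts -/

section AnalyticSums

open scoped Topology

variable {n : ℕ}

theorem integral_count_eq_tsum {ι F : Type*} [Countable ι] [MeasurableSpace ι]
    [MeasurableSingletonClass ι] [NormedAddCommGroup F] [NormedSpace ℝ F] [CompleteSpace F]
    {f : ι → F} (hf : Integrable f Measure.count) : ∫ i, f i ∂Measure.count = ∑' i, f i := by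
  rw [integral_countable hf]
  simp [measureReal_def]

/-- The linear form `(h, ρ) ↦ -2s ⟨v, h⟩ - s ρ`. For `ρ = |h|²` its exponential is
`e^{-s|v + h|²} / e^{-s|v|²}`. -/
noncomputable def shiftForm (v : EuclideanSpace ℝ (Fin n)) (s : ℝ) :
    EuclideanSpace ℝ (Fin n) × ℝ →L[ℝ] ℝ :=
  (-2 * s) • ((innerSL ℝ v).comp (ContinuousLinearMap.fst ℝ _ _))
    + (-s) • ContinuousLinearMap.snd ℝ _ _

theorem norm_shiftForm_le (v : EuclideanSpace ℝ (Fin n)) {s : ℝ} (hs : 0 ≤ s) :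
    ‖shiftForm v s‖ ≤ s * (2 * ‖v‖ + 1) := by
  refine ContinuousLinearMap.opNorm_le_bound _ (by positivity) fun p => ?_
  have h1 : ‖p.1‖ ≤ ‖p‖ := norm_fst_le p
  have h2 : ‖p.2‖ ≤ ‖p‖ := norm_snd_le p
  have h3 : |inner ℝ v p.1| ≤ ‖v‖ * ‖p‖ := (abs_real_inner_le_norm v p.1).trans (by gcongr)
  have e : shiftForm v s p = -2 * s * inner ℝ v p.1 + -s * p.2 := by simp [shiftForm]
  rw [e, Real.norm_eq_abs]
  calc |-2 * s * inner ℝ v p.1 + -s * p.2|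
      ≤ 2 * s * |inner ℝ v p.1| + s * |p.2| := by
        refine (abs_add_le _ _).trans ?_
        rw [abs_mul, abs_mul, abs_mul, abs_neg, abs_neg, abs_of_nonneg hs, abs_of_pos two_pos]
    _ ≤ 2 * s * (‖v‖ * ‖p‖) + s * ‖p‖ := by gcongr; exact h2
    _ = _ := by ring

theorem exp_neg_mul_norm_add_sq (v h : EuclideanSpace ℝ (Fin n)) (s : ℝ) :
    Real.exp (-s * ‖v + h‖ ^ 2)
      = Real.exp (-s * ‖v‖ ^ 2) * Real.exp (shiftForm v s (h, ‖h‖ ^ 2)) := by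
  rw [← Real.exp_add, norm_add_sq_real]
  congr 1
  simp [shiftForm]
  ring

variable {ι : Type*} [TopologicalSpace ι] [MeasurableSpace ι]

/-- The sum `∑ᵢ ∫₁^∞ p(i,s) w(s) e^{-s|vᵢ|²} e^{Λ(y)} ds`, with `w = heatWeight n` and
`Λ = shiftForm (v i) s`. At `y = (h, |h|²)` the exponentials combine to `e^{-s|vᵢ + h|²}`. -/
noncomputable def weightedSum (v : ι → EuclideanSpace ℝ (Fin n)) (p : ι × ℝ → ℝ)
    (y : EuclideanSpace ℝ (Fin n) × ℝ) : ℝ :=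
  ∫ x : ι × ℝ, p x * (heatWeight n x.2 * Real.exp (-x.2 * ‖v x.1‖ ^ 2)) *
    Real.exp (shiftForm (v x.1) x.2 y) ∂((Measure.count).prod (volume.restrict (Set.Ioi 1)))

theorem continuous_shiftForm {ι : Type*} [TopologicalSpace ι] [DiscreteTopology ι]
    (v : ι → EuclideanSpace ℝ (Fin n)) :
    Continuous fun x : ι × ℝ => shiftForm (v x.1) x.2 := by
  have hv : Continuous v := continuous_of_discreteTopology
  unfold shiftForm
  fun_prop

variable [DiscreteTopology ι] [BorelSpace ι]

theorem aestronglyMeasurable_weightedSum {v : ι → EuclideanSpace ℝ (Fin n)} {p : ι × ℝ → ℝ}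
    (hp : Continuous p) (μ : Measure (ι × ℝ)) : AEStronglyMeasurable
      (fun x => p x * (heatWeight n x.2 * Real.exp (-x.2 * ‖v x.1‖ ^ 2))) μ := by
  have hv : Continuous v := continuous_of_discreteTopology
  have h1 : Continuous fun x : ι × ℝ => Real.exp (-x.2 * ‖v x.1‖ ^ 2) := by fun_prop
  exact hp.aestronglyMeasurable.mul
    (((measurable_heatWeight (n := n)).comp measurable_snd).aestronglyMeasurable.mul
      h1.aestronglyMeasurable)

variable [Countable ι]

/-- The radius `δ² / (4δ + 2)` is chosen so that, for `|vᵢ| ≥ δ`, the exponential of `shiftForm`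
takes up at most half of the Gaussian `e^{-s|vᵢ|²}`. A quarter of the exponent is left for the sum
over `i`, and a quarter for the integral over `s`. -/
theorem integrable_weightedSum_bound (hn : 0 < n) {v : ι → EuclideanSpace ℝ (Fin n)} {δ : ℝ}
    (hδ : 0 < δ) (hv : ∀ i, δ ≤ ‖v i‖) (hsum : Summable fun i => ((1 + ‖v i‖) ^ (n + 1))⁻¹)
    {p : ι × ℝ → ℝ} (hp : Continuous p) {C : ℝ}
    (hpC : ∀ i s, 1 < s → |p (i, s)| ≤ C * s * (1 + ‖v i‖) ^ 2) :
    Integrable (fun x : ι × ℝ => |p x * (heatWeight n x.2 * Real.exp (-x.2 * ‖v x.1‖ ^ 2))| *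
      Real.exp (δ ^ 2 / (4 * δ + 2) * ‖shiftForm (v x.1) x.2‖))
      ((Measure.count).prod (volume.restrict (Set.Ioi 1))) := by
  have hsum2 : Integrable (fun i => (1 + ‖v i‖) ^ 2 * Real.exp (-(1 / 4 * ‖v i‖ ^ 2)))
      Measure.count := by
    rw [integrable_count_iff]
    refine Summable.of_nonneg_of_le (fun _ => norm_nonneg _) (fun i => ?_)
      (hsum.mul_left ((n + 3).factorial * Real.exp (1 + 1 / 1)))
    have h := one_add_pow_le_exp one_pos (n + 3) (norm_nonneg (v i))
    rw [one_mul] at h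
    rw [Real.norm_of_nonneg (by positivity), ← div_eq_mul_inv, le_div_iff₀ (by positivity),
      Real.exp_neg]
    have e : (1 + ‖v i‖) ^ 2 * (Real.exp (1 / 4 * ‖v i‖ ^ 2))⁻¹ * (1 + ‖v i‖) ^ (n + 1)
        = (1 + ‖v i‖) ^ (n + 3) / Real.exp (1 / 4 * ‖v i‖ ^ 2) := by
      rw [div_eq_mul_inv]; ring
    rw [e, div_le_iff₀ (Real.exp_pos _)]
    exact h
  have hW := (integrableOn_mul_heatWeight_mul_exp hn (show 0 < δ ^ 2 / 4 by positivity)).mono_set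
    (Set.Ioi_subset_Ioi (zero_le_one' ℝ))
  refine ((hsum2.mul_prod hW).const_mul C).mono' ?_ ?_
  · refine ((continuous_abs.comp_aestronglyMeasurable (aestronglyMeasurable_weightedSum hp _))).mul
      (Real.continuous_exp.comp_aestronglyMeasurable ?_)
    exact ((continuous_shiftForm v).norm.const_mul _).aestronglyMeasurable
  · have hae : ∀ᵐ x : ι × ℝ ∂((Measure.count).prod (volume.restrict (Set.Ioi 1))), 1 < x.2 :=
      Measure.quasiMeasurePreserving_snd.ae (ae_restrict_mem measurableSet_Ioi)
    filter_upwards [hae] with x hx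
    obtain ⟨i, s⟩ := x
    simp only at hx ⊢
    have hs0 : 0 < s := one_pos.trans hx
    have hw := (heatWeight_pos (n := n) hs0).le
    set d := ‖v i‖ with hd
    have hdδ : δ ≤ d := hv i
    have hd0 : 0 < d := hδ.trans_le hdδ
    have hr : δ ^ 2 / (4 * δ + 2) * ‖shiftForm (v i) s‖ ≤ s * d ^ 2 / 2 := by
      have h1 : δ ^ 2 / (4 * δ + 2) * (2 * d + 1) ≤ d ^ 2 / 2 := by
        rw [div_mul_eq_mul_div, div_le_div_iff₀ (by positivity) two_pos]
        nlinarith [mul_nonneg (mul_pos hδ hd0).le (sub_nonneg.2 hdδ),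
          mul_nonneg (add_pos hδ hd0).le (sub_nonneg.2 hdδ)]
      calc _ ≤ δ ^ 2 / (4 * δ + 2) * (s * (2 * d + 1)) := by
            gcongr; exact norm_shiftForm_le _ hs0.le
        _ = s * (δ ^ 2 / (4 * δ + 2) * (2 * d + 1)) := by ring
        _ ≤ s * (d ^ 2 / 2) := by gcongr
        _ = _ := by ring
    have hexp : Real.exp (-s * d ^ 2) * Real.exp (s * d ^ 2 / 2)
        ≤ Real.exp (-(1 / 4 * d ^ 2)) * Real.exp (-(δ ^ 2 / 4 * s)) := by
      rw [← Real.exp_add, ← Real.exp_add]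
      refine Real.exp_le_exp.2 ?_
      have h1 : d ^ 2 ≤ s * d ^ 2 := by nlinarith [sq_nonneg d]
      have h2 : δ ^ 2 * s ≤ d ^ 2 * s := by gcongr
      linarith
    have hC : 0 ≤ C * s * (1 + d) ^ 2 := (abs_nonneg _).trans (hpC i s hx)
    rw [Real.norm_of_nonneg (by positivity), abs_mul, abs_mul, Real.abs_exp, abs_of_nonneg hw]
    calc |p (i, s)| * (heatWeight n s * Real.exp (-s * d ^ 2))
          * Real.exp (δ ^ 2 / (4 * δ + 2) * ‖shiftForm (v i) s‖)
        ≤ (C * s * (1 + d) ^ 2) * (heatWeight n s * Real.exp (-s * d ^ 2))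
          * Real.exp (s * d ^ 2 / 2) := by gcongr; exact hpC i s hx
      _ = (C * s * (1 + d) ^ 2) * heatWeight n s *
          (Real.exp (-s * d ^ 2) * Real.exp (s * d ^ 2 / 2)) := by ring
      _ ≤ (C * s * (1 + d) ^ 2) * heatWeight n s *
          (Real.exp (-(1 / 4 * d ^ 2)) * Real.exp (-(δ ^ 2 / 4 * s))) := by gcongr
      _ = _ := by ring

theorem analyticAt_weightedSum (hn : 0 < n) {v : ι → EuclideanSpace ℝ (Fin n)} {δ : ℝ}
    (hδ : 0 < δ) (hv : ∀ i, δ ≤ ‖v i‖) (hsum : Summable fun i => ((1 + ‖v i‖) ^ (n + 1))⁻¹)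
    {p : ι × ℝ → ℝ} (hp : Continuous p) {C : ℝ}
    (hpC : ∀ i s, 1 < s → |p (i, s)| ≤ C * s * (1 + ‖v i‖) ^ 2) :
    AnalyticAt ℝ (fun h : EuclideanSpace ℝ (Fin n) => weightedSum v p (h, ‖h‖ ^ 2)) 0 := by
  have h1 : AnalyticAt ℝ (weightedSum v p)
      ((fun h : EuclideanSpace ℝ (Fin n) => (h, ‖h‖ ^ 2)) 0) := by
    have := analyticAt_integral_rexp (r := δ ^ 2 / (4 * δ + 2)) (by positivity)
      (aestronglyMeasurable_weightedSum (v := v) hp _)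
      (continuous_shiftForm v).aestronglyMeasurable
      (integrable_weightedSum_bound hn hδ hv hsum hp hpC)
    have e : ((fun h : EuclideanSpace ℝ (Fin n) => (h, ‖h‖ ^ 2)) 0) = 0 := by simp
    rw [e]
    exact this
  exact AnalyticAt.comp (f := fun h : EuclideanSpace ℝ (Fin n) => (h, ‖h‖ ^ 2)) h1
    (analyticAt_id.prod (analyticAt_norm_sq 0))

theorem integrable_weightedSum (hn : 0 < n) {v : ι → EuclideanSpace ℝ (Fin n)} {δ : ℝ}
    (hδ : 0 < δ) (hv : ∀ i, δ ≤ ‖v i‖) (hsum : Summable fun i => ((1 + ‖v i‖) ^ (n + 1))⁻¹)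
    {p : ι × ℝ → ℝ} (hp : Continuous p) {C : ℝ}
    (hpC : ∀ i s, 1 < s → |p (i, s)| ≤ C * s * (1 + ‖v i‖) ^ 2)
    {y : EuclideanSpace ℝ (Fin n) × ℝ} (hy : ‖y‖ < δ ^ 2 / (4 * δ + 2)) :
    Integrable (fun x : ι × ℝ => p x * (heatWeight n x.2 * Real.exp (-x.2 * ‖v x.1‖ ^ 2)) *
      Real.exp (shiftForm (v x.1) x.2 y)) ((Measure.count).prod (volume.restrict (Set.Ioi 1))) := by
  refine (integrable_weightedSum_bound hn hδ hv hsum hp hpC).mono'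
    ((aestronglyMeasurable_weightedSum hp _).mul ?_) (Filter.Eventually.of_forall fun x => ?_)
  · have := continuous_shiftForm v
    exact (Real.continuous_exp.comp (this.clm_apply continuous_const)).aestronglyMeasurable
  · rw [norm_mul, Real.norm_eq_abs, Real.norm_of_nonneg (Real.exp_pos _).le]
    gcongr
    refine (Real.le_norm_self _).trans ((ContinuousLinearMap.le_opNorm _ _).trans ?_)
    rw [mul_comm]
    gcongr

/-- Near a point at positive distance from the points `-v i`, the sum of the short range parts
centred at these points is real analytic and converges absolutely. -/
theorem analyticAt_tsum_shortPart (hn : 0 < n) (ω : ℝ) (j k : Fin n)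
    {v : ι → EuclideanSpace ℝ (Fin n)} {δ : ℝ}
    (hδ : 0 < δ) (hv : ∀ i, δ ≤ ‖v i‖) (hsum : Summable fun i => ((1 + ‖v i‖) ^ (n + 1))⁻¹) :
    AnalyticAt ℝ (fun h => ∑' i, shortPart ω j k 1 (v i + h)) 0 ∧
      ∀ᶠ h in 𝓝 (0 : EuclideanSpace ℝ (Fin n)), Summable fun i => shortPart ω j k 1 (v i + h) := by
  set c : ℝ := (ω + 2) / (2 * (ω + 1)) * (if j = k then 1 else 0) with hc
  set α : ℝ := ω / (ω + 1) with hα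
  have hvc : Continuous v := continuous_of_discreteTopology
  -- the weights of `1`, `h_k`, `h_j` and `h_j h_k` in the kernel at `v i + h`
  set p0 : ι × ℝ → ℝ := fun x => -(c + α * (x.2 * (v x.1 j * v x.1 k))) with hp0
  set p1 : ι × ℝ → ℝ := fun x => -(α * (x.2 * v x.1 j)) with hp1
  set p2 : ι × ℝ → ℝ := fun x => -(α * (x.2 * v x.1 k)) with hp2
  set p3 : ι × ℝ → ℝ := fun x => -(α * x.2) with hp3
  have c0 : Continuous p0 := by fun_prop
  have c1 : Continuous p1 := by fun_prop
  have c2 : Continuous p2 := by fun_prop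
  have c3 : Continuous p3 := by fun_prop
  have hcoord : ∀ (w : EuclideanSpace ℝ (Fin n)) (l : Fin n), |w l| ≤ (1 + ‖w‖) ^ 2 := fun w l => by
    have h := PiLp.norm_apply_le w l
    rw [Real.norm_eq_abs] at h
    nlinarith [norm_nonneg w]
  have b0 : ∀ i s, 1 < s → |p0 (i, s)| ≤ (|c| + |α|) * s * (1 + ‖v i‖) ^ 2 := by
    intro i s hs
    have hs0 : 0 < s := one_pos.trans hs
    have h1 := abs_apply_mul_apply_le (v i) j k
    have h2 : |p0 (i, s)| ≤ |c| + |α| * (s * ‖v i‖ ^ 2) := by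
      rw [hp0]
      simp only [abs_neg]
      refine (abs_add_le _ _).trans ?_
      rw [abs_mul α, abs_mul s, abs_of_pos hs0]
      gcongr
    have h3 : 1 ≤ s * (1 + ‖v i‖) ^ 2 := by nlinarith [norm_nonneg (v i)]
    have h4 : ‖v i‖ ^ 2 ≤ (1 + ‖v i‖) ^ 2 := by nlinarith [norm_nonneg (v i)]
    calc |p0 (i, s)| ≤ |c| * 1 + |α| * (s * ‖v i‖ ^ 2) := by linarith
      _ ≤ |c| * (s * (1 + ‖v i‖) ^ 2) + |α| * (s * (1 + ‖v i‖) ^ 2) := by gcongr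
      _ = _ := by ring
  have b1 : ∀ l : Fin n, ∀ i s, 1 < s →
      |-(α * (s * v i l))| ≤ |α| * s * (1 + ‖v i‖) ^ 2 := by
    intro l i s hs
    have hs0 : 0 < s := one_pos.trans hs
    rw [abs_neg, abs_mul, abs_mul, abs_of_pos hs0, mul_assoc]
    gcongr
    exact hcoord _ _
  have b3 : ∀ i s, 1 < s → |p3 (i, s)| ≤ |α| * s * (1 + ‖v i‖) ^ 2 := by
    intro i s hs
    have hs0 : 0 < s := one_pos.trans hs
    rw [hp3, abs_neg, abs_mul, abs_of_pos hs0]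
    refine le_mul_of_one_le_right (by positivity) ?_
    nlinarith [norm_nonneg (v i)]
  set r := δ ^ 2 / (4 * δ + 2) with hr
  have hr0 : 0 < r := by positivity
  have hnear : ∀ᶠ h in 𝓝 (0 : EuclideanSpace ℝ (Fin n)), ‖(h, ‖h‖ ^ 2)‖ < r := by
    have hcont : Continuous fun h : EuclideanSpace ℝ (Fin n) => ‖(h, ‖h‖ ^ 2)‖ := by fun_prop
    exact hcont.continuousAt.eventually_lt continuousAt_const (by simpa using hr0)
  have hexpand : ∀ (h : EuclideanSpace ℝ (Fin n)) (i : ι) (s : ℝ), heatKer ω j k s (v i + h)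
      = p0 (i, s) * (heatWeight n s * Real.exp (-s * ‖v i‖ ^ 2))
          * Real.exp (shiftForm (v i) s (h, ‖h‖ ^ 2))
        + h k * (p1 (i, s) * (heatWeight n s * Real.exp (-s * ‖v i‖ ^ 2))
          * Real.exp (shiftForm (v i) s (h, ‖h‖ ^ 2)))
        + h j * (p2 (i, s) * (heatWeight n s * Real.exp (-s * ‖v i‖ ^ 2))
          * Real.exp (shiftForm (v i) s (h, ‖h‖ ^ 2)))
        + h j * h k * (p3 (i, s) * (heatWeight n s * Real.exp (-s * ‖v i‖ ^ 2))
          * Real.exp (shiftForm (v i) s (h, ‖h‖ ^ 2))) := by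
    intro h i s
    rw [heatKer, exp_neg_mul_norm_add_sq, ← hc, ← hα]
    simp only [hp0, hp1, hp2, hp3, PiLp.add_apply]
    ring
  have hint : ∀ h : EuclideanSpace ℝ (Fin n), ‖(h, ‖h‖ ^ 2)‖ < r →
      Integrable (fun x : ι × ℝ => heatKer ω j k x.2 (v x.1 + h))
        ((Measure.count).prod (volume.restrict (Set.Ioi 1))) ∧
      ∫ x : ι × ℝ, heatKer ω j k x.2 (v x.1 + h)
        ∂((Measure.count).prod (volume.restrict (Set.Ioi 1)))
        = weightedSum v p0 (h, ‖h‖ ^ 2) + h k * weightedSum v p1 (h, ‖h‖ ^ 2)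
          + h j * weightedSum v p2 (h, ‖h‖ ^ 2)
          + h j * h k * weightedSum v p3 (h, ‖h‖ ^ 2) := by
    intro h hh
    have i0 := integrable_weightedSum hn hδ hv hsum c0 b0 hh
    have i1 := (integrable_weightedSum hn hδ hv hsum c1 (b1 j) hh).const_mul (h k)
    have i2 := (integrable_weightedSum hn hδ hv hsum c2 (b1 k) hh).const_mul (h j)
    have i3 := (integrable_weightedSum hn hδ hv hsum c3 b3 hh).const_mul (h j * h k)
    simp only [hexpand]
    refine ⟨((i0.add i1).add i2).add i3, ?_⟩
    refine (integral_add ((i0.add i1).add i2) i3).trans ?_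
    rw [integral_const_mul]
    refine congrArg₂ _ ?_ rfl
    refine (integral_add (i0.add i1) i2).trans ?_
    rw [integral_const_mul]
    refine congrArg₂ _ ?_ rfl
    refine (integral_add i0 i1).trans ?_
    rw [integral_const_mul]
    rfl
  have a0 := analyticAt_weightedSum hn hδ hv hsum c0 b0
  have a1 := analyticAt_weightedSum hn hδ hv hsum c1 (b1 j)
  have a2 := analyticAt_weightedSum hn hδ hv hsum c2 (b1 k)
  have a3 := analyticAt_weightedSum hn hδ hv hsum c3 b3
  have xj := analyticAt_apply (0 : EuclideanSpace ℝ (Fin n)) j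
  have xk := analyticAt_apply (0 : EuclideanSpace ℝ (Fin n)) k
  refine ⟨(((a0.add (xk.mul a1)).add (xj.mul a2)).add ((xj.mul xk).mul a3)).congr ?_, ?_⟩
  · filter_upwards [hnear] with h hh
    obtain ⟨hi, he⟩ := hint h hh
    rw [integral_prod _ hi, integral_count_eq_tsum hi.integral_prod_left] at he
    exact he.symm
  · filter_upwards [hnear] with h hh
    have := (hint h hh).1.integral_prod_left
    rw [integrable_count_iff] at this
    exact this.of_norm

end AnalyticSums

/-! ### The periodic function and its regular part -/

section PeriodicFunction

open scoped Topology

variable {n : ℕ}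

/-- A family of nonzero vectors that tends to infinity stays away from the origin. -/
theorem exists_pos_le_norm_of_summable {ι : Type*} {v : ι → EuclideanSpace ℝ (Fin n)}
    (hsum : Summable fun i => ((1 + ‖v i‖) ^ (n + 1))⁻¹) (hv : ∀ i, v i ≠ 0) :
    ∃ δ : ℝ, 0 < δ ∧ ∀ i, δ ≤ ‖v i‖ := by
  have h1 := hsum.tendsto_cofinite_zero.eventually_lt_const
    (show (0 : ℝ) < ((1 + 1) ^ (n + 1))⁻¹ by positivity)
  set S : Set ι := {i | ¬ ((1 + ‖v i‖) ^ (n + 1))⁻¹ < ((1 + 1) ^ (n + 1) : ℝ)⁻¹} with hS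
  have hSf : S.Finite := h1
  have hout : ∀ i ∉ S, 1 ≤ ‖v i‖ := by
    intro i hi
    have h2 : ((1 + ‖v i‖) ^ (n + 1))⁻¹ < ((1 + 1) ^ (n + 1) : ℝ)⁻¹ := by simpa [hS] using hi
    have h3 := (inv_lt_inv₀ (by positivity) (by positivity)).1 h2
    have h4 := lt_of_pow_lt_pow_left₀ _ (by positivity) h3
    linarith
  rcases S.eq_empty_or_nonempty with h | h
  · exact ⟨1, one_pos, fun i => hout i (by simp [h])⟩
  · obtain ⟨i0, -, hi0⟩ := S.exists_min_image (fun i => ‖v i‖) hSf h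
    refine ⟨min 1 ‖v i0‖, lt_min one_pos (norm_pos_iff.2 (hv i0)), fun i => ?_⟩
    by_cases hi : i ∈ S
    · exact (min_le_right _ _).trans (hi0 i hi)
    · exact (min_le_left _ _).trans (hout i hi)

theorem summable_one_add_norm_sub_latticePt {q : Fin n → ℝ} (hq : ∀ j, 0 < q j)
    (x : EuclideanSpace ℝ (Fin n)) :
    Summable fun z : Fin n → ℤ => ((1 + ‖x - latticePt q z‖) ^ (n + 1))⁻¹ := by
  refine Summable.of_nonneg_of_le (fun _ => by positivity) (fun z => ?_)
    ((summable_one_add_norm_latticePt hq).mul_left ((1 + ‖x‖) ^ (n + 1)))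
  have h := one_add_norm_le_mul (-latticePt q z) x
  rw [norm_neg, ← sub_eq_add_neg] at h
  rw [← div_eq_mul_inv, inv_eq_one_div, div_le_div_iff₀ (by positivity) (by positivity), one_mul,
    ← mul_pow]
  gcongr

theorem sub_latticePt_ne_zero {q : Fin n → ℝ} {x : EuclideanSpace ℝ (Fin n)} (hx : x ∉ lattice q)
    (z : Fin n → ℤ) : x - latticePt q z ≠ 0 :=
  sub_ne_zero.2 fun h => hx ⟨z, h.symm⟩

theorem latticePt_ne_zero {q : Fin n → ℝ} (hq : ∀ j, 0 < q j) {z : Fin n → ℤ} (hz : z ≠ 0) :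
    latticePt q z ≠ 0 := fun h =>
  hz (latticePt_injective hq (h.trans (latticePt_zero q).symm))

theorem zero_mem_lattice (q : Fin n → ℝ) : (0 : EuclideanSpace ℝ (Fin n)) ∈ lattice q :=
  ⟨0, latticePt_zero q⟩

theorem isClosed_lattice {q : Fin n → ℝ} (hq : ∀ j, 0 < q j) : IsClosed (lattice q) := by
  rw [← isOpen_compl_iff, Metric.isOpen_iff]
  intro x hx
  obtain ⟨δ, hδ, h⟩ := exists_pos_le_norm_of_summable (summable_one_add_norm_sub_latticePt hq x)
    (sub_latticePt_ne_zero hx)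
  refine ⟨δ, hδ, fun y hy hyl => ?_⟩
  obtain ⟨z, rfl⟩ := hyl
  have h1 := h z
  rw [Metric.mem_ball, dist_comm, dist_eq_norm] at hy
  linarith

/-- The origin is isolated in the lattice. -/
theorem eventually_notMem_lattice {q : Fin n → ℝ} (hq : ∀ j, 0 < q j) :
    ∀ᶠ x in 𝓝 (0 : EuclideanSpace ℝ (Fin n)), x ≠ 0 → x ∉ lattice q := by
  obtain ⟨δ, hδ, h⟩ := exists_pos_le_norm_of_summable
    (v := fun z : {z : Fin n → ℤ // z ≠ 0} => latticePt q z)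
    ((summable_one_add_norm_latticePt hq).comp_injective Subtype.val_injective)
    (fun z => latticePt_ne_zero hq z.2)
  filter_upwards [Metric.ball_mem_nhds 0 hδ] with x hx hx0 hxl
  obtain ⟨z, rfl⟩ := hxl
  have hz : z ≠ 0 := fun h0 => hx0 (by rw [h0, latticePt_zero])
  rw [mem_ball_zero_iff] at hx
  exact absurd (h ⟨z, hz⟩) (not_le.2 hx)

theorem summable_ne_zero_iff {F : Type*} [AddCommGroup F] [TopologicalSpace F]
    [IsTopologicalAddGroup F] {f : (Fin n → ℤ) → F} :
    (Summable fun z : {z : Fin n → ℤ // z ≠ 0} => f z) ↔ Summable f :=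
  (Set.finite_singleton (0 : Fin n → ℤ)).summable_compl_iff

theorem tsum_eq_zero_add_tsum_ne {F : Type*} [NormedAddCommGroup F] [CompleteSpace F]
    {f : (Fin n → ℤ) → F} (hf : Summable f) :
    ∑' z, f z = f 0 + ∑' z : {z : Fin n → ℤ // z ≠ 0}, f z := by
  rw [← hf.tsum_subtype_add_tsum_subtype_compl {0}, tsum_singleton]
  rfl

theorem abs_apply_mul_apply_div_le (ξ : EuclideanSpace ℝ (Fin n)) (j k : Fin n) :
    |ξ j * ξ k / ‖ξ‖ ^ 2| ≤ 1 := by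
  rw [abs_div, abs_of_nonneg (sq_nonneg ‖ξ‖)]
  exact div_le_one_of_le₀ (abs_apply_mul_apply_le ξ j k) (sq_nonneg _)

theorem abs_invSymbol_le (ω : ℝ) (j k : Fin n) {c : ℝ} (hc : 0 < c)
    {ξ : EuclideanSpace ℝ (Fin n)} (hξ : c ≤ ‖ξ‖) :
    |invSymbol ω j k ξ| ≤ 1 / (4 * Real.pi ^ 2 * c ^ 2) * (1 + |ω / (ω + 1)|) := by
  have hξ0 : 0 < ‖ξ‖ := hc.trans_le hξ
  rw [invSymbol, abs_mul, abs_of_pos (by positivity : 0 < 1 / (4 * Real.pi ^ 2 * ‖ξ‖ ^ 2))]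
  gcongr
  refine (abs_add_le _ _).trans ?_
  rw [abs_neg, abs_mul]
  gcongr
  · split_ifs <;> simp
  · exact mul_le_of_le_one_right (abs_nonneg _) (abs_apply_mul_apply_div_le ξ j k)

/-- The long range part of `Γ_{n,ω}` is bounded by a Gaussian on the frequency side. -/
theorem abs_longSymbol_le (ω : ℝ) (j k : Fin n) {c : ℝ} (hc : 0 < c)
    {ξ : EuclideanSpace ℝ (Fin n)} (hξ : c ≤ ‖ξ‖) :
    |longSymbol ω j k 1 ξ| ≤
      (1 / (4 * Real.pi ^ 2 * c ^ 2) * (1 + |ω / (ω + 1)|) + |ω / (ω + 1)| / 4)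
        * Real.exp (-(Real.pi ^ 2 * ‖ξ‖ ^ 2)) := by
  have h2 : |ω / (ω + 1) * (ξ j * ξ k) / (4 * ‖ξ‖ ^ 2 * 1)| ≤ |ω / (ω + 1)| / 4 := by
    have e : ω / (ω + 1) * (ξ j * ξ k) / (4 * ‖ξ‖ ^ 2 * 1)
        = ω / (ω + 1) / 4 * (ξ j * ξ k / ‖ξ‖ ^ 2) := by
      rw [mul_one, div_mul_div_comm]
    rw [e, abs_mul, abs_div (ω / (ω + 1)), abs_of_pos (by norm_num : (0 : ℝ) < 4)]
    exact mul_le_of_le_one_right (by positivity) (abs_apply_mul_apply_div_le ξ j k)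
  rw [longSymbol, abs_mul, Real.abs_exp, div_one, mul_comm]
  gcongr
  exact (abs_add_le _ _).trans (add_le_add (abs_invSymbol_le ω j k hc hξ) h2)

theorem exists_le_norm_dualPt {q : Fin n → ℝ} (hq : ∀ j, 0 < q j) :
    ∃ c : ℝ, 0 < c ∧ ∀ z : {z : Fin n → ℤ // z ≠ 0}, c ≤ ‖dualPt q z‖ :=
  exists_pos_le_norm_of_summable
    ((summable_one_add_norm_latticePt fun j => inv_pos.2 (hq j)).comp_injective
      Subtype.val_injective)
    (fun z => latticePt_ne_zero (fun j => inv_pos.2 (hq j)) z.2)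

/-- The exponential weight is the majorant of the plane waves `E_{2πiξ}` on a complex unit ball. -/
theorem summable_longSymbol_mul_exp {q : Fin n → ℝ} (hq : ∀ j, 0 < q j) (ω : ℝ) (j k : Fin n) :
    Summable fun z : {z : Fin n → ℤ // z ≠ 0} =>
      |longSymbol ω j k 1 (dualPt q z)| * Real.exp (2 * Real.pi * ‖dualPt q z‖) := by
  obtain ⟨c, hc, hcz⟩ := exists_le_norm_dualPt hq
  set B := 1 / (4 * Real.pi ^ 2 * c ^ 2) * (1 + |ω / (ω + 1)|) + |ω / (ω + 1)| / 4 with hB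
  have hB0 : 0 ≤ B := by positivity
  refine Summable.of_nonneg_of_le (fun _ => by positivity) (fun z => ?_)
    (((summable_one_add_norm_latticePt fun j => inv_pos.2 (hq j)).comp_injective
      Subtype.val_injective).mul_left
      (B * Real.exp 2 * ((n + 1).factorial * Real.exp (1 + 1 / 1))))
  simp only [Function.comp_apply, ← dualPt_eq_latticePt]
  have h1 := abs_longSymbol_le ω j k hc (hcz z)
  have h2 := one_add_pow_le_exp one_pos (n + 1) (norm_nonneg (dualPt q z))
  rw [← hB] at h1
  set t := ‖dualPt q z‖ with ht
  have ht0 : 0 ≤ t := norm_nonneg _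
  have h3 : Real.exp (-(Real.pi ^ 2 * t ^ 2)) * Real.exp (2 * Real.pi * t)
      * Real.exp (1 * (1 / 4) * t ^ 2) ≤ Real.exp 2 := by
    rw [← Real.exp_add, ← Real.exp_add]
    refine Real.exp_le_exp.2 ?_
    have hpi := Real.pi_gt_three
    have h4 : 9 * t ^ 2 ≤ Real.pi ^ 2 * t ^ 2 := by
      gcongr; nlinarith
    nlinarith [sq_nonneg (Real.pi * t - 2)]
  rw [← div_eq_mul_inv, le_div_iff₀ (by positivity)]
  set E1 := Real.exp (-(Real.pi ^ 2 * t ^ 2))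
  set E2 := Real.exp (2 * Real.pi * t)
  set E3 := Real.exp (1 * (1 / 4) * t ^ 2)
  set K := ((n + 1).factorial * Real.exp (1 + 1 / 1) : ℝ)
  have hK : 0 ≤ K := by positivity
  have hE2 : 0 ≤ E2 := (Real.exp_pos _).le
  have hE1 : 0 ≤ E1 := (Real.exp_pos _).le
  calc _ ≤ (B * E1) * E2 * (K * E3) := by gcongr
    _ = B * (E1 * E2 * E3) * K := by ring
    _ ≤ B * Real.exp 2 * K := by gcongr

theorem summable_longSymbol {q : Fin n → ℝ} (hq : ∀ j, 0 < q j) (ω : ℝ) (j k : Fin n) :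
    Summable fun z : {z : Fin n → ℤ // z ≠ 0} => |longSymbol ω j k 1 (dualPt q z)| :=
  Summable.of_nonneg_of_le (fun _ => abs_nonneg _)
    (fun z => le_mul_of_one_le_right (abs_nonneg _) (Real.one_le_exp (by positivity)))
    (summable_longSymbol_mul_exp hq ω j k)

/-- The Fourier series of the long range part, in real form: the coefficients are even in the
frequency. -/
noncomputable def longSum (q : Fin n → ℝ) (ω : ℝ) (j k : Fin n)
    (x : EuclideanSpace ℝ (Fin n)) : ℝ :=
  ∑' z : {z : Fin n → ℤ // z ≠ 0},
    longSymbol ω j k 1 (dualPt q z) * Real.cos (2 * Real.pi * inner ℝ (dualPt q z) x)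

theorem re_expFun (ξ x : EuclideanSpace ℝ (Fin n)) :
    (expFun ξ x).re = Real.cos (2 * Real.pi * inner ℝ ξ x) := by
  have e : 2 * Real.pi * Complex.I * (inner ℝ ξ x : ℝ)
      = ((2 * Real.pi * inner ℝ ξ x : ℝ) : ℂ) * Complex.I := by push_cast; ring
  rw [expFun, e, Complex.exp_ofReal_mul_I_re]

theorem summable_longSymbol_mul_expFun {q : Fin n → ℝ} (hq : ∀ j, 0 < q j) (ω : ℝ) (j k : Fin n)
    (x : EuclideanSpace ℝ (Fin n)) : Summable fun z : {z : Fin n → ℤ // z ≠ 0} =>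
      (longSymbol ω j k 1 (dualPt q z) : ℂ) * expFun (dualPt q z) x := by
  refine Summable.of_norm ((summable_longSymbol hq ω j k).congr fun z => ?_)
  rw [norm_mul, norm_expFun, mul_one, Complex.norm_real, Real.norm_eq_abs]

theorem longSum_eq_re {q : Fin n → ℝ} (hq : ∀ j, 0 < q j) (ω : ℝ) (j k : Fin n)
    (x : EuclideanSpace ℝ (Fin n)) : longSum q ω j k x = (∑' z : {z : Fin n → ℤ // z ≠ 0},
      (longSymbol ω j k 1 (dualPt q z) : ℂ) * expFun (dualPt q z) x).re := by
  rw [Complex.re_tsum (summable_longSymbol_mul_expFun hq ω j k x), longSum]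
  refine tsum_congr fun z => ?_
  rw [Complex.re_ofReal_mul, re_expFun]

/-- The series is a superposition of exponentials with respect to the counting measure. -/
theorem analyticAt_longSum {q : Fin n → ℝ} (hq : ∀ j, 0 < q j) (ω : ℝ) (j k : Fin n)
    (x₀ : EuclideanSpace ℝ (Fin n)) : AnalyticAt ℝ (longSum q ω j k) x₀ := by
  set Λ : {z : Fin n → ℤ // z ≠ 0} → EuclideanSpace ℝ (Fin n) →L[ℝ] ℂ := fun z =>
    (2 * Real.pi * Complex.I : ℂ) • (Complex.ofRealCLM.comp (innerSL ℝ (dualPt q z))) with hΛ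
  have hΛn : ∀ z, ‖Λ z‖ ≤ 2 * Real.pi * ‖dualPt q z‖ := by
    intro z
    refine ContinuousLinearMap.opNorm_le_bound _ (by positivity) fun h => ?_
    have h1 := abs_real_inner_le_norm (dualPt q z) h
    have e : ‖Λ z h‖ = 2 * Real.pi * |inner ℝ (dualPt q z) h| := by
      simp [hΛ, abs_of_pos Real.pi_pos]
    rw [e, mul_assoc (2 * Real.pi)]
    gcongr
  set c : {z : Fin n → ℤ // z ≠ 0} → ℂ := fun z =>
    (longSymbol ω j k 1 (dualPt q z) : ℂ) * expFun (dualPt q z) x₀ with hc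
  have hcn : ∀ z, ‖c z‖ = |longSymbol ω j k 1 (dualPt q z)| := by
    intro z
    rw [hc, norm_mul, norm_expFun, mul_one, Complex.norm_real, Real.norm_eq_abs]
  have hct : Continuous c := continuous_of_discreteTopology
  have hΛt : Continuous Λ := continuous_of_discreteTopology
  have h := analyticAt_integral_exp (μ := Measure.count) (c := c) (Λ := Λ) one_pos
    hct.aestronglyMeasurable hΛt.aestronglyMeasurable (by
      rw [integrable_count_iff]
      refine Summable.of_nonneg_of_le (fun _ => norm_nonneg _) (fun z => ?_)
        (summable_longSymbol_mul_exp hq ω j k)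
      rw [Real.norm_of_nonneg (by positivity), hcn, one_mul]
      gcongr
      exact hΛn z)
  have h2 := (Complex.reCLM.analyticAt _).comp h
  have h3 : AnalyticAt ℝ (fun x : EuclideanSpace ℝ (Fin n) => x - x₀) x₀ :=
    analyticAt_id.sub analyticAt_const
  rw [← sub_self x₀] at h2
  refine (h2.comp (f := fun x : EuclideanSpace ℝ (Fin n) => x - x₀) h3).congr
    (Filter.Eventually.of_forall fun x => ?_)
  have e : ∀ z, c z * Complex.exp (Λ z (x - x₀))
      = (longSymbol ω j k 1 (dualPt q z) : ℂ) * expFun (dualPt q z) x := by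
    intro z
    have : Complex.exp (Λ z (x - x₀)) = expFun (dualPt q z) (x - x₀) := by
      simp [hΛ, expFun]
    rw [this, hc, mul_assoc, ← expFun_add, add_sub_cancel]
  simp only [Function.comp_apply, e, Complex.reCLM_apply]
  rw [integral_count_eq_tsum
    (integrable_count_iff.2 (summable_longSymbol_mul_expFun hq ω j k x).norm),
    ← longSum_eq_re hq]

/-- The periodic analog of `Γ_{n,ω}` as a function: the short range part is summed over the lattice
and the long range part over the dual lattice. The last constant makes the mean over the cell
vanish. -/
noncomputable def perFun (q : Fin n → ℝ) (ω : ℝ) (x : EuclideanSpace ℝ (Fin n)) :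
    Matrix (Fin n) (Fin n) ℝ :=
  Matrix.of fun j k => (∑' z : Fin n → ℤ, shortPart ω j k 1 (x - latticePt q z))
    + (cellVol q)⁻¹ * (longSum q ω j k x + (if j = k then 1 else 0) / 4)

theorem analyticAt_perFun (hn : 0 < n) {q : Fin n → ℝ} (hq : ∀ j, 0 < q j) (ω : ℝ) (j k : Fin n)
    {x₀ : EuclideanSpace ℝ (Fin n)} (hx₀ : x₀ ∉ lattice q) :
    AnalyticAt ℝ (fun x => perFun q ω x j k) x₀ := by
  have hs := summable_one_add_norm_sub_latticePt hq x₀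
  obtain ⟨δ, hδ, hv⟩ := exists_pos_le_norm_of_summable hs (sub_latticePt_ne_zero hx₀)
  have h := (analyticAt_tsum_shortPart hn ω j k hδ hv hs).1
  have h3 : AnalyticAt ℝ (fun x : EuclideanSpace ℝ (Fin n) => x - x₀) x₀ :=
    analyticAt_id.sub analyticAt_const
  rw [← sub_self x₀] at h
  have h4 := AnalyticAt.comp (f := fun x : EuclideanSpace ℝ (Fin n) => x - x₀) h h3
  refine (h4.add (analyticAt_const (v := (cellVol q)⁻¹).mul ((analyticAt_longSum hq ω j k x₀).add
    (analyticAt_const (v := (if j = k then 1 else 0) / 4))))).congr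
    (Filter.Eventually.of_forall fun x => ?_)
  have e : ∀ z, x₀ - latticePt q z + (x - x₀) = x - latticePt q z := fun z => by abel
  simp [perFun, e]

theorem perFun_neg (q : Fin n → ℝ) (ω : ℝ) (x : EuclideanSpace ℝ (Fin n)) :
    perFun q ω (-x) = perFun q ω x := by
  ext j k
  have h1 : ∑' z : Fin n → ℤ, shortPart ω j k 1 (-x - latticePt q z)
      = ∑' z : Fin n → ℤ, shortPart ω j k 1 (x - latticePt q z) := by
    rw [← (Equiv.neg (Fin n → ℤ)).tsum_eq]
    refine tsum_congr fun z => ?_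
    rw [← shortPart_neg, Equiv.neg_apply, latticePt_neg]
    congr 1
    abel
  have h2 : longSum q ω j k (-x) = longSum q ω j k x := by
    simp [longSum, inner_neg_right]
  simp only [perFun, Matrix.of_apply, h1, h2]

/-- The part of the periodic function that is regular near the origin. The number `C` is the
additive constant in the splitting of `Γ_{n,ω}`. -/
noncomputable def nearReg (q : Fin n → ℝ) (ω C : ℝ) (x : EuclideanSpace ℝ (Fin n)) :
    Matrix (Fin n) (Fin n) ℝ :=
  Matrix.of fun j k =>
    (∑' z : {z : Fin n → ℤ // z ≠ 0}, shortPart ω j k 1 (x - latticePt q z))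
      + (cellVol q)⁻¹ * (longSum q ω j k x + (if j = k then 1 else 0) / 4)
      - (regPart ω j k x + if j = k then C else 0)

theorem analyticAt_nearReg (hn : 0 < n) {q : Fin n → ℝ} (hq : ∀ j, 0 < q j) (ω C : ℝ)
    (j k : Fin n) : AnalyticAt ℝ (fun x => nearReg q ω C x j k) 0 ∧
      ∀ᶠ x in 𝓝 (0 : EuclideanSpace ℝ (Fin n)),
        Summable fun z : {z : Fin n → ℤ // z ≠ 0} => shortPart ω j k 1 (x - latticePt q z) := by
  have hs : Summable fun z : {z : Fin n → ℤ // z ≠ 0} => ((1 + ‖-latticePt q z‖) ^ (n + 1))⁻¹ := by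
    simp only [norm_neg]
    exact (summable_one_add_norm_latticePt hq).comp_injective Subtype.val_injective
  obtain ⟨δ, hδ, hv⟩ := exists_pos_le_norm_of_summable hs
    (fun z => neg_ne_zero.2 (latticePt_ne_zero hq z.2))
  have h := analyticAt_tsum_shortPart hn ω j k hδ hv hs
  simp only [neg_add_eq_sub] at h
  refine ⟨?_, h.2⟩
  simp only [nearReg, Matrix.of_apply]
  exact (h.1.add (analyticAt_const.mul ((analyticAt_longSum hq ω j k 0).add
    analyticAt_const))).sub ((analyticAt_regPart hn ω j k).add analyticAt_const)

open Classical in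
/-- The difference of the periodic function and `Γ_{n,ω}` off the lattice, extended analytically to
the origin by the value of `nearReg`. The values at the other lattice points play no role. -/
noncomputable def perReg (q : Fin n → ℝ) (ω C : ℝ) (x : EuclideanSpace ℝ (Fin n)) :
    Matrix (Fin n) (Fin n) ℝ :=
  if x ∈ lattice q then nearReg q ω C x else perFun q ω x - elasticFund ω x

theorem perReg_of_notMem {q : Fin n → ℝ} (ω C : ℝ) {x : EuclideanSpace ℝ (Fin n)}
    (hx : x ∉ lattice q) : perReg q ω C x = perFun q ω x - elasticFund ω x := if_neg hx

theorem analyticOnNhd_perReg (hn : 0 < n) {q : Fin n → ℝ} (hq : ∀ j, 0 < q j) {ω C : ℝ}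
    (hC : ∀ (j k : Fin n) (x : EuclideanSpace ℝ (Fin n)), x ≠ 0 → elasticFund ω x j k
      = shortPart ω j k 1 x + regPart ω j k x + (if j = k then C else 0)) (j k : Fin n) :
    AnalyticOnNhd ℝ (fun x => perReg q ω C x j k) ((lattice q)ᶜ ∪ {0}) := by
  rintro x (hx | rfl)
  · have hx0 : x ≠ 0 := fun h => hx (h ▸ zero_mem_lattice q)
    refine ((analyticAt_perFun hn hq ω j k hx).sub (analyticAt_elasticFund ω j k hx0)).congr ?_
    filter_upwards [(isClosed_lattice hq).isOpen_compl.mem_nhds hx] with y hy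
    rw [perReg_of_notMem ω C hy]
    rfl
  · obtain ⟨ha, hs⟩ := analyticAt_nearReg hn hq ω C j k
    refine ha.congr ?_
    filter_upwards [hs, eventually_notMem_lattice hq] with x hxs hx
    by_cases hx0 : x = 0
    · rw [perReg, if_pos (hx0 ▸ zero_mem_lattice q)]
    · rw [perReg_of_notMem ω C (hx hx0), Matrix.sub_apply, hC j k x hx0]
      simp only [nearReg, perFun, Matrix.of_apply]
      rw [tsum_eq_zero_add_tsum_ne (f := fun z => shortPart ω j k 1 (x - latticePt q z))
        (summable_ne_zero_iff.1 hxs), latticePt_zero, sub_zero]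
      ring

end PeriodicFunction

/-! ### The Fourier series as a tempered distribution -/

section PeriodicDistribution

open scoped FourierTransform

variable {n : ℕ} {ι : Type*}

theorem hasSum_temperedDistribution_iff {u : ι → 𝓢'(EuclideanSpace ℝ (Fin n), ℂ)}
    {T : 𝓢'(EuclideanSpace ℝ (Fin n), ℂ)} :
    HasSum u T ↔ ∀ f, HasSum (fun i => u i f) (T f) := by
  rw [HasSum, PointwiseConvergenceCLM.tendsto_iff_forall_tendsto]
  refine forall_congr' fun f => ?_
  rw [HasSum]
  have e : ∀ s : Finset ι, (∑ i ∈ s, u i) f = ∑ i ∈ s, u i f := fun s =>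
    map_sum (PointwiseConvergenceCLM.evalCLM (RingHom.id ℂ) ℂ f) u s
  simp only [e]

/-- Sampling a Schwartz function with bounded weights at a family of points that is sparse enough
is a continuous functional. -/
theorem exists_hasSum_sampling {p : ι → EuclideanSpace ℝ (Fin n)} {c : ι → ℂ} {B : ℝ}
    (hc : ∀ i, ‖c i‖ ≤ B) (hp : Summable fun i => ((1 + ‖p i‖) ^ (n + 1))⁻¹) :
    ∃ T : 𝓢(EuclideanSpace ℝ (Fin n), ℂ) →L[ℂ] ℂ, ∀ f, HasSum (fun i => c i * f (p i)) (T f) := by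
  rcases isEmpty_or_nonempty ι with hι | ⟨⟨i0⟩⟩
  · exact ⟨0, fun f => by simp⟩
  have hB : 0 ≤ B := (norm_nonneg _).trans (hc i0)
  set S : 𝓢(EuclideanSpace ℝ (Fin n), ℂ) → ℝ := fun f => 2 ^ (n + 1) *
    ((Finset.Iic (n + 1, 0)).sup fun m => SchwartzMap.seminorm ℂ m.1 m.2) f with hS
  have hterm : ∀ f : 𝓢(EuclideanSpace ℝ (Fin n), ℂ), ∀ i,
      ‖c i * f (p i)‖ ≤ B * S f * ((1 + ‖p i‖) ^ (n + 1))⁻¹ := by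
    intro f i
    have h := one_add_le_sup_seminorm_apply (𝕜 := ℂ) (m := (n + 1, 0)) (k := n + 1) (n := 0)
      le_rfl le_rfl f (p i)
    rw [norm_iteratedFDeriv_zero] at h
    rw [norm_mul, ← div_eq_mul_inv, le_div_iff₀ (by positivity), mul_assoc]
    refine mul_le_mul (hc i) ?_ (by positivity) hB
    rw [mul_comm]
    exact h
  have hsum : ∀ f : 𝓢(EuclideanSpace ℝ (Fin n), ℂ), Summable fun i => c i * f (p i) := fun f =>
    Summable.of_norm_bounded (hp.mul_left _) (hterm f)
  refine ⟨SchwartzMap.mkCLMtoNormedSpace (𝕜 := ℂ) (σ := RingHom.id ℂ)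
    (fun f => ∑' i, c i * f (p i)) ?_ ?_ ?_, fun f => (hsum f).hasSum⟩
  · intro f g
    rw [← (hsum f).tsum_add (hsum g)]
    exact tsum_congr fun i => by rw [add_apply, mul_add]
  · intro a f
    rw [RingHom.id_apply, smul_eq_mul, ← tsum_mul_left]
    exact tsum_congr fun i => by rw [smul_apply, smul_eq_mul]; ring
  · refine ⟨Finset.Iic (n + 1, 0), B * 2 ^ (n + 1) * ∑' i, ((1 + ‖p i‖) ^ (n + 1))⁻¹, ?_,
      fun f => ?_⟩
    · have : 0 ≤ ∑' i, ((1 + ‖p i‖) ^ (n + 1))⁻¹ := tsum_nonneg fun i => by positivity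
      positivity
    · refine (tsum_of_norm_bounded (hp.mul_left (B * S f)).hasSum (hterm f)).trans (le_of_eq ?_)
      have e : S f = 2 ^ (n + 1) * (Finset.Iic (n + 1, 0)).sup
        (schwartzSeminormFamily ℂ (EuclideanSpace ℝ (Fin n)) ℂ) f := rfl
      rw [tsum_mul_left, e]
      ring

theorem perCoeff_eq (q : Fin n → ℝ) (ω : ℝ) (j k : Fin n) (z : Fin n → ℤ) :
    perCoeff q ω j k z = (cellVol q)⁻¹ * invSymbol ω j k (dualPt q z) := by
  rw [perCoeff, invSymbol, ← mul_assoc]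
  congr 1
  rw [mul_right_comm, one_div, one_div, mul_inv, mul_comm]

theorem exists_norm_perCoeff_le {q : Fin n → ℝ} (hq : ∀ j, 0 < q j) (ω : ℝ) (j k : Fin n) :
    ∃ B, ∀ z : {z : Fin n → ℤ // z ≠ 0}, ‖((perCoeff q ω j k z : ℝ) : ℂ)‖ ≤ B := by
  obtain ⟨c, hc, hcz⟩ := exists_le_norm_dualPt hq
  refine ⟨(cellVol q)⁻¹ * (1 / (4 * Real.pi ^ 2 * c ^ 2) * (1 + |ω / (ω + 1)|)), fun z => ?_⟩
  have hv := cellVol_pos hq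
  rw [Complex.norm_real, Real.norm_eq_abs, perCoeff_eq, abs_mul, abs_of_pos (inv_pos.2 hv)]
  gcongr
  exact abs_invSymbol_le ω j k hc (hcz z)

theorem exists_hasSum_perTerm {q : Fin n → ℝ} (hq : ∀ j, 0 < q j) (ω : ℝ) (j k : Fin n) :
    ∃ T, HasSum (perTerm q ω j k) T := by
  obtain ⟨B, hB⟩ := exists_norm_perCoeff_le hq ω j k
  obtain ⟨T, hT⟩ := exists_hasSum_sampling (p := fun z : {z : Fin n → ℤ // z ≠ 0} => dualPt q z) hB
    ((summable_one_add_norm_latticePt fun j => inv_pos.2 (hq j)).comp_injective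
      Subtype.val_injective)
  refine ⟨ContinuousLinearMap.toPointwiseConvergenceCLM ℂ (RingHom.id ℂ) _ _
    (T.comp (FourierTransform.fourierInvCLM ℂ _)), hasSum_temperedDistribution_iff.2 fun f => ?_⟩
  refine (hT (𝓕⁻ f)).congr_fun fun z => ?_
  show ((perCoeff q ω j k z : ℝ) : ℂ) * expDist (dualPt q z) f = _
  rw [expDist_apply]

theorem summable_perTerm {q : Fin n → ℝ} (hq : ∀ j, 0 < q j) (ω : ℝ) (j k : Fin n) :
    Summable (perTerm q ω j k) := (exists_hasSum_perTerm hq ω j k)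

theorem hasSum_perFund_apply {q : Fin n → ℝ} (hq : ∀ j, 0 < q j) (ω : ℝ) (j k : Fin n)
    (f : 𝓢(EuclideanSpace ℝ (Fin n), ℂ)) :
    HasSum (fun z : {z : Fin n → ℤ // z ≠ 0} => ((perCoeff q ω j k z : ℝ) : ℂ) * 𝓕⁻ f (dualPt q z))
      (perFund q ω j k f) := by
  have h := hasSum_temperedDistribution_iff.1 (summable_perTerm hq ω j k).hasSum f
  refine h.congr_fun fun z => ?_
  show _ = ((perCoeff q ω j k z : ℝ) : ℂ) * expDist (dualPt q z) f
  rw [expDist_apply]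

theorem summable_delta_latticePt {q : Fin n → ℝ} (hq : ∀ j, 0 < q j) :
    Summable fun z : Fin n → ℤ => TemperedDistribution.delta (latticePt q z) := by
  obtain ⟨T, hT⟩ := exists_hasSum_sampling (c := fun _ : Fin n → ℤ => (1 : ℂ)) (B := 1)
    (fun _ => by simp) (summable_one_add_norm_latticePt hq)
  refine ⟨ContinuousLinearMap.toPointwiseConvergenceCLM ℂ (RingHom.id ℂ) _ _ T,
    hasSum_temperedDistribution_iff.2 fun f => ?_⟩
  refine (hT f).congr_fun fun z => ?_
  rw [TemperedDistribution.delta_apply, one_mul]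

theorem hasSum_delta_apply {q : Fin n → ℝ} (hq : ∀ j, 0 < q j)
    (f : 𝓢(EuclideanSpace ℝ (Fin n), ℂ)) :
    HasSum (fun z : Fin n → ℤ => f (latticePt q z))
      ((∑' z : Fin n → ℤ, TemperedDistribution.delta (latticePt q z) :
        𝓢'(EuclideanSpace ℝ (Fin n), ℂ)) f) :=
  hasSum_temperedDistribution_iff.1 (summable_delta_latticePt hq).hasSum f

theorem translateDistr_perFund {q : Fin n → ℝ} (hq : ∀ j, 0 < q j) (ω : ℝ) (l j k : Fin n) :
    translateDistr (q l • EuclideanSpace.single l (1 : ℝ)) (perFund q ω j k) = perFund q ω j k := by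
  have hl : q l • EuclideanSpace.single l (1 : ℝ) = latticePt q (Pi.single l 1) := by
    ext i
    by_cases h : i = l
    · subst h; simp [latticePt]
    · simp [latticePt, h]
  ext f
  show perFund q ω j k (compSubConstCLM ℂ (-(q l • EuclideanSpace.single l (1 : ℝ))) f) = _
  refine (hasSum_perFund_apply hq ω j k _).unique
    ((hasSum_perFund_apply hq ω j k f).congr_fun fun z => ?_)
  have h1 : -dualPt q z = dualPt q (-z.1) := by simp only [dualPt_eq_latticePt, latticePt_neg]
  rw [fourierInv_translate, hl, h1, expFun_dualPt_latticePt hq, one_mul]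

/-- The reflection of the nonzero indices. -/
def negNe : {z : Fin n → ℤ // z ≠ 0} ≃ {z : Fin n → ℤ // z ≠ 0} :=
  (Equiv.neg (Fin n → ℤ)).subtypeEquiv fun z => by simp

theorem dualPt_negNe (q : Fin n → ℝ) (z : {z : Fin n → ℤ // z ≠ 0}) :
    dualPt q (negNe z) = -dualPt q z := latticePt_neg _ z.1

theorem conj_perFund {q : Fin n → ℝ} (hq : ∀ j, 0 < q j) (ω : ℝ) (j k : Fin n)
    (f : 𝓢(EuclideanSpace ℝ (Fin n), ℂ)) :
    (starRingEnd ℂ) (perFund q ω j k (conjS f)) = perFund q ω j k f := by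
  have h1 := (hasSum_perFund_apply hq ω j k (conjS f)).map (starRingEnd ℂ).toAddMonoidHom
    Complex.continuous_conj
  refine HasSum.unique (h1 : HasSum _ ((starRingEnd ℂ) _)) ?_
  refine (negNe.hasSum_iff.2 (hasSum_perFund_apply hq ω j k f)).congr_fun fun z => ?_
  show (starRingEnd ℂ) (_ * _) = _
  rw [map_mul, Complex.conj_ofReal, fourierInv_conjS, Complex.conj_conj]
  simp only [Function.comp_apply, perCoeff_eq, dualPt_negNe, invSymbol_neg]

/-- The action of `L[ω] U` on a Schwartz function: the two signs from transposing two derivatives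
cancel. -/
theorem lameOp_apply (ω : ℝ)
    (U : Matrix (Fin n) (Fin n) (𝓢'(EuclideanSpace ℝ (Fin n), ℂ))) (j k : Fin n)
    (f : 𝓢(EuclideanSpace ℝ (Fin n), ℂ)) :
    lameOp ω U j k f = (∑ l, U j k (secondDeriv l l f)) + ω * ∑ l, U l k (secondDeriv l j f) := by
  have hsum : ∀ (u : Fin n → 𝓢'(EuclideanSpace ℝ (Fin n), ℂ)) g, (∑ l, u l) g = ∑ l, u l g :=
    fun u g => map_sum (PointwiseConvergenceCLM.evalCLM (RingHom.id ℂ) ℂ g) u _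
  have hneg : ∀ (u : 𝓢'(EuclideanSpace ℝ (Fin n), ℂ)) g, u (-g) = - u g := fun u g => map_neg u g
  have hd : ∀ (u : 𝓢'(EuclideanSpace ℝ (Fin n), ℂ)) (l : Fin n) g,
      (∂_{EuclideanSpace.single l (1 : ℝ)} u) g = - u (∂_{EuclideanSpace.single l (1 : ℝ)} g) :=
    fun u l g => (TemperedDistribution.lineDerivOp_apply_apply u g _).trans (hneg _ _)
  have h0 : lameOp ω U j k f = (∑ l : Fin n, ∂_{EuclideanSpace.single l (1 : ℝ)}
      (∂_{EuclideanSpace.single l (1 : ℝ)} (U j k))) f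
      + ω • (∂_{EuclideanSpace.single j (1 : ℝ)}
          (∑ l : Fin n, ∂_{EuclideanSpace.single l (1 : ℝ)} (U l k))) f := rfl
  rw [h0, hsum, hd, hsum]
  simp only [hd, neg_neg, Finset.sum_neg_distrib, Complex.real_smul]
  rfl

/-- On the Fourier side every nonzero frequency has coefficient `1/|Q|`; the Poisson summation
formula identifies the sum over all frequencies, and the frequency `0` is missing. -/
theorem lameOp_perFund {q : Fin n → ℝ} (hq : ∀ j, 0 < q j) {ω : ℝ} (hω : ω + 1 ≠ 0) :
    lameOp ω (perFund q ω) = Matrix.diagonal (fun _ : Fin n =>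
      (∑' z : Fin n → ℤ, TemperedDistribution.delta (latticePt q z))
        - (((cellVol q)⁻¹ : ℝ) : ℂ) •
          (volume : Measure (EuclideanSpace ℝ (Fin n))).toTemperedDistribution) := by
  ext j k f
  have hs : HasSum (fun z : {z : Fin n → ℤ // z ≠ 0} =>
      (((cellVol q)⁻¹ : ℝ) : ℂ) * (if j = k then 1 else 0) * 𝓕⁻ f (dualPt q z))
      (lameOp ω (perFund q ω) j k f) := by
    rw [lameOp_apply]
    refine ((hasSum_sum fun l _ => hasSum_perFund_apply hq ω j k (secondDeriv l l f)).add
      ((hasSum_sum fun l _ => hasSum_perFund_apply hq ω l k (secondDeriv l j f)).mul_left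
        (ω : ℂ))).congr_fun fun z => ?_
    have hz : dualPt q z ≠ 0 := latticePt_ne_zero (fun j => inv_pos.2 (hq j)) z.2
    have hl := lameSymbol_invSymbol hω j k hz
    rw [lameSymbol] at hl
    have hl' := congrArg (fun t : ℝ => (t : ℂ)) hl
    have hδ : (((if j = k then 1 else 0 : ℝ)) : ℂ) = if j = k then 1 else 0 := by
      split_ifs <;> simp
    simp only [hδ] at hl'
    rw [← hl']
    simp only [perCoeff_eq, fourierInv_secondDeriv]
    push_cast
    simp only [add_mul, mul_add, Finset.sum_mul, Finset.mul_sum, neg_mul, mul_neg,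
      Finset.sum_neg_distrib]
    refine congrArg₂ (· + ·) ?_ ?_ <;>
      refine congrArg _ (Finset.sum_congr rfl fun l _ => ?_) <;> ring
  refine hs.unique ?_
  have hsm := (summable_fourierInv_dualPt hq f).of_norm
  have hP := poisson_schwartz hq f
  rw [tsum_eq_zero_add_tsum_ne hsm] at hP
  have h0 : dualPt q 0 = 0 := latticePt_zero _
  rw [h0, fourierInv_zero] at hP
  by_cases h : j = k
  · subst h
    rw [Matrix.diagonal_apply_eq]
    have e : ((∑' z : Fin n → ℤ, TemperedDistribution.delta (latticePt q z))
        - (((cellVol q)⁻¹ : ℝ) : ℂ) •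
          (volume : Measure (EuclideanSpace ℝ (Fin n))).toTemperedDistribution :
          𝓢'(EuclideanSpace ℝ (Fin n), ℂ)) f
        = (∑' z : Fin n → ℤ, TemperedDistribution.delta (latticePt q z) :
            𝓢'(EuclideanSpace ℝ (Fin n), ℂ)) f
          - (((cellVol q)⁻¹ : ℝ) : ℂ) * ∫ x, f x := rfl
    rw [e, ← (hasSum_delta_apply hq f).tsum_eq, hP]
    simp only [if_true, mul_one]
    rw [mul_add, add_sub_cancel_left]
    exact (summable_ne_zero_iff.2 hsm).hasSum.mul_left _
  · rw [Matrix.diagonal_apply_ne _ h]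
    simp only [if_neg h, mul_zero, zero_mul]
    exact hasSum_zero

end PeriodicDistribution

/-! ### Representation of the distribution by the periodic function -/

section Representation

open scoped FourierTransform

variable {n : ℕ}

/-- Fubini's theorem for the counting measure. -/
theorem integrable_tsum_of_summable_integral_norm {X ι : Type*} [MeasurableSpace X] {μ : Measure X}
    [SFinite μ] [Countable ι] {F : ι → X → ℂ} (hm : ∀ i, Measurable (F i))
    (hi : ∀ i, Integrable (F i) μ) (hs : Summable fun i => ∫ x, ‖F i x‖ ∂μ) :
    Integrable (fun x => ∑' i, F i x) μ := by
  let _ : MeasurableSpace ι := ⊤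
  have hp : Integrable (fun p : ι × X => F p.1 p.2) (Measure.count.prod μ) := by
    refine (integrable_prod_iff
      (measurable_from_prod_countable_right hm).aestronglyMeasurable).2
      ⟨Filter.Eventually.of_forall hi, integrable_count_iff.2 ?_⟩
    refine hs.congr fun i => ?_
    rw [Real.norm_of_nonneg (integral_nonneg fun x => norm_nonneg _)]
  refine hp.integral_prod_right.congr ?_
  filter_upwards [hp.prod_left_ae] with x hx
  exact integral_count_eq_tsum hx

theorem measurable_shortPart (ω : ℝ) (j k : Fin n) (a : ℝ) :
    Measurable (shortPart (n := n) ω j k a) :=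
  ((measurable_heatKer ω j k).stronglyMeasurable.integral_prod_right').measurable

/-- The translate `f(· + y)`. -/
theorem compSubConstCLM_neg_apply (f : 𝓢(EuclideanSpace ℝ (Fin n), ℂ))
    (y x : EuclideanSpace ℝ (Fin n)) : compSubConstCLM ℂ (-y) f x = f (x + y) := by
  rw [compSubConstCLM_apply, sub_neg_eq_add]

theorem integrable_shortPart_mul_translate (ω : ℝ) (j k : Fin n)
    (f : 𝓢(EuclideanSpace ℝ (Fin n), ℂ)) (w : EuclideanSpace ℝ (Fin n)) :
    Integrable fun y => (shortPart ω j k 1 y : ℂ) * f (y + w) := by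
  have := integrable_shortPart_mul ω j k one_pos (compSubConstCLM ℂ (-w) f)
  simpa only [compSubConstCLM_neg_apply] using this

theorem summable_integral_norm_shortPart_mul_translate {q : Fin n → ℝ} (hq : ∀ j, 0 < q j) (ω : ℝ)
    (j k : Fin n) (f : 𝓢(EuclideanSpace ℝ (Fin n), ℂ)) :
    Summable fun z : Fin n → ℤ => ∫ y, ‖(shortPart ω j k 1 y : ℂ) * f (y + latticePt q z)‖ := by
  obtain ⟨C, hC, hdec⟩ := schwartz_translate_decay f (n + 1)
  have hA := (integrable_pow_mul_shortPart (n := n) ω j k one_pos (n + 1)).norm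
  refine Summable.of_nonneg_of_le (fun z => integral_nonneg fun _ => norm_nonneg _) (fun z => ?_)
    ((summable_one_add_norm_latticePt hq).mul_left
      (C * ∫ x, ‖(1 + ‖x‖) ^ (n + 1) * shortPart (n := n) ω j k 1 x‖))
  have e : C * (∫ x, ‖(1 + ‖x‖) ^ (n + 1) * shortPart (n := n) ω j k 1 x‖)
      * ((1 + ‖latticePt q z‖) ^ (n + 1))⁻¹
      = ∫ x, C * ((1 + ‖latticePt q z‖) ^ (n + 1))⁻¹ *
        ‖(1 + ‖x‖) ^ (n + 1) * shortPart (n := n) ω j k 1 x‖ := by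
    rw [integral_const_mul]; ring
  rw [e]
  refine integral_mono (integrable_shortPart_mul_translate ω j k f _).norm (hA.const_mul _)
    fun x => ?_
  simp only [norm_mul, Complex.norm_real, norm_pow]
  rw [Real.norm_of_nonneg (by positivity : 0 ≤ 1 + ‖x‖)]
  calc _ ≤ ‖shortPart ω j k 1 x‖ *
        (C * (1 + ‖x‖) ^ (n + 1) * ((1 + ‖latticePt q z‖) ^ (n + 1))⁻¹) := by
        gcongr; exact hdec x _
    _ = _ := by ring

/-- The pairing of the lattice sum of the short range part with a Schwartz function, through the
Poisson summation formula. -/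
theorem integral_tsum_shortPart_mul {q : Fin n → ℝ} (hq : ∀ j, 0 < q j) (ω : ℝ) (j k : Fin n)
    (f : 𝓢(EuclideanSpace ℝ (Fin n), ℂ)) :
    Integrable (fun x => ((∑' z, shortPart ω j k 1 (x - latticePt q z) : ℝ) : ℂ) * f x) ∧
    HasSum (fun z : Fin n → ℤ => (((cellVol q)⁻¹ : ℝ) : ℂ) *
      ((∫ y, expFun (-dualPt q z) y * (shortPart ω j k 1 y : ℂ)) * 𝓕⁻ f (dualPt q z)))
      (∫ x, ((∑' z, shortPart ω j k 1 (x - latticePt q z) : ℝ) : ℂ) * f x) := by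
  have hAm : Measurable fun x : EuclideanSpace ℝ (Fin n) => (shortPart ω j k 1 x : ℂ) :=
    Complex.measurable_ofReal.comp (measurable_shortPart ω j k 1)
  have hfm : Measurable f := f.continuous.measurable
  -- the sum over the lattice, before and after the translations
  set F : (Fin n → ℤ) → EuclideanSpace ℝ (Fin n) → ℂ := fun z y =>
    (shortPart ω j k 1 y : ℂ) * f (y + latticePt q z) with hF
  set F' : (Fin n → ℤ) → EuclideanSpace ℝ (Fin n) → ℂ := fun z x =>
    (shortPart ω j k 1 (x - latticePt q z) : ℂ) * f x with hF'
  have hFF' : ∀ z x, F' z x = F z (x - latticePt q z) := fun z x => by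
    simp only [hF, hF', sub_add_cancel]
  have hFi : ∀ z, Integrable (F z) := fun z => integrable_shortPart_mul_translate ω j k f _
  have hFs : Summable fun z => ∫ y, ‖F z y‖ :=
    summable_integral_norm_shortPart_mul_translate hq ω j k f
  have hFi' : ∀ z, Integrable (F' z) := fun z => by
    simp only [funext (hFF' z)]
    exact (hFi z).comp_sub_right _
  have hFm' : ∀ z, Measurable (F' z) := fun z =>
    (hAm.comp (measurable_id.sub_const _)).mul hfm
  have hFs' : Summable fun z => ∫ x, ‖F' z x‖ := by
    refine hFs.congr fun z => ?_
    simp only [hFF']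
    exact (integral_sub_right_eq_self (fun y => ‖F z y‖) _).symm
  have e1 : ∀ x, ((∑' z, shortPart ω j k 1 (x - latticePt q z) : ℝ) : ℂ) * f x = ∑' z, F' z x := by
    intro x
    rw [Complex.ofReal_tsum, ← tsum_mul_right]
  simp only [e1]
  refine ⟨integrable_tsum_of_summable_integral_norm hFm' hFi' hFs', ?_⟩
  have h1 := hasSum_integral_of_summable_integral_norm hFi' hFs'
  have h2 := hasSum_integral_of_summable_integral_norm hFi hFs
  have e2 : ∫ x, ∑' z, F' z x = ∫ y, ∑' z, F z y := by
    rw [← h1.tsum_eq, ← h2.tsum_eq]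
    refine tsum_congr fun z => ?_
    simp only [hFF']
    exact integral_sub_right_eq_self (fun y => F z y) _
  rw [e2]
  -- Poisson summation under the integral sign
  have e3 : ∀ y, ∑' z, F z y = ∑' z, (((cellVol q)⁻¹ : ℝ) : ℂ) *
      ((expFun (-dualPt q z) y * (shortPart ω j k 1 y : ℂ)) * 𝓕⁻ f (dualPt q z)) := by
    intro y
    have hP := poisson_schwartz hq (compSubConstCLM ℂ (-y) f)
    simp only [compSubConstCLM_neg_apply, fourierInv_translate] at hP
    simp only [hF, add_comm y]
    rw [tsum_mul_left, hP, tsum_mul_left]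
    rw [mul_left_comm, ← tsum_mul_left]
    congr 1
    exact tsum_congr fun z => by ring
  simp only [e3]
  have hAi := (integrable_shortPart (n := n) ω j k one_pos).ofReal (𝕜 := ℂ)
  have hGi : ∀ z : Fin n → ℤ, Integrable fun y => (((cellVol q)⁻¹ : ℝ) : ℂ) *
      ((expFun (-dualPt q z) y * (shortPart ω j k 1 y : ℂ)) * 𝓕⁻ f (dualPt q z)) := fun z =>
    ((hAi.bdd_mul (c := 1) (continuous_expFun _).aestronglyMeasurable
      (Filter.Eventually.of_forall fun y => (norm_expFun _ _).le)).mul_const _).const_mul _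
  have h3 := hasSum_integral_of_summable_integral_norm hGi ?_
  · refine h3.congr_fun fun z => ?_
    rw [integral_const_mul, integral_mul_const]
  · have hsm := (summable_fourierInv_dualPt hq f).mul_left
      (‖(((cellVol q)⁻¹ : ℝ) : ℂ)‖ * ∫ y, ‖(shortPart (n := n) ω j k 1 y : ℂ)‖)
    refine hsm.congr fun z => ?_
    simp only [norm_mul, norm_expFun, one_mul]
    rw [integral_const_mul, integral_mul_const, mul_assoc]

theorem ofReal_longSum {q : Fin n → ℝ} (hq : ∀ j, 0 < q j) (ω : ℝ) (j k : Fin n)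
    (x : EuclideanSpace ℝ (Fin n)) : (longSum q ω j k x : ℂ) = ∑' z : {z : Fin n → ℤ // z ≠ 0},
      (longSymbol ω j k 1 (dualPt q z) : ℂ) * expFun (dualPt q z) x := by
  rw [longSum_eq_re hq]
  refine Complex.conj_eq_iff_re.1 ?_
  rw [Complex.conj_tsum, ← negNe.tsum_eq]
  refine tsum_congr fun z => ?_
  rw [map_mul, Complex.conj_ofReal, conj_expFun, dualPt_negNe, longSymbol_neg, neg_neg]

theorem integral_longSum_mul {q : Fin n → ℝ} (hq : ∀ j, 0 < q j) (ω : ℝ) (j k : Fin n)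
    (f : 𝓢(EuclideanSpace ℝ (Fin n), ℂ)) :
    Integrable (fun x => (longSum q ω j k x : ℂ) * f x) ∧
    HasSum (fun z : {z : Fin n → ℤ // z ≠ 0} =>
      (longSymbol ω j k 1 (dualPt q z) : ℂ) * 𝓕⁻ f (dualPt q z))
      (∫ x, (longSum q ω j k x : ℂ) * f x) := by
  set F : {z : Fin n → ℤ // z ≠ 0} → EuclideanSpace ℝ (Fin n) → ℂ := fun z x =>
    (longSymbol ω j k 1 (dualPt q z) : ℂ) * (expFun (dualPt q z) x * f x) with hF
  have e : ∀ x, (longSum q ω j k x : ℂ) * f x = ∑' z, F z x := by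
    intro x
    rw [ofReal_longSum hq, ← tsum_mul_right]
    exact tsum_congr fun z => mul_assoc _ _ _
  have hFm : ∀ z, Measurable (F z) := fun z =>
    (((continuous_expFun _).mul f.continuous).measurable).const_mul _
  have hFi : ∀ z, Integrable (F z) := fun z =>
    (f.integrable.bdd_mul (c := 1) (continuous_expFun _).aestronglyMeasurable
      (Filter.Eventually.of_forall fun y => (norm_expFun _ _).le)).const_mul _
  have hFs : Summable fun z => ∫ x, ‖F z x‖ := by
    refine ((summable_longSymbol hq ω j k).mul_right (∫ x, ‖f x‖)).congr fun z => ?_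
    simp only [hF, norm_mul, norm_expFun, one_mul, Complex.norm_real, Real.norm_eq_abs]
    rw [integral_const_mul]
  simp only [e]
  refine ⟨integrable_tsum_of_summable_integral_norm hFm hFi hFs,
    (hasSum_integral_of_summable_integral_norm hFi hFs).congr_fun fun z => ?_⟩
  rw [integral_const_mul, fourierInv_eq_integral_expFun]

/-- The periodic function represents the sum of the Fourier series: the short range part
contributes `invSymbol - longSymbol` at each nonzero frequency, the long range part `longSymbol`,
and the two constants cancel at frequency zero. -/
theorem perFund_apply_eq_integral {q : Fin n → ℝ} (hq : ∀ j, 0 < q j) {ω : ℝ} (hω : ω + 1 ≠ 0)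
    (j k : Fin n) (f : 𝓢(EuclideanSpace ℝ (Fin n), ℂ)) :
    Integrable (fun x => (perFun q ω x j k : ℂ) * f x) ∧
    perFund q ω j k f = ∫ x, (perFun q ω x j k : ℂ) * f x := by
  obtain ⟨hS, hSsum⟩ := integral_tsum_shortPart_mul hq ω j k f
  obtain ⟨hL, hLsum⟩ := integral_longSum_mul hq ω j k f
  set V : ℂ := (((cellVol q)⁻¹ : ℝ) : ℂ) with hV
  set D : ℝ := if j = k then 1 else 0 with hD
  have e : ∀ x, (perFun q ω x j k : ℂ) * f x
      = ((∑' z, shortPart ω j k 1 (x - latticePt q z) : ℝ) : ℂ) * f x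
        + (V * ((longSum q ω j k x : ℂ) * f x) + V * (D / 4) * f x) := by
    intro x
    simp only [perFun, Matrix.of_apply, ← hD, hV]
    push_cast
    ring
  have hc : Integrable fun x => V * (D / 4) * f x := f.integrable.const_mul _
  simp only [e]
  refine ⟨hS.add ((hL.const_mul V).add hc), ?_⟩
  have hI : ∫ x, (((∑' z, shortPart ω j k 1 (x - latticePt q z) : ℝ) : ℂ) * f x
        + (V * ((longSum q ω j k x : ℂ) * f x) + V * (D / 4) * f x))
      = (∫ x, ((∑' z, shortPart ω j k 1 (x - latticePt q z) : ℝ) : ℂ) * f x)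
        + (V * (∫ x, (longSum q ω j k x : ℂ) * f x) + V * (D / 4) * ∫ x, f x) := by
    refine (integral_add hS ((hL.const_mul V).add hc)).trans ?_
    refine congrArg₂ _ rfl ?_
    refine (integral_add (hL.const_mul V) hc).trans ?_
    rw [integral_const_mul, integral_const_mul]
  rw [hI, ← hSsum.tsum_eq, tsum_eq_zero_add_tsum_ne hSsum.summable]
  have h0 : dualPt q 0 = 0 := latticePt_zero _
  have hz : ∀ z : {z : Fin n → ℤ // z ≠ 0}, dualPt q z ≠ 0 := fun z =>
    latticePt_ne_zero (fun j => inv_pos.2 (hq j)) z.2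
  rw [h0, neg_zero, fourierInv_zero]
  simp only [expFun_zero_left, one_mul]
  rw [integral_shortPart hω j k one_pos, ← hD]
  have h1 := summable_ne_zero_iff.2 hSsum.summable
  have h2 := hLsum.summable.mul_left V
  rw [← hLsum.tsum_eq, ← tsum_mul_left]
  have h3 : perFund q ω j k f
      = (∑' z : {z : Fin n → ℤ // z ≠ 0}, V *
          ((∫ y, expFun (-dualPt q z) y * (shortPart ω j k 1 y : ℂ)) * 𝓕⁻ f (dualPt q z)))
        + ∑' z : {z : Fin n → ℤ // z ≠ 0},
          V * ((longSymbol ω j k 1 (dualPt q z) : ℂ) * 𝓕⁻ f (dualPt q z)) := by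
    rw [← h1.tsum_add h2, ← (hasSum_perFund_apply hq ω j k f).tsum_eq]
    refine tsum_congr fun z => ?_
    rw [integral_expFun_mul_shortPart hω j k one_pos (neg_ne_zero.2 (hz z)), invSymbol_neg,
      longSymbol_neg, perCoeff_eq, hV]
    push_cast
    ring
  rw [h3]
  push_cast
  ring

/-- A smooth compactly supported real function, as a complex Schwartz function. -/
noncomputable def complexSchwartz {g : EuclideanSpace ℝ (Fin n) → ℝ} (hc : HasCompactSupport g)
    (hs : ContDiff ℝ (⊤ : ℕ∞) g) : 𝓢(EuclideanSpace ℝ (Fin n), ℂ) :=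
  HasCompactSupport.toSchwartzMap (f := fun x => (g x : ℂ)) (hc.comp_left (g := Complex.ofReal) rfl)
    (Complex.ofRealCLM.contDiff.comp hs)

theorem complexSchwartz_apply {g : EuclideanSpace ℝ (Fin n) → ℝ} (hc : HasCompactSupport g)
    (hs : ContDiff ℝ (⊤ : ℕ∞) g) (x : EuclideanSpace ℝ (Fin n)) :
    complexSchwartz hc hs x = (g x : ℂ) := rfl

/-- A function whose products with all Schwartz functions are integrable is locally integrable. -/
theorem locallyIntegrable_of_integrable_mul_schwartz {g : EuclideanSpace ℝ (Fin n) → ℝ}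
    (hg : ∀ f : 𝓢(EuclideanSpace ℝ (Fin n), ℂ), Integrable fun x => (g x : ℂ) * f x) :
    LocallyIntegrable g volume := by
  rw [locallyIntegrable_iff]
  intro K hK
  obtain ⟨R, hR0, hR⟩ := hK.isBounded.exists_pos_norm_le
  let b : ContDiffBump (0 : EuclideanSpace ℝ (Fin n)) := ⟨R, R + 1, hR0, by linarith⟩
  have h := (hg (complexSchwartz b.hasCompactSupport b.contDiff)).integrableOn (s := K)
  have h2 : IntegrableOn (fun x => (g x : ℂ)) K := by
    refine h.congr_fun (fun x hx => ?_) hK.measurableSet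
    have : b x = 1 := b.one_of_mem_closedBall (by simpa using hR x hx)
    simp only [complexSchwartz_apply, this, Complex.ofReal_one, mul_one]
  exact Integrable.re (𝕜 := ℂ) h2

end Representation

/-! ### The equation satisfied by the regular part -/

section RegularPart

variable {n : ℕ}

/-- A test function, as a complex Schwartz function. -/
noncomputable def testSchwartz
    (φ : 𝓓((⊤ : TopologicalSpace.Opens (EuclideanSpace ℝ (Fin n))), ℝ)) :
    𝓢(EuclideanSpace ℝ (Fin n), ℂ) :=
  complexSchwartz φ.hasCompactSupport φ.contDiff

theorem testSchwartz_apply (φ : 𝓓((⊤ : TopologicalSpace.Opens (EuclideanSpace ℝ (Fin n))), ℝ))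
    (x : EuclideanSpace ℝ (Fin n)) : testSchwartz φ x = (φ x : ℂ) := rfl

theorem testSchwartz_lineDeriv (φ : 𝓓((⊤ : TopologicalSpace.Opens (EuclideanSpace ℝ (Fin n))), ℝ))
    (v : EuclideanSpace ℝ (Fin n)) : testSchwartz (∂_{v} φ) = ∂_{v} (testSchwartz φ) := by
  ext x
  have h1 : (∂_{v} φ) x = lineDeriv ℝ φ x v := TestFunction.lineDerivCLM_apply_of_le (by simp)
  have hd : DifferentiableAt ℝ φ x := (φ.contDiff.differentiable (by simp)).differentiableAt
  have h2 : HasLineDerivAt ℝ (fun y => (φ y : ℂ)) ((lineDeriv ℝ φ x v : ℝ) : ℂ) x v :=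
    (hd.lineDifferentiableAt.hasLineDerivAt (v := v)).ofReal_comp
  rw [testSchwartz_apply, h1, SchwartzMap.lineDerivOp_apply]
  exact h2.lineDeriv.symm

theorem toDistr_apply {g : EuclideanSpace ℝ (Fin n) → ℝ} (hg : LocallyIntegrable g volume)
    (φ : 𝓓((⊤ : TopologicalSpace.Opens (EuclideanSpace ℝ (Fin n))), ℝ)) :
    ((toDistr g φ : ℝ) : ℂ) = ∫ x, (g x : ℂ) * testSchwartz φ x := by
  have h : toDistr g φ = ∫ x, φ x * g x :=
    TestFunction.integralAgainstBilinCLM_eq_integral (hg.locallyIntegrableOn _)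
  rw [h, ← integral_complex_ofReal]
  refine integral_congr_ae (Filter.Eventually.of_forall fun x => ?_)
  simp only [testSchwartz_apply, Complex.ofReal_mul, mul_comm]

/-- The distributional `L[ω]` of a matrix of locally integrable functions is `lamePairing`. -/
theorem lameOp_toDistr_apply (ω : ℝ) {u : Fin n → Fin n → EuclideanSpace ℝ (Fin n) → ℝ}
    (hu : ∀ j k, LocallyIntegrable (u j k) volume) (j k : Fin n)
    (φ : 𝓓((⊤ : TopologicalSpace.Opens (EuclideanSpace ℝ (Fin n))), ℝ)) :
    ((lameOp ω (Matrix.of fun j k => toDistr (u j k)) j k φ : ℝ) : ℂ)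
      = lamePairing ω u j k (testSchwartz φ) := by
  have hsum : ∀ (T : Fin n → 𝓓'((⊤ : TopologicalSpace.Opens (EuclideanSpace ℝ (Fin n))), ℝ)) g,
      (∑ l, T l) g = ∑ l, T l g := fun T g => by
    rw [sum_apply]
  have hd : ∀ (T : 𝓓'((⊤ : TopologicalSpace.Opens (EuclideanSpace ℝ (Fin n))), ℝ)) (l : Fin n) g,
      (∂_{EuclideanSpace.single l (1 : ℝ)} T) g = - T (∂_{EuclideanSpace.single l (1 : ℝ)} g) :=
    fun T l g => (Distribution.lineDerivOp_apply_apply T g _).trans (map_neg T _)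
  have h0 : lameOp ω (Matrix.of fun j k => toDistr (u j k)) j k φ
      = (∑ l : Fin n, ∂_{EuclideanSpace.single l (1 : ℝ)}
          (∂_{EuclideanSpace.single l (1 : ℝ)} (toDistr (u j k)))) φ
      + ω * (∂_{EuclideanSpace.single j (1 : ℝ)}
          (∑ l : Fin n, ∂_{EuclideanSpace.single l (1 : ℝ)} (toDistr (u l k)))) φ := rfl
  rw [h0, hsum, hd, hsum]
  simp only [hd, neg_neg, Finset.sum_neg_distrib]
  push_cast
  simp only [toDistr_apply (hu _ _), testSchwartz_lineDeriv]
  rfl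

theorem lamePairing_perFun {q : Fin n → ℝ} (hq : ∀ j, 0 < q j) {ω : ℝ} (hω : ω + 1 ≠ 0)
    (j k : Fin n) (f : 𝓢(EuclideanSpace ℝ (Fin n), ℂ)) :
    lamePairing ω (fun j k x => perFun q ω x j k) j k f
      = if j = k then (∑' z : Fin n → ℤ, f (latticePt q z))
          - (((cellVol q)⁻¹ : ℝ) : ℂ) * ∫ x, f x else 0 := by
  have h := lameOp_apply ω (perFund q ω) j k f
  simp only [(perFund_apply_eq_integral hq hω _ _ _).2] at h
  rw [lamePairing, ← h, lameOp_perFund hq hω]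
  by_cases hjk : j = k
  · subst hjk
    rw [Matrix.diagonal_apply_eq, if_pos rfl, (hasSum_delta_apply hq f).tsum_eq]
    rfl
  · rw [Matrix.diagonal_apply_ne _ hjk, if_neg hjk]
    rfl

theorem ae_notMem_lattice (hn : 0 < n) (q : Fin n → ℝ) :
    ∀ᵐ x : EuclideanSpace ℝ (Fin n), x ∉ lattice q := by
  have : Nonempty (Fin n) := ⟨⟨0, hn⟩⟩
  exact (Set.countable_range (latticePt q)).ae_notMem volume

theorem integrable_perReg_mul (hn : 0 < n) {q : Fin n → ℝ} (hq : ∀ j, 0 < q j) {ω : ℝ}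
    (hω : ω + 1 ≠ 0) (C : ℝ) (j k : Fin n) (f : 𝓢(EuclideanSpace ℝ (Fin n), ℂ)) :
    Integrable (fun x => (perReg q ω C x j k : ℂ) * f x) ∧
      ∫ x, (perReg q ω C x j k : ℂ) * f x
        = (∫ x, (perFun q ω x j k : ℂ) * f x) - ∫ x, (elasticFund ω x j k : ℂ) * f x := by
  have h1 := (perFund_apply_eq_integral hq hω j k f).1
  obtain ⟨_, hE⟩ := exists_integrable_elasticFund_mul hn hω j k
  have h2 := (hE f).1
  have e : (fun x => (perFun q ω x j k : ℂ) * f x - (elasticFund ω x j k : ℂ) * f x)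
      =ᵐ[volume] fun x => (perReg q ω C x j k : ℂ) * f x := by
    filter_upwards [ae_notMem_lattice hn q] with x hx
    rw [perReg_of_notMem ω C hx, Matrix.sub_apply]
    push_cast
    ring
  exact ⟨(h1.sub h2).congr e, by rw [← integral_congr_ae e, integral_sub h1 h2]⟩

theorem lamePairing_perReg (hn : 0 < n) {q : Fin n → ℝ} (hq : ∀ j, 0 < q j) {ω : ℝ}
    (hω : ω + 1 ≠ 0) (C : ℝ) (j k : Fin n) (f : 𝓢(EuclideanSpace ℝ (Fin n), ℂ)) :
    lamePairing ω (fun j k x => perReg q ω C x j k) j k f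
      = if j = k then (∑' z : {z : Fin n → ℤ // z ≠ 0}, f (latticePt q z))
          - (((cellVol q)⁻¹ : ℝ) : ℂ) * ∫ x, f x else 0 := by
  have h : lamePairing ω (fun j k x => perReg q ω C x j k) j k f
      = lamePairing ω (fun j k x => perFun q ω x j k) j k f
        - lamePairing ω (fun j k x => elasticFund ω x j k) j k f := by
    simp only [lamePairing, (integrable_perReg_mul hn hq hω C _ _ _).2, Finset.sum_sub_distrib,
      mul_sub]
    ring
  rw [h, lamePairing_perFun hq hω, lamePairing_elasticFund hn hω]
  split_ifs
  · rw [tsum_eq_zero_add_tsum_ne (summable_norm_schwartz_latticePt hq f).of_norm, latticePt_zero]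
    ring
  · simp

end RegularPart
end PeriodicElastic

theorem mainTheorem4 (n : ℕ) (hn : 2 ≤ n) (q : Fin n → ℝ) (hq : ∀ j, 0 < q j)
    (ω : ℝ) (hω : 1 - 2 / (n : ℝ) < ω) :
    -- the Fourier series converge (unconditionally) in the space of tempered distributions
    (∀ j k, Summable (PeriodicElastic.perTerm q ω j k)) ∧
    -- periodicity
    (∀ l j k, PeriodicElastic.translateDistr (q l • EuclideanSpace.single l (1 : ℝ))
        (PeriodicElastic.perFund q ω j k) = PeriodicElastic.perFund q ω j k) ∧
    -- reality
    (∀ (j k : Fin n) (f : 𝓢(EuclideanSpace ℝ (Fin n), ℂ)),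
      (starRingEnd ℂ) (PeriodicElastic.perFund q ω j k (PeriodicElastic.conjS f))
        = PeriodicElastic.perFund q ω j k f) ∧
    -- the equation satisfied by the periodic fundamental solution
    (Summable fun z : Fin n → ℤ =>
      TemperedDistribution.delta (PeriodicElastic.latticePt q z)) ∧
    PeriodicElastic.lameOp ω (PeriodicElastic.perFund q ω)
      = Matrix.diagonal (fun _ : Fin n =>
          (∑' z : Fin n → ℤ, TemperedDistribution.delta (PeriodicElastic.latticePt q z))
            - (((PeriodicElastic.cellVol q)⁻¹ : ℝ) : ℂ) •
              (volume : Measure (EuclideanSpace ℝ (Fin n))).toTemperedDistribution) ∧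
    ∃ G : EuclideanSpace ℝ (Fin n) → Matrix (Fin n) (Fin n) ℝ,
      -- the distribution is given by the real locally integrable function `G`
      (∀ j k, LocallyIntegrable (fun x => G x j k) volume) ∧
      (∀ (j k : Fin n) (f : 𝓢(EuclideanSpace ℝ (Fin n), ℂ)),
        Integrable (fun x => (G x j k : ℂ) * f x) volume ∧
        PeriodicElastic.perFund q ω j k f = ∫ x, (G x j k : ℂ) * f x) ∧
      -- which is real analytic off the lattice
      (∀ j k, AnalyticOnNhd ℝ (fun x => G x j k) (PeriodicElastic.lattice q)ᶜ) ∧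
      -- the difference with the fundamental solution of `L[ω]` is analytic near `0`
      (∃ R : EuclideanSpace ℝ (Fin n) → Matrix (Fin n) (Fin n) ℝ,
        (∀ j k, AnalyticOnNhd ℝ (fun x => R x j k) ((PeriodicElastic.lattice q)ᶜ ∪ {0})) ∧
        (∀ x ∉ PeriodicElastic.lattice q, R x = G x - PeriodicElastic.elasticFund ω x) ∧
        (∀ j k, LocallyIntegrable (fun x => R x j k) volume) ∧
        (∀ (j k : Fin n) (φ : 𝓓((⊤ : TopologicalSpace.Opens (EuclideanSpace ℝ (Fin n))), ℝ)),
          (Summable fun z : {z : Fin n → ℤ // z ≠ 0} => φ (PeriodicElastic.latticePt q z)) ∧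
          PeriodicElastic.lameOp ω
              (Matrix.of fun j k => PeriodicElastic.toDistr fun x => R x j k) j k φ
            = if j = k then
                (∑' z : {z : Fin n → ℤ // z ≠ 0}, φ (PeriodicElastic.latticePt q z))
                  - (PeriodicElastic.cellVol q)⁻¹ * ∫ x, φ x
              else 0)) ∧
      -- evenness
      (∀ x ∉ PeriodicElastic.lattice q, G x = G (-x))
  := by
  have hn0 : 0 < n := by omega
  have hω1 : ω + 1 ≠ 0 := by
    have hn2 : (2 : ℝ) ≤ n := by exact_mod_cast hn
    have : 2 / (n : ℝ) ≤ 1 := by rw [div_le_one (by linarith)]; exact hn2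
    linarith
  obtain ⟨C, hC⟩ := PeriodicElastic.exists_elasticFund_eq hn0 ω hω1
  have hR : ∀ j k, LocallyIntegrable (fun x => PeriodicElastic.perReg q ω C x j k) volume :=
    fun j k => PeriodicElastic.locallyIntegrable_of_integrable_mul_schwartz fun f =>
      (PeriodicElastic.integrable_perReg_mul hn0 hq hω1 C j k f).1
  refine ⟨PeriodicElastic.summable_perTerm hq ω, PeriodicElastic.translateDistr_perFund hq ω,
    PeriodicElastic.conj_perFund hq ω, PeriodicElastic.summable_delta_latticePt hq,
    PeriodicElastic.lameOp_perFund hq hω1, PeriodicElastic.perFun q ω, fun j k =>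
      PeriodicElastic.locallyIntegrable_of_integrable_mul_schwartz fun f =>
        (PeriodicElastic.perFund_apply_eq_integral hq hω1 j k f).1,
    PeriodicElastic.perFund_apply_eq_integral hq hω1,
    fun j k x hx => PeriodicElastic.analyticAt_perFun hn0 hq ω j k hx,
    ⟨PeriodicElastic.perReg q ω C, PeriodicElastic.analyticOnNhd_perReg hn0 hq hC,
      fun x hx => PeriodicElastic.perReg_of_notMem ω C hx, hR, fun j k φ => ?_⟩,
    fun x _ => (PeriodicElastic.perFun_neg q ω x).symm⟩
  have hφ := PeriodicElastic.summable_norm_schwartz_latticePt hq (PeriodicElastic.testSchwartz φ)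
  have hφ' : Summable fun z : Fin n → ℤ => φ (PeriodicElastic.latticePt q z) := by
    refine Summable.of_norm (hφ.congr fun z => ?_)
    rw [PeriodicElastic.testSchwartz_apply, Complex.norm_real]
  refine ⟨hφ'.subtype _, ?_⟩
  apply Complex.ofReal_injective
  rw [PeriodicElastic.lameOp_toDistr_apply ω hR, PeriodicElastic.lamePairing_perReg hn0 hq hω1]
  simp only [PeriodicElastic.testSchwartz_apply, integral_complex_ofReal]
  split_ifs
  · push_cast
    rfl
  · simp
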